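/- Let $V$ be a vector space of finite dimension $n\ge 1$ over a field $\mathbb F$ with $\operatorname{char}\mathbb F\neq 2$, with basis $v_1,\dots,v_n$ and dual basis $x_1,\dots,x_n$ of $V^*$, and let $S=S(V^*)=\mathbb F[x_1,\dots,x_n]$. Let $G\subset \mathrm{GL}(V)$ be a reflection group, i.e. a finite group generated by reflections (nonidentity elements fixing a hyperplane pointwise), acting on $V^*$ by the dual action, on $S$ by the induced algebra automorphisms, and diagonally on tensor products over $\mathbb F$. Let $\mathcal A$ be the set of hyperplanes $H$ fixed pointwise by some reflection in $G$. For $H\in\mathcal A$ fix $\ell_H\in V^*$ with $\ker \ell_H=H$, let $G_H$ be the pointwise stabilizer of $H$ in $G$, let $K_H$ be the kernel of $\det$ on $G_H$, and put $e_H=|G_H:K_H|$. Set $$Q_{\det}=\prod_{H\in\mathcal A}\ell_H^{\,e_H-1},\qquad Q^e=\prod_{H\in\mathcal A}\ell_H^{\,e_H}$$ (the second is the $e$-th power of $Q=\prod_{H}\ell_H$ for the common value $e$ of the $e_H$). Assume that all transvection root spaces of $G$ are maximal: for every $H\in\mathcal A$, the images of $s-1$, for $s$ running over the transvections in $G$ about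 $H$ (the reflections $s\in G$ about $H$ with $\operatorname{Im}(s-1)\subset H$), span $H$. Suppose that $(S\otimes V)^G$ is a free $S^G$-module with basis $\theta_1,\dots,\theta_n$, and define the dual $1$-forms $$\omega_i=(1\otimes\Phi)\big(Q_{\det}\,\theta_1\wedge\cdots\wedge\widehat{\theta_i}\wedge\cdots\wedge\theta_n\big)\in S\otimes V^*,$$ where $\Phi:\wedge^{n-1}V\to V^*$ sends $\beta$ to the linear form $u\mapsto (u\wedge\beta)/(v_1\wedge\cdots\wedge v_n)$. For $I=\{i_1<\dots<i_k\}\subset[n]=\{1,\dots,n\}$ with $k\ge 1$, the element $\omega_{i_1}\wedge\cdots\wedge\omega_{i_k}$ of $S\otimes\wedge V^*$ is divisible by $(Q^e)^{k-1}$; let $$\omega_I^{\curlywedge}=\omega_{i_1}\curlywedge\cdots\curlywedge\omega_{i_k}=\frac{\omega_{i_1}\wedge\cdots\wedge\omega_{i_k}}{(Q^{e})^{k-1}}\in S\otimes\wedge V^*$$ be the twisted wedge product, with $\omega_\varnothing^{\curlywedge}=1\otimes 1$. Let $d\theta_E=\sum_{i=1}^n 1\otimes x_i\otimes v_i$, and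 multiply forms and derivations by $(f\otimes x)(f'\otimes v)=ff'\otimes x\otimes v$. Then $(S\otimes\wedge V^*\otimes V)^G$ is a free $S^G$-module, and for every $r\in\{1,\dots,n\}$ a basis is given by $d\theta_E$ together with the family of all $\omega_I^{\curlywedge}\,\theta_j$ with $I\subset[n]$, $1\le j\le n$ and $(I,j)\neq(\{r\},r)$. -/

import Mathlib

open scoped TensorProduct
open Module

namespace InvDiffDer

noncomputable section

section Spaces

variable (F V : Type*) [Field F] [AddCommGroup V] [Module F V]

/-- The symmetric algebra `S = S(V*)`, i.e. the polynomial functions on `V`. -/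
abbrev Poly := SymmetricAlgebra F (Dual F V)

/-- The derivations `S ⊗ V`. -/
abbrev Der := Poly F V ⊗[F] V

/-- The multivector fields `S ⊗ ∧V`, a ring under the wedge product. -/
abbrev MultiDer := Poly F V ⊗[F] ExteriorAlgebra F V

/-- The one-forms `S ⊗ V*`. -/
abbrev OneForm := Poly F V ⊗[F] Dual F V

/-- The differential forms `S ⊗ ∧V*`, a ring under the wedge product. -/
abbrev DiffForm := Poly F V ⊗[F] ExteriorAlgebra F (Dual F V)

/-- The differential derivations `S ⊗ ∧V* ⊗ V`. -/
abbrev DiffDer := Poly F V ⊗[F] (ExteriorAlgebra F (Dual F V) ⊗[F] V)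

end Spaces

section Invariants

variable {F V : Type*} [Field F] [AddCommGroup V] [Module F V]

/-- The dual action of `g` on `V*`: a linear form `φ` goes to `φ ∘ g⁻¹`. -/
def dualAct (g : V ≃ₗ[F] V) : Dual F V →ₗ[F] Dual F V :=
  g.symm.dualMap.toLinearMap

/-- The action of `g` on `S = S(V*)` by algebra automorphisms extending the dual action. -/
def polyAct (g : V ≃ₗ[F] V) : Poly F V →ₐ[F] Poly F V :=
  SymmetricAlgebra.lift (SymmetricAlgebra.ι F (Dual F V) ∘ₗ dualAct g)

/-- The diagonal action of `g` on `∧V* ⊗ V`. -/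
def extAct (g : V ≃ₗ[F] V) :
    (ExteriorAlgebra F (Dual F V) ⊗[F] V) →ₗ[F] (ExteriorAlgebra F (Dual F V) ⊗[F] V) :=
  TensorProduct.map (ExteriorAlgebra.map (dualAct g)).toLinearMap g.toLinearMap

/-- The ring of invariant polynomials `S^G`. -/
def invPoly (G : Subgroup (V ≃ₗ[F] V)) : Subalgebra F (Poly F V) where
  carrier := {f | ∀ g ∈ G, polyAct g f = f}
  mul_mem' ha hb g hg := by rw [map_mul, ha g hg, hb g hg]
  add_mem' ha hb g hg := by rw [map_add, ha g hg, hb g hg]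
  algebraMap_mem' r g _ := AlgHom.commutes _ r

theorem map_polyAct_smul {M : Type*} [AddCommGroup M] [Module F M] (g : V ≃ₗ[F] V)
    (ρ : M →ₗ[F] M) (f : Poly F V) (m : Poly F V ⊗[F] M) :
    TensorProduct.map (polyAct g).toLinearMap ρ (f • m) =
      polyAct g f • TensorProduct.map (polyAct g).toLinearMap ρ m := by
  induction m with
  | zero => simp
  | tmul s x => simp [TensorProduct.smul_tmul']
  | add x y hx hy => simp [smul_add, hx, hy]

/-- The `S^G`-module `(S ⊗ M)^G`, where `g` acts on `M` by `ρ g` and diagonally on `S ⊗ M`. -/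
def invariants {M : Type*} [AddCommGroup M] [Module F M] (G : Subgroup (V ≃ₗ[F] V))
    (ρ : (V ≃ₗ[F] V) → M →ₗ[F] M) : Submodule (invPoly G) (Poly F V ⊗[F] M) where
  carrier := {m | ∀ g ∈ G, TensorProduct.map (polyAct g).toLinearMap (ρ g) m = m}
  zero_mem' g _ := map_zero _
  add_mem' ha hb g hg := by rw [map_add, ha g hg, hb g hg]
  smul_mem' c m hm g hg := by
    rw [Subalgebra.smul_def, map_polyAct_smul, hm g hg, c.2 g hg]

/-- The invariant derivations `(S ⊗ V)^G`. -/
abbrev invDer (G : Subgroup (V ≃ₗ[F] V)) : Submodule (invPoly G) (Der F V) :=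
  invariants G fun g => g.toLinearMap

/-- The invariant differential derivations `(S ⊗ ∧V* ⊗ V)^G`. -/
abbrev invDiffDer (G : Subgroup (V ≃ₗ[F] V)) : Submodule (invPoly G) (DiffDer F V) :=
  invariants G extAct

end Invariants

section Reflections

variable {F V : Type*} [Field F] [AddCommGroup V] [Module F V]

/-- `s` is a reflection about `H`: it is not the identity, and it fixes pointwise the subspace `H`
of codimension one (the coatoms of the lattice of subspaces are the hyperplanes). -/
def IsReflectionAbout (s : V ≃ₗ[F] V) (H : Submodule F V) : Prop :=
  s ≠ 1 ∧ IsCoatom H ∧ ∀ v ∈ H, s v = v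

/-- `G` is a reflection group: a finite group generated by reflections. -/
def IsReflectionGroup (G : Subgroup (V ≃ₗ[F] V)) : Prop :=
  Finite G ∧ Subgroup.closure {s | s ∈ G ∧ ∃ H, IsReflectionAbout s H} = G

/-- The set `𝒜` of reflecting hyperplanes of `G`. -/
def reflArrangement (G : Subgroup (V ≃ₗ[F] V)) : Set (Submodule F V) :=
  {H | ∃ s ∈ G, IsReflectionAbout s H}

/-- `s` is a transvection about `H`: a reflection about `H` whose root vector, which spans
the image of `s - 1`, lies in `H`. -/
def IsTransvectionAbout (s : V ≃ₗ[F] V) (H : Submodule F V) : Prop :=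
  IsReflectionAbout s H ∧ ∀ v, s v - v ∈ H

/-- The transvection root space of `H`: the span of the root vectors of the transvections in `G`
about `H`, i.e. the span of the images of `s - 1` for these transvections `s`. -/
def transvectionRootSpace (G : Subgroup (V ≃ₗ[F] V)) (H : Submodule F V) : Submodule F V :=
  Submodule.span F {w | ∃ s ∈ G, IsTransvectionAbout s H ∧ ∃ v, w = s v - v}

/-- All transvection root spaces of `G` are maximal. -/
def TransvectionRootSpacesMaximal (G : Subgroup (V ≃ₗ[F] V)) : Prop :=
  ∀ H ∈ reflArrangement G, transvectionRootSpace G H = H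

/-- The pointwise stabilizer `G_H`. -/
def pointwiseStab (G : Subgroup (V ≃ₗ[F] V)) (H : Submodule F V) : Subgroup (V ≃ₗ[F] V) :=
  G ⊓ fixingSubgroup (V ≃ₗ[F] V) (H : Set V)

/-- `e_H = |G_H : K_H|` where `K_H` is the kernel of the determinant on `G_H`. -/
def reflIndex (G : Subgroup (V ≃ₗ[F] V)) (H : Submodule F V) : ℕ :=
  (LinearEquiv.det (R := F) (M := V)).ker.relIndex (pointwiseStab G H)

/-- `Q_det = ∏_H ℓ_H ^ (e_H - 1)`. -/
def Qdet (G : Subgroup (V ≃ₗ[F] V)) (ℓ : Submodule F V → Dual F V) : Poly F V :=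
  ∏ᶠ H ∈ reflArrangement G, SymmetricAlgebra.ι F (Dual F V) (ℓ H) ^ (reflIndex G H - 1)

/-- `∏_H ℓ_H ^ e_H`, which is `Q ^ e` for `Q = ∏_H ℓ_H` and the common value `e` of the `e_H`. -/
def Qe (G : Subgroup (V ≃ₗ[F] V)) (ℓ : Submodule F V → Dual F V) : Poly F V :=
  ∏ᶠ H ∈ reflArrangement G, SymmetricAlgebra.ι F (Dual F V) (ℓ H) ^ reflIndex G H

end Reflections

section Forms

variable {F V : Type*} [Field F] [AddCommGroup V] [Module F V] {n : ℕ}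

/-- The product of the `a i`, `i ∈ I`, in increasing order of the indices. -/
def orderedProd {A : Type*} [Monoid A] (a : Fin n → A) (I : Finset (Fin n)) : A :=
  ((I.sort (· ≤ ·)).map a).prod

/-- Division by the volume form `v₁ ∧ ⋯ ∧ vₙ`: the coefficient of the volume form in an element
of `∧V`. -/
def volCoeff (v : Basis (Fin n) F V) : ExteriorAlgebra F V →ₗ[F] F :=
  ExteriorAlgebra.liftAlternating (Pi.single n v.det)

/-- The dualizing map `Φ : ∧ⁿ⁻¹V → V*`, sending `β` to `u ↦ (u ∧ β) / vol`. It is extended by zero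
to the other graded pieces of `∧V`. -/
def dualizing (v : Basis (Fin n) F V) : ExteriorAlgebra F V →ₗ[F] Dual F V :=
  LinearMap.mk₂ F (fun β u => volCoeff v (ExteriorAlgebra.ι F u * β))
    (by intros; simp [mul_add]) (by intros; simp) (by intros; simp [add_mul]) (by intros; simp)

/-- The embedding `S ⊗ V → S ⊗ ∧V`. -/
def derToMulti : Der F V →ₗ[F] MultiDer F V :=
  TensorProduct.map LinearMap.id (ExteriorAlgebra.ι F)

/-- The embedding `S ⊗ V* → S ⊗ ∧V*`. -/
def oneFormToForm : OneForm F V →ₗ[F] DiffForm F V :=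
  TensorProduct.map LinearMap.id (ExteriorAlgebra.ι F)

/-- The dual one-forms `ω_i = (1 ⊗ Φ)(Q_det θ₁ ∧ ⋯ ∧ θ̂_i ∧ ⋯ ∧ θₙ)` (with `θ_i` omitted). -/
def dualOneForm (v : Basis (Fin n) F V) (G : Subgroup (V ≃ₗ[F] V))
    (ℓ : Submodule F V → Dual F V) (θ : Fin n → Der F V) (i : Fin n) : OneForm F V :=
  TensorProduct.map LinearMap.id (dualizing v)
    (Qdet G ℓ • orderedProd (fun j => derToMulti (θ j)) (Finset.univ.erase i))

open Classical in
/-- The quotient `η / q` of a differential form by a polynomial. It is unique for `q ≠ 0` when it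
exists (the forms are a free `S`-module); the value is `0` when `q` does not divide `η`. -/
def divForm (η : DiffForm F V) (q : Poly F V) : DiffForm F V :=
  if h : ∃ ζ : DiffForm F V, q • ζ = η then h.choose else 0

/-- The twisted wedge product `ω_I = ω_{i₁} ⋏ ⋯ ⋏ ω_{iₖ} = (ω_{i₁} ∧ ⋯ ∧ ω_{iₖ}) / Q ^ (e (k - 1))`
for `I = {i₁ < ⋯ < iₖ}`, with the value `1 ⊗ 1` for empty `I`. -/
def twistedWedge (G : Subgroup (V ≃ₗ[F] V)) (ℓ : Submodule F V → Dual F V)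
    (ω : Fin n → OneForm F V) (I : Finset (Fin n)) : DiffForm F V :=
  if I = ∅ then 1
  else divForm (orderedProd (fun i => oneFormToForm (ω i)) I) (Qe G ℓ ^ (I.card - 1))

/-- The product of a form and a derivation: `(f ⊗ x)(f' ⊗ u) = f f' ⊗ x ⊗ u`. -/
def formMulDer (ω : DiffForm F V) (θ : Der F V) : DiffDer F V :=
  TensorProduct.map (LinearMap.mul' F (Poly F V)) LinearMap.id
    (TensorProduct.tensorTensorTensorComm F (Poly F V) (ExteriorAlgebra F (Dual F V))
      (Poly F V) V (ω ⊗ₜ[F] θ))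

/-- `dθ_E = ∑ 1 ⊗ x_i ⊗ v_i` for the dual basis `x_i` of `v_i`. -/
def dEuler (v : Basis (Fin n) F V) : DiffDer F V :=
  ∑ i, 1 ⊗ₜ[F] (ExteriorAlgebra.ι F (v.coord i) ⊗ₜ[F] v i)

end Forms

end

end InvDiffDer

/-!
Write `S` for the polynomial functions, `ℓ = ℓ_H` and `e = e_H` for a reflecting hyperplane `H`, and
call a derivation logarithmic if it is tangent to all the reflecting hyperplanes. Everything is
reduced to divisibility statements in the factorial ring `S`, obtained by evaluating forms at the
basic derivations `θ_j`; the only determinant that occurs is that of the coefficients of the `θ_j`.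

*Saito's criterion.* For each prime `f` of `S`, averaging over the cosets of the inertia group of
`f` shows that, up to a factor prime to `f`, the invariant derivations span the derivations fixed by
that inertia group (`exists_smul_mem_span_invDer`). The inertia group is trivial unless `f` is one
of the `ℓ_H`, in which case it fixes the Euler derivation and the constant derivations along `H`.
Hence the coefficient determinant of the `θ_j` is a nonzero constant times `∏ ℓ_H`
(`exists_det_basicDer_eq`), and the `θ_j` form an `S`-basis of the logarithmic derivations
(`exists_sum_basicDer_eq`).

*Duality.* Consequently `ω_i(θ_j)` is zero for `i ≠ j` and a nonzero constant times `Q ^ e` for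
`i = j` (`exists_isDualSystem`), while near `H` each `ω_i` is a combination of `ℓ ^ (e - 1) dℓ` and
`ℓ ^ e σ` for one-forms `σ` (`exists_basicForm_eq`). As `dℓ` can occur only once in a product, this
gives the divisibility that makes the twisted wedge products meaningful
(`Qe_pow_smul_twistedWedge`); evaluating `ω_I` (twisted) at the `θ_j`, `j ∈ J`, gives zero for
`I ≠ J` and a nonzero multiple of `Q ^ e` for `I = J ≠ ∅`. A differential derivation is determined
by all its values at such families (`IsDualSystem.diffDer_ext`).

*Local structure along a hyperplane.* Let `η` be an invariant differential derivation. Because the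
transvection root space of `H` is all of `H`, invariance of `η` under the pointwise stabilizer of
`H` forces its values to be highly divisible by `ℓ` (`local_structure`); this uses a symmetry that
makes it possible to cancel a factor two. In form degree at least two
the values at logarithmic derivations are `ℓ ^ e` times derivations tangent to `H`
(`isTangent_evalAtDers`). In degree one this holds after subtracting a multiple of the identity
(`exists_isTangent_sub`), and the identity is `dθ_E`.

*Conclusion.* The values of `η` at families of two or more of the `θ_j` are thus `Q ^ e` times a
combination of the `θ_j`, and the matrix of the degree one part in the basis `θ` is scalar modulo
`Q ^ e`. So `η` is an `S`-combination of `dθ_E` and the `ω_I θ_j`, where the `(r, r)` entry of the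
matrix is used as the coefficient of `dθ_E` and makes `ω_r θ_r` superfluous (`exists_eq_sum`). These
coefficients are unique (`eq_zero_of_sum_eq_zero`), hence invariant (`mem_invPoly_of_sum_mem`).
-/

namespace InvDiffDer


/-! ### Divisibility in factorial domains -/

section Divisibility

/-- Divisibility can be checked prime by prime: it is enough that `b` divides, for each prime `f`,
some multiple of `a` by an element prime to `f`. -/
theorem dvd_of_forall_prime_dvd_mul {R : Type*} [CommRing R] [IsDomain R]
    [UniqueFactorizationMonoid R] {b a : R} (hb : b ≠ 0)
    (h : ∀ f, Prime f → ∃ c, ¬ f ∣ c ∧ b ∣ c * a) : b ∣ a := by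
  induction b using UniqueFactorizationMonoid.induction_on_prime generalizing a with
  | h₁ => exact absurd rfl hb
  | h₂ x hx => exact hx.dvd
  | h₃ b p hb0 hp ih =>
    obtain ⟨a', rfl⟩ : b ∣ a := ih hb0 fun f hf => by
      obtain ⟨c, hc, hd⟩ := h f hf
      exact ⟨c, hc, (Dvd.intro_left p rfl).trans hd⟩
    obtain ⟨c, hc, d, hd⟩ := h p hp
    have h1 : c * a' = p * d := mul_left_cancel₀ hb0 (by linear_combination hd)
    have h2 : p ∣ a' := (hp.dvd_or_dvd ⟨d, h1⟩).resolve_left hc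
    rw [mul_comm p b]
    exact mul_dvd_mul_left b h2

/-- A product of powers of pairwise non-associated primes divides whatever each factor divides. -/
theorem prod_prime_pow_dvd {R ι : Type*} [CommRing R] [IsDomain R]
    [UniqueFactorizationMonoid R] {s : Finset ι} {p : ι → R} {m : ι → ℕ} {a : R}
    (hp : ∀ i ∈ s, Prime (p i)) (hne : ∀ i ∈ s, ∀ j ∈ s, p i ∣ p j → i = j)
    (h : ∀ i ∈ s, p i ^ m i ∣ a) : ∏ i ∈ s, p i ^ m i ∣ a := by
  refine Finset.prod_dvd_of_isRelPrime (fun i hi j hj hij => ?_) h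
  refine IsRelPrime.pow ?_
  exact ((hp i hi).irreducible.isRelPrime_iff_not_dvd).2 fun hd => hij (hne i hi j hj hd)

end Divisibility

/-! ### Polynomial functions -/

section Poly

variable {F V : Type*} [Field F] [AddCommGroup V] [Module F V]

instance : UniqueFactorizationMonoid (Poly F V) :=
  (SymmetricAlgebra.equivMvPolynomial
    (Basis.ofVectorSpace F (Dual F V))).symm.toMulEquiv.uniqueFactorizationMonoid inferInstance

/-- The polynomial function of a linear form. -/
noncomputable abbrev lin (y : Dual F V) : Poly F V := SymmetricAlgebra.ι F (Dual F V) y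

theorem lin_add (y z : Dual F V) : lin (y + z) = lin y + lin z := map_add _ y z

theorem lin_smul (c : F) (y : Dual F V) : lin (c • y) = c • lin y := map_smul _ c y

/-- Evaluation of polynomial functions at a vector. -/
noncomputable def evalAt (u : V) : Poly F V →ₐ[F] F := SymmetricAlgebra.lift (Dual.eval F V u)

@[simp] theorem evalAt_lin (u : V) (y : Dual F V) : evalAt u (lin y) = y u := by
  simp [evalAt, lin]

theorem prime_lin {y : Dual F V} (hy : y ≠ 0) : Prime (lin y) := by
  have hli : LinearIndepOn F id ({y} : Set (Dual F V)) := LinearIndepOn.singleton (v := id) hy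
  let b := Basis.extend hli
  have hmem : y ∈ hli.extend (Set.subset_univ _) := hli.subset_extend _ rfl
  have hb : b ⟨y, hmem⟩ = y := by simp [b]
  have h1 := SymmetricAlgebra.equivMvPolynomial_ι_apply b ⟨y, hmem⟩
  rw [hb] at h1
  rw [← MulEquiv.prime_iff (SymmetricAlgebra.equivMvPolynomial b).toMulEquiv]
  change Prime (SymmetricAlgebra.equivMvPolynomial b (lin y))
  rw [h1]
  exact MvPolynomial.X_prime

theorem ker_le_of_lin_dvd_lin {y z : Dual F V} (h : lin y ∣ lin z) :
    LinearMap.ker y ≤ LinearMap.ker z := by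
  intro u hu
  have := map_dvd (evalAt u) h
  rw [evalAt_lin, evalAt_lin, LinearMap.mem_ker.1 hu, zero_dvd_iff] at this
  exact this

theorem isUnit_poly {f : Poly F V} (hf : IsUnit f) : ∃ c : F, f = algebraMap F _ c := by
  let e := SymmetricAlgebra.equivMvPolynomial (Basis.ofVectorSpace F (Dual F V))
  obtain ⟨r, -, hr⟩ := MvPolynomial.isUnit_iff_eq_C_of_isReduced.1 (hf.map e)
  refine ⟨r, e.injective ?_⟩
  rw [hr, AlgEquiv.commutes]
  rfl

/-! ### The group action on polynomial functions -/

@[simp] theorem dualAct_apply (g : V ≃ₗ[F] V) (y : Dual F V) (u : V) :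
    dualAct g y u = y (g⁻¹ u) := rfl

@[simp] theorem dualAct_one (y : Dual F V) : dualAct 1 y = y := rfl

theorem dualAct_mul (g h : V ≃ₗ[F] V) (y : Dual F V) :
    dualAct (g * h) y = dualAct g (dualAct h y) := rfl

theorem dualAct_apply_apply (g : V ≃ₗ[F] V) (y : Dual F V) (u : V) :
    dualAct g y (g u) = y u := by
  rw [dualAct_apply, ← LinearEquiv.mul_apply, inv_mul_cancel, LinearEquiv.coe_one, id]

@[simp] theorem polyAct_lin (g : V ≃ₗ[F] V) (y : Dual F V) :
    polyAct g (lin y) = lin (dualAct g y) := by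
  simp [polyAct, lin]

@[simp] theorem polyAct_one (a : Poly F V) : polyAct 1 a = a := by
  have : polyAct (1 : V ≃ₗ[F] V) = AlgHom.id F (Poly F V) := by
    apply SymmetricAlgebra.algHom_ext
    ext y
    exact polyAct_lin 1 y
  rw [this]; rfl

theorem polyAct_mul (g h : V ≃ₗ[F] V) (a : Poly F V) :
    polyAct (g * h) a = polyAct g (polyAct h a) := by
  have : polyAct (g * h) = (polyAct g).comp (polyAct h) := by
    apply SymmetricAlgebra.algHom_ext
    ext y
    change polyAct (g * h) (lin y) = polyAct g (polyAct h (lin y))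
    simp [dualAct_mul]
  rw [this]; rfl

@[simp] theorem polyAct_inv_apply (g : V ≃ₗ[F] V) (a : Poly F V) :
    polyAct g (polyAct g⁻¹ a) = a := by
  rw [← polyAct_mul, mul_inv_cancel, polyAct_one]

theorem polyAct_injective (g : V ≃ₗ[F] V) : Function.Injective (polyAct g) := by
  intro a b h
  have := congrArg (polyAct g⁻¹) h
  rwa [← polyAct_mul, ← polyAct_mul, inv_mul_cancel, polyAct_one, polyAct_one] at this

/-- If `f` divides `g y - y` for all linear forms `y`, then it divides `g a - a` for all
polynomial functions `a`. -/
theorem dvd_polyAct_sub {f : Poly F V} {g : V ≃ₗ[F] V}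
    (h : ∀ y : Dual F V, f ∣ lin (dualAct g y) - lin y) (a : Poly F V) : f ∣ polyAct g a - a := by
  induction a using SymmetricAlgebra.induction with
  | algebraMap r => simp
  | ι y => simpa using h y
  | mul a b ha hb =>
    have : polyAct g (a * b) - a * b =
        polyAct g a * (polyAct g b - b) + (polyAct g a - a) * b := by
      rw [map_mul]; ring
    rw [this]
    exact dvd_add (hb.mul_left _) (ha.mul_right _)
  | add a b ha hb =>
    have : polyAct g (a + b) - (a + b) = (polyAct g a - a) + (polyAct g b - b) := by
      rw [map_add]; ring
    rw [this]
    exact dvd_add ha hb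

end Poly

/-! ### Linear maps fixing a hyperplane -/

section Hyperplane

variable {F V : Type*} [Field F] [AddCommGroup V] [Module F V]

theorem eq_smul_of_ker_le {l z : Dual F V} {u : V} (hu : l u = 1)
    (h : ∀ w, l w = 0 → z w = 0) : z = z u • l := by
  ext w
  have h1 : z (w - l w • u) = 0 := h _ (by simp [hu])
  rw [map_sub, map_smul, sub_eq_zero] at h1
  rw [h1, LinearMap.smul_apply, smul_eq_mul, smul_eq_mul, mul_comm]

theorem exists_apply_eq_one {l : Dual F V} (hl : l ≠ 0) : ∃ u, l u = 1 := by
  obtain ⟨u, hu⟩ := DFunLike.ne_iff.1 hl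
  exact ⟨(l u)⁻¹ • u, by simpa using inv_mul_cancel₀ hu⟩

theorem ne_zero_of_isCoatom_ker {l : Dual F V} (h : IsCoatom (LinearMap.ker l)) : l ≠ 0 := by
  rintro rfl
  exact h.1 LinearMap.ker_zero

theorem isCoatom_ker {l : Dual F V} (hl : l ≠ 0) : IsCoatom (LinearMap.ker l) := by
  obtain ⟨u, hu⟩ := exists_apply_eq_one hl
  refine ⟨fun h => by rw [LinearMap.ker_eq_top.1 h] at hu; simp at hu, fun K hK => ?_⟩
  obtain ⟨w, hwK, hw⟩ := SetLike.exists_of_lt hK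
  rw [LinearMap.mem_ker] at hw
  rw [eq_top_iff]
  intro x _
  have : x - (l x / l w) • w ∈ K := hK.le (by
    rw [LinearMap.mem_ker, map_sub, map_smul, smul_eq_mul, div_mul_cancel₀ _ hw, sub_self])
  simpa using K.add_mem this (K.smul_mem (l x / l w) hwK)

/-- `g` fixes the kernel of `l` pointwise. -/
def FixesKer (g : V ≃ₗ[F] V) (l : Dual F V) : Prop := ∀ w, l w = 0 → g w = w

theorem FixesKer.inv {g : V ≃ₗ[F] V} {l : Dual F V} (h : FixesKer g l) : FixesKer g⁻¹ l := by
  intro w hw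
  have : g w = w := h w hw
  exact (LinearEquiv.symm_apply_eq g).2 this.symm

theorem FixesKer.apply_eq {g : V ≃ₗ[F] V} {l : Dual F V} (h : FixesKer g l) {u : V} (hu : l u = 1)
    (w : V) : g w = w + l w • (g u - u) := by
  have h1 := h (w - l w • u) (by simp [hu])
  rw [map_sub, map_smul, sub_eq_iff_eq_add] at h1
  rw [h1, smul_sub]
  abel

theorem FixesKer.dualAct_eq {g : V ≃ₗ[F] V} {l : Dual F V} (h : FixesKer g l) {u : V}
    (hu : l u = 1) (y : Dual F V) : dualAct g y = y + (y (g⁻¹ u) - y u) • l := by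
  have h1 : dualAct g y - y = (dualAct g y - y) u • l := eq_smul_of_ker_le hu fun w hw => by
    rw [LinearMap.sub_apply, dualAct_apply, h.inv w hw, sub_self]
  rw [LinearMap.sub_apply, dualAct_apply] at h1
  rw [← h1, add_sub_cancel]

/-- An element that fixes the hyperplane `l = 0` pointwise acts trivially modulo `l`. -/
theorem FixesKer.lin_dvd {g : V ≃ₗ[F] V} {l : Dual F V} (h : FixesKer g l) (hl : l ≠ 0)
    (a : Poly F V) : lin l ∣ polyAct g a - a := by
  obtain ⟨u, hu⟩ := exists_apply_eq_one hl
  refine dvd_polyAct_sub (fun y => ?_) a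
  rw [h.dualAct_eq hu, lin_add, lin_smul, add_sub_cancel_left, Algebra.smul_def]
  exact Dvd.intro_left _ rfl

theorem FixesKer.det_eq [Module.Finite F V] {g : V ≃ₗ[F] V} {l : Dual F V} (h : FixesKer g l)
    {u : V} (hu : l u = 1) : LinearMap.det (g : V →ₗ[F] V) = l (g u) := by
  have : (g : V →ₗ[F] V) = LinearMap.transvection l (g u - u) := by
    ext w
    rw [LinearMap.transvection.apply]
    exact h.apply_eq hu w
  rw [this, LinearMap.transvection.det, map_sub, hu]
  ring

theorem dualAct_eq_smul_of_eigenvector {g : V ≃ₗ[F] V} {l : Dual F V} (h : FixesKer g l) {u : V}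
    (hu : l u = 1) {ζ : F} (hζ : ζ ≠ 0) (hgu : g u = ζ • u) : dualAct g l = ζ⁻¹ • l := by
  have h1 : g⁻¹ u = ζ⁻¹ • u := by
    rw [LinearEquiv.coe_inv, LinearEquiv.symm_apply_eq, map_smul, hgu, smul_smul,
      inv_mul_cancel₀ hζ, one_smul]
  rw [h.dualAct_eq hu, h1, map_smul, hu]
  module

/-- An invariant of an element of order `e` modulo transvections which vanishes on the hyperplane
`l = 0` vanishes there to order `e`. -/
theorem lin_pow_dvd_of_invariant {g : V ≃ₗ[F] V} {l : Dual F V} (h : FixesKer g l) (hl : l ≠ 0)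
    {ζ : F} {e : ℕ} (hζ : IsPrimitiveRoot ζ e) (hgl : dualAct g l = ζ⁻¹ • l) {f : Poly F V}
    (hf : polyAct g f = f) (hd : lin l ∣ f) : lin l ^ e ∣ f := by
  have hl' := prime_lin hl
  suffices H : ∀ m, m + 1 ≤ e → lin l ^ (m + 1) ∣ f by
    rcases e with - | m
    · simp
    · exact H m le_rfl
  intro m
  induction m with
  | zero => intro _; simpa using hd
  | succ m ih =>
    intro hm
    obtain ⟨a, rfl⟩ := ih (by omega)
    have hζ0 : ζ ≠ 0 := hζ.ne_zero (by omega)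
    have h1 : polyAct g a = ζ ^ (m + 1) • a := by
      rw [map_mul, map_pow, polyAct_lin, hgl, lin_smul, smul_pow, smul_mul_assoc,
        ← mul_smul_comm] at hf
      have := mul_left_cancel₀ (pow_ne_zero _ hl'.ne_zero) hf
      conv_rhs => rw [← this]
      rw [smul_smul, ← mul_pow, mul_inv_cancel₀ hζ0, one_pow, one_smul]
    have h2 := h.lin_dvd hl a
    have h3 : ζ ^ (m + 1) - 1 ≠ 0 := sub_ne_zero.2
      (hζ.pow_ne_one_of_pos_of_lt (by omega) (by omega))
    have h4 : lin l ∣ a := by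
      have h5 : polyAct g a - a = (ζ ^ (m + 1) - 1) • a := by rw [h1, sub_smul, one_smul]
      rw [h5] at h2
      have := h2.trans (Dvd.intro_left (algebraMap F _ (ζ ^ (m + 1) - 1)⁻¹) rfl)
      rwa [← Algebra.smul_def, smul_smul, inv_mul_cancel₀ h3, one_smul] at this
    rw [pow_succ (lin l) (m + 1)]
    exact mul_dvd_mul_left _ h4

end Hyperplane

/-! ### The reflection arrangement -/

section Arrangement

variable {F V : Type*} [Field F] [AddCommGroup V] [Module F V] {G : Subgroup (V ≃ₗ[F] V)}

theorem IsReflectionAbout.eq_ker {s : V ≃ₗ[F] V} {H : Submodule F V}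
    (h : IsReflectionAbout s H) : H = LinearMap.ker ((s : V →ₗ[F] V) - 1) := by
  obtain ⟨hs, hH, hfix⟩ := h
  have hle : H ≤ LinearMap.ker ((s : V →ₗ[F] V) - 1) := fun w hw => by
    simp [hfix w hw]
  refine ((hH.le_iff.1 hle).resolve_left fun htop => hs ?_).symm
  ext w
  have : w ∈ LinearMap.ker ((s : V →ₗ[F] V) - 1) := htop ▸ Submodule.mem_top
  simpa [sub_eq_zero] using this

theorem reflArrangement_finite (hG : Finite G) : (reflArrangement G).Finite := by
  have : Set.Finite (G : Set (V ≃ₗ[F] V)) := hG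
  refine (this.image fun s : V ≃ₗ[F] V => LinearMap.ker ((s : V →ₗ[F] V) - 1)).subset ?_
  rintro H ⟨s, hs, h⟩
  exact ⟨s, hs, h.eq_ker.symm⟩

theorem mem_pointwiseStab {H : Submodule F V} {g : V ≃ₗ[F] V} :
    g ∈ pointwiseStab G H ↔ g ∈ G ∧ ∀ w ∈ H, g w = w := by
  rw [pointwiseStab, Subgroup.mem_inf, mem_fixingSubgroup_iff]
  rfl

theorem isCoatom_of_mem_reflArrangement {H : Submodule F V} (hH : H ∈ reflArrangement G) :
    IsCoatom H := by
  obtain ⟨s, -, h⟩ := hH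
  exact h.2.1

theorem map_mem_reflArrangement {H : Submodule F V} (hH : H ∈ reflArrangement G)
    {g : V ≃ₗ[F] V} (hg : g ∈ G) : H.map (g : V →ₗ[F] V) ∈ reflArrangement G := by
  obtain ⟨s, hs, h1, h2, h3⟩ := hH
  refine ⟨g * s * g⁻¹, G.mul_mem (G.mul_mem hg hs) (G.inv_mem hg), ?_, ?_, ?_⟩
  · intro h
    rw [mul_inv_eq_one] at h
    exact h1 (mul_left_cancel (h.trans (mul_one g).symm))
  · exact (OrderIso.isCoatom_iff (Submodule.orderIsoMapComap g) H).2 h2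
  · rintro _ ⟨w, hw, rfl⟩
    simp [h3 w hw]

theorem map_det_pointwiseStab_map_le {H : Submodule F V} {g : V ≃ₗ[F] V} (hg : g ∈ G) :
    (pointwiseStab G H).map (LinearEquiv.det (R := F) (M := V)) ≤
      (pointwiseStab G (H.map (g : V →ₗ[F] V))).map LinearEquiv.det := by
  rintro _ ⟨s, hs, rfl⟩
  obtain ⟨hsG, hsH⟩ := mem_pointwiseStab.1 hs
  refine ⟨g * s * g⁻¹, mem_pointwiseStab.2
    ⟨G.mul_mem (G.mul_mem hg hsG) (G.inv_mem hg), ?_⟩, ?_⟩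
  · rintro _ ⟨w, hw, rfl⟩
    simp [hsH w hw]
  · rw [map_mul, map_mul, map_inv, mul_inv_cancel_comm]

theorem map_inv_map (g : V ≃ₗ[F] V) (H : Submodule F V) :
    (H.map (g : V →ₗ[F] V)).map ((g⁻¹ : V ≃ₗ[F] V) : V →ₗ[F] V) = H := by
  rw [← Submodule.map_comp]
  convert Submodule.map_id H
  ext w
  simp

theorem reflIndex_map {H : Submodule F V} {g : V ≃ₗ[F] V} (hg : g ∈ G) :
    reflIndex G (H.map (g : V →ₗ[F] V)) = reflIndex G H := by
  rw [reflIndex, reflIndex, Subgroup.relIndex_ker, Subgroup.relIndex_ker]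
  refine congrArg (fun K : Subgroup Fˣ => Nat.card K)
    (le_antisymm ?_ (map_det_pointwiseStab_map_le hg))
  have := map_det_pointwiseStab_map_le (H := H.map (g : V →ₗ[F] V)) (G.inv_mem hg)
  rwa [map_inv_map] at this

theorem reflIndex_pos (hG : Finite G) (H : Submodule F V) : 0 < reflIndex G H := by
  have hfin : Finite (pointwiseStab G H) :=
    Finite.of_injective _ (Subgroup.inclusion_injective (inf_le_left : pointwiseStab G H ≤ G))
  rw [reflIndex, Subgroup.relIndex_ker]
  have : Finite ((pointwiseStab G H).map (LinearEquiv.det (R := F) (M := V))) :=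
    Finite.of_surjective _ (LinearEquiv.det.subgroupMap_surjective (pointwiseStab G H))
  exact Nat.card_pos

/-- The pointwise stabilizer of the hyperplane `l = 0` has an element whose determinant has the
largest possible order `e_H`, and this element is diagonal for a suitable complement. -/
theorem exists_diagonal_generator [Module.Finite F V] (hG : Finite G) {H : Submodule F V}
    {l : Dual F V} (hl : l ≠ 0) (hker : LinearMap.ker l = H) :
    ∃ s ∈ G, FixesKer s l ∧ ∃ (u : V) (ζ : F), l u = 1 ∧ s u = ζ • u ∧
      IsPrimitiveRoot ζ (reflIndex G H) := by
  have hfin : Finite (pointwiseStab G H) :=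
    Finite.of_injective _ (Subgroup.inclusion_injective (inf_le_left : pointwiseStab G H ≤ G))
  let D := (pointwiseStab G H).map (LinearEquiv.det (R := F) (M := V))
  have hD : Finite D :=
    Finite.of_surjective _ (LinearEquiv.det.subgroupMap_surjective (pointwiseStab G H))
  obtain ⟨⟨d, hdD⟩, hd⟩ := IsCyclic.exists_generator (α := D)
  have hcard : orderOf d = reflIndex G H := by
    rw [reflIndex, Subgroup.relIndex_ker, ← orderOf_eq_card_of_forall_mem_zpowers hd,
      Subgroup.orderOf_mk]
  obtain ⟨s, hs, hsd⟩ := hdD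
  obtain ⟨hsG, hsH⟩ := mem_pointwiseStab.1 hs
  have hfix : FixesKer s l := fun w hw => hsH w (hker ▸ hw)
  obtain ⟨u, hu⟩ := exists_apply_eq_one hl
  have hdet : (d : F) = l (s u) := by
    rw [← hsd, LinearEquiv.coe_det, hfix.det_eq hu]
  have hprim : IsPrimitiveRoot (d : F) (reflIndex G H) := by
    rw [← hcard, ← orderOf_units]
    exact IsPrimitiveRoot.orderOf _
  by_cases h1 : (d : F) = 1
  · refine ⟨1, G.one_mem, fun w _ => rfl, u, 1, hu, by simp, ?_⟩
    rwa [h1] at hprim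
  · have h2 : l (s u - u) ≠ 0 := by
      rw [map_sub, ← hdet, hu]
      exact sub_ne_zero.2 h1
    refine ⟨s, hsG, hfix, (l (s u - u))⁻¹ • (s u - u), d, ?_, ?_, hprim⟩
    · rw [map_smul, smul_eq_mul, inv_mul_cancel₀ h2]
    · rw [map_smul, hfix.apply_eq hu (s u - u), smul_comm (d : F)]
      congr 1
      rw [map_sub, ← hdet, hu]
      module

end Arrangement

/-! ### Products of the linear forms of the arrangement -/

section ArrangementProducts

variable {F V : Type*} [Field F] [AddCommGroup V] [Module F V] {G : Subgroup (V ≃ₗ[F] V)}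
  {ℓ : Submodule F V → Dual F V}

theorem form_ne_zero (hℓ : ∀ H ∈ reflArrangement G, LinearMap.ker (ℓ H) = H) {H : Submodule F V}
    (hH : H ∈ reflArrangement G) : ℓ H ≠ 0 :=
  ne_zero_of_isCoatom_ker (by rw [hℓ H hH]; exact isCoatom_of_mem_reflArrangement hH)

theorem eq_of_lin_dvd_lin (hℓ : ∀ H ∈ reflArrangement G, LinearMap.ker (ℓ H) = H)
    {H K : Submodule F V} (hH : H ∈ reflArrangement G) (hK : K ∈ reflArrangement G)
    (h : lin (ℓ H) ∣ lin (ℓ K)) : H = K := by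
  have h1 := ker_le_of_lin_dvd_lin h
  rw [hℓ H hH, hℓ K hK] at h1
  exact (((isCoatom_of_mem_reflArrangement hH).le_iff.1 h1).resolve_left
    (isCoatom_of_mem_reflArrangement hK).1).symm

/-- The product `∏_H ℓ_H ^ m_H` over the reflecting hyperplanes of `G`. -/
noncomputable def arrProd (G : Subgroup (V ≃ₗ[F] V)) (ℓ : Submodule F V → Dual F V)
    (m : Submodule F V → ℕ) : Poly F V :=
  ∏ᶠ H ∈ reflArrangement G, lin (ℓ H) ^ m H

theorem arrProd_eq (hG : Finite G) (m : Submodule F V → ℕ) :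
    arrProd G ℓ m = ∏ H ∈ (reflArrangement_finite hG).toFinset, lin (ℓ H) ^ m H :=
  finprod_mem_eq_finite_toFinset_prod _ _

theorem arrProd_dvd (hG : Finite G) (hℓ : ∀ H ∈ reflArrangement G, LinearMap.ker (ℓ H) = H)
    {m : Submodule F V → ℕ} {a : Poly F V}
    (h : ∀ H ∈ reflArrangement G, lin (ℓ H) ^ m H ∣ a) : arrProd G ℓ m ∣ a := by
  rw [arrProd_eq hG]
  refine prod_prime_pow_dvd (fun H hH => ?_) (fun H hH K hK hd => ?_) (fun H hH => ?_) <;>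
    rw [Set.Finite.mem_toFinset] at hH
  · exact prime_lin (form_ne_zero hℓ hH)
  · exact eq_of_lin_dvd_lin hℓ hH ((Set.Finite.mem_toFinset _).1 hK) hd
  · exact h H hH

theorem arrProd_factor (hG : Finite G) (hℓ : ∀ H ∈ reflArrangement G, LinearMap.ker (ℓ H) = H)
    (m : Submodule F V → ℕ) {H : Submodule F V} (hH : H ∈ reflArrangement G) :
    ∃ R, arrProd G ℓ m = lin (ℓ H) ^ m H * R ∧ ¬ lin (ℓ H) ∣ R := by
  classical
  refine ⟨∏ K ∈ (reflArrangement_finite hG).toFinset.erase H, lin (ℓ K) ^ m K, ?_, fun hd => ?_⟩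
  · rw [arrProd_eq hG, Finset.mul_prod_erase _ (fun K => lin (ℓ K) ^ m K)
      ((Set.Finite.mem_toFinset _).2 hH)]
  · have hp := prime_lin (form_ne_zero hℓ hH)
    obtain ⟨K, hK, hd⟩ := hp.exists_mem_finset_dvd hd
    rw [Finset.mem_erase, Set.Finite.mem_toFinset] at hK
    exact hK.1 (eq_of_lin_dvd_lin hℓ hH hK.2 (hp.dvd_of_dvd_pow hd)).symm

theorem arrProd_ne_zero (hG : Finite G) (hℓ : ∀ H ∈ reflArrangement G, LinearMap.ker (ℓ H) = H)
    (m : Submodule F V → ℕ) : arrProd G ℓ m ≠ 0 := by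
  rw [arrProd_eq hG, Finset.prod_ne_zero_iff]
  intro H hH
  exact pow_ne_zero _ (prime_lin (form_ne_zero hℓ ((Set.Finite.mem_toFinset _).1 hH))).ne_zero

theorem Qe_eq_arrProd : Qe G ℓ = arrProd G ℓ (reflIndex G) := rfl

theorem Qdet_eq_arrProd : Qdet G ℓ = arrProd G ℓ (fun H => reflIndex G H - 1) := rfl

theorem Qdet_mul_arrProd_one (hG : Finite G) : Qdet G ℓ * arrProd G ℓ 1 = Qe G ℓ := by
  rw [Qe_eq_arrProd, Qdet_eq_arrProd, arrProd_eq hG, arrProd_eq hG, arrProd_eq hG,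
    ← Finset.prod_mul_distrib]
  refine Finset.prod_congr rfl fun H _ => ?_
  rw [← pow_add]
  congr 1
  exact Nat.sub_add_cancel (reflIndex_pos hG H)

theorem Qe_dvd_polyAct_Qe (hG : Finite G) (hℓ : ∀ H ∈ reflArrangement G, LinearMap.ker (ℓ H) = H)
    {g : V ≃ₗ[F] V} (hg : g ∈ G) : Qe G ℓ ∣ polyAct g (Qe G ℓ) := by
  conv_lhs => rw [Qe_eq_arrProd]
  refine arrProd_dvd hG hℓ fun H hH => ?_
  have hK := map_mem_reflArrangement hH (G.inv_mem hg)
  set K := H.map ((g⁻¹ : V ≃ₗ[F] V) : V →ₗ[F] V) with hKdef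
  obtain ⟨R, hR, -⟩ := arrProd_factor hG hℓ (reflIndex G) hK
  obtain ⟨u, hu⟩ := exists_apply_eq_one (form_ne_zero hℓ hH)
  have h1 : dualAct g (ℓ K) = (dualAct g (ℓ K)) u • ℓ H := by
    refine eq_smul_of_ker_le hu fun w hw => ?_
    rw [dualAct_apply, ← LinearMap.mem_ker, hℓ K hK, hKdef]
    refine ⟨w, ?_, rfl⟩
    rw [← hℓ H hH]
    exact hw
  have h2 : (dualAct g (ℓ K)) u ≠ 0 := by
    intro h0
    rw [h0, zero_smul] at h1
    refine form_ne_zero hℓ hK (LinearMap.ext fun w => ?_)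
    rw [← dualAct_apply_apply g, h1]
    rfl
  rw [Qe_eq_arrProd, hR, map_mul, map_pow, polyAct_lin, h1, lin_smul, smul_pow, hKdef,
    reflIndex_map (G.inv_mem hg), Algebra.smul_def]
  exact ((Dvd.intro_left _ rfl).mul_right _)

/-- The polynomial `Q ^ e` is invariant. A reflection about `H` can only scale it, and the scalar
is seen to be one by cancelling `ℓ_H ^ e_H` and reducing modulo `ℓ_H`. -/
theorem polyAct_Qe (hG : IsReflectionGroup G)
    (hℓ : ∀ H ∈ reflArrangement G, LinearMap.ker (ℓ H) = H)
    [Module.Finite F V] {g : V ≃ₗ[F] V} (hg : g ∈ G) : polyAct g (Qe G ℓ) = Qe G ℓ := by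
  obtain ⟨hfin, hgen⟩ := hG
  have hscale : ∀ g ∈ G, ∃ c : F, polyAct g (Qe G ℓ) = c • Qe G ℓ := by
    intro g hg
    have h1 : polyAct g (Qe G ℓ) ∣ Qe G ℓ := by
      have := map_dvd (polyAct g) (Qe_dvd_polyAct_Qe hfin hℓ (G.inv_mem hg))
      rwa [polyAct_inv_apply] at this
    obtain ⟨a, ha⟩ := associated_of_dvd_dvd (Qe_dvd_polyAct_Qe hfin hℓ hg) h1
    obtain ⟨c, hc⟩ := isUnit_poly a.isUnit
    exact ⟨c, by rw [← ha, hc, mul_comm, Algebra.smul_def]⟩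
  rw [← hgen] at hg
  induction hg using Subgroup.closure_induction with
  | mem s hs =>
    obtain ⟨hsG, H, hsH⟩ := hs
    have hH : H ∈ reflArrangement G := ⟨s, hsG, hsH⟩
    have hl := form_ne_zero hℓ hH
    have hp := prime_lin hl
    have hfix : FixesKer s (ℓ H) := fun w hw => hsH.2.2 w (by rw [← hℓ H hH]; exact hw)
    obtain ⟨R, hR, hnd⟩ := arrProd_factor hfin hℓ (reflIndex G) hH
    obtain ⟨c, hc⟩ := hscale s hsG
    obtain ⟨u, hu⟩ := exists_apply_eq_one hl
    -- `s` scales `ℓ_H` by the inverse of its determinant, whose order divides `e_H`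
    have h1 : polyAct s (lin (ℓ H)) ^ reflIndex G H = lin (ℓ H) ^ reflIndex G H := by
      have h2 : dualAct s (ℓ H) = (ℓ H (s⁻¹ u)) • ℓ H := by
        rw [hfix.dualAct_eq hu, hu]; module
      have hmem : LinearEquiv.det s⁻¹ ∈
          (pointwiseStab G H).map (LinearEquiv.det (R := F) (M := V)) :=
        ⟨s⁻¹, mem_pointwiseStab.2 ⟨G.inv_mem hsG, fun w hw => hfix.inv w (by
          rw [← LinearMap.mem_ker, hℓ H hH]; exact hw)⟩, rfl⟩
      have h3 : (LinearEquiv.det s⁻¹ : Fˣ) ^ reflIndex G H = 1 := by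
        rw [reflIndex, Subgroup.relIndex_ker]
        exact congrArg Subtype.val (pow_card_eq_one'
          (x := (⟨_, hmem⟩ : (pointwiseStab G H).map (LinearEquiv.det (R := F) (M := V)))))
      have h4 : ((LinearEquiv.det s⁻¹ : Fˣ) : F) = ℓ H (s⁻¹ u) := by
        rw [LinearEquiv.coe_det, hfix.inv.det_eq hu]
      rw [polyAct_lin, h2, lin_smul, smul_pow, ← h4, ← Units.val_pow_eq_pow_val, h3,
        Units.val_one, one_smul]
    have h5 : polyAct s R = c • R := by
      rw [Qe_eq_arrProd, hR, map_mul, map_pow, h1, ← mul_smul_comm] at hc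
      exact mul_left_cancel₀ (pow_ne_zero _ hp.ne_zero) hc
    have h6 : lin (ℓ H) ∣ algebraMap F _ (c - 1) * R := by
      have := hfix.lin_dvd hl R
      rwa [h5, ← one_smul F R, smul_smul, mul_one, ← sub_smul, Algebra.smul_def] at this
    have h7 : c = 1 := by
      by_contra hne
      refine hp.not_isUnit (isUnit_of_dvd_unit ((hp.dvd_or_dvd h6).resolve_right hnd) ?_)
      exact (IsUnit.mk0 (c - 1) (sub_ne_zero.2 hne)).map _
    rw [hc, h7, one_smul]
  | one => exact polyAct_one _
  | mul x y _ _ hx hy => rw [polyAct_mul, hy, hx]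
  | inv x _ hx =>
    apply polyAct_injective x
    rw [polyAct_inv_apply, hx]

end ArrangementProducts

/-! ### Derivations -/

section Derivations

variable {F V : Type*} [Field F] [AddCommGroup V] [Module F V]

/-- The `S`-linear extension `S ⊗ V → S` of a linear form on `V`. -/
noncomputable def ev (y : Dual F V) : Der F V →ₗ[Poly F V] Poly F V :=
  (Algebra.linearMap F (Poly F V) ∘ₗ y).liftBaseChange (Poly F V)

@[simp] theorem ev_tmul (y : Dual F V) (a : Poly F V) (u : V) :
    ev y (a ⊗ₜ u) = y u • a := by
  simp [ev, Algebra.smul_def, mul_comm]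

theorem ev_add (y z : Dual F V) (φ : Der F V) : ev (y + z) φ = ev y φ + ev z φ := by
  induction φ using TensorProduct.induction_on with
  | zero => simp
  | tmul a u => simp [add_smul]
  | add φ ψ hφ hψ => rw [map_add, map_add, map_add, hφ, hψ]; ring

theorem ev_smul (c : F) (y : Dual F V) (φ : Der F V) : ev (c • y) φ = c • ev y φ := by
  induction φ using TensorProduct.induction_on with
  | zero => simp
  | tmul a u => simp [smul_smul]
  | add φ ψ hφ hψ => rw [map_add, map_add, smul_add, hφ, hψ]

/-- The diagonal action of `g` on `S ⊗ V`. -/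
noncomputable def derAct (g : V ≃ₗ[F] V) : Der F V →ₗ[F] Der F V :=
  TensorProduct.map (polyAct g).toLinearMap g.toLinearMap

@[simp] theorem derAct_tmul (g : V ≃ₗ[F] V) (a : Poly F V) (u : V) :
    derAct g (a ⊗ₜ u) = polyAct g a ⊗ₜ g u := rfl

theorem derAct_smul (g : V ≃ₗ[F] V) (a : Poly F V) (φ : Der F V) :
    derAct g (a • φ) = polyAct g a • derAct g φ := map_polyAct_smul g _ a φ

theorem mem_invDer {G : Subgroup (V ≃ₗ[F] V)} {φ : Der F V} :
    φ ∈ invDer G ↔ ∀ g ∈ G, derAct g φ = φ := Iff.rfl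

theorem derAct_mul (g h : V ≃ₗ[F] V) (φ : Der F V) :
    derAct (g * h) φ = derAct g (derAct h φ) := by
  induction φ using TensorProduct.induction_on with
  | zero => simp
  | tmul a u => simp [polyAct_mul]
  | add φ ψ hφ hψ => rw [map_add, map_add, map_add, hφ, hψ]

theorem ev_dualAct_derAct (g : V ≃ₗ[F] V) (y : Dual F V) (φ : Der F V) :
    ev (dualAct g y) (derAct g φ) = polyAct g (ev y φ) := by
  induction φ using TensorProduct.induction_on with
  | zero => simp
  | tmul a u =>
    rw [derAct_tmul, ev_tmul, ev_tmul, dualAct_apply_apply, map_smul]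
  | add φ ψ hφ hψ => rw [map_add, map_add, map_add, map_add, hφ, hψ]

variable {n : ℕ} (v : Basis (Fin n) F V)

/-- The basis `1 ⊗ v_i` of the derivations. -/
noncomputable abbrev derBasis : Basis (Fin n) (Poly F V) (Der F V) :=
  Algebra.TensorProduct.basis (Poly F V) v

theorem derBasis_apply (i : Fin n) : derBasis v i = 1 ⊗ₜ v i :=
  Algebra.TensorProduct.basis_apply v i

theorem derBasis_repr (φ : Der F V) (i : Fin n) : (derBasis v).repr φ i = ev (v.coord i) φ := by
  induction φ using TensorProduct.induction_on with
  | zero => simp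
  | tmul a u =>
    rw [Algebra.TensorProduct.basis_repr_tmul, ev_tmul]
    simp [Algebra.smul_def, mul_comm]
  | add φ ψ hφ hψ => rw [map_add, map_add, Finsupp.add_apply, hφ, hψ]

theorem sum_ev_coord (φ : Der F V) : ∑ i, ev (v.coord i) φ • (1 ⊗ₜ[F] v i : Der F V) = φ := by
  conv_rhs => rw [← (derBasis v).sum_repr φ]
  simp only [derBasis_repr, derBasis_apply]

theorem ev_eq_sum (y : Dual F V) (φ : Der F V) : ev y φ = ∑ i, y (v i) • ev (v.coord i) φ := by
  conv_lhs => rw [← sum_ev_coord v φ]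
  simp

theorem der_ext_ev {φ ψ : Der F V} (h : ∀ i, ev (v.coord i) φ = ev (v.coord i) ψ) : φ = ψ := by
  rw [← sum_ev_coord v φ, ← sum_ev_coord v ψ]
  simp only [h]

/-- The derivations which are tangent to the hyperplane `l = 0`. -/
noncomputable def logDer (l : Dual F V) : Submodule (Poly F V) (Der F V) where
  carrier := {φ | lin l ∣ ev l φ}
  zero_mem' := by simp
  add_mem' ha hb := by simpa using dvd_add ha hb
  smul_mem' c φ h := by simpa using h.mul_left c

theorem mem_logDer {l : Dual F V} {φ : Der F V} : φ ∈ logDer l ↔ lin l ∣ ev l φ := Iff.rfl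

/-- The easy half of Saito's criterion: derivations tangent to a hyperplane are linearly
dependent along it, so their coefficient determinant vanishes there. -/
theorem lin_dvd_det {l : Dual F V} (hl : l ≠ 0) {φ : Fin n → Der F V}
    (h : ∀ j, φ j ∈ logDer l) : lin l ∣ (derBasis v).det φ := by
  choose z hz using h
  obtain ⟨i, hi⟩ : ∃ i, l (v i) ≠ 0 := by
    by_contra! hcon
    exact hl (v.ext fun i => by simpa using hcon i)
  set M := (derBasis v).toMatrix φ
  set y : Fin n → Poly F V := fun i => algebraMap F _ (l (v i))
  have h1 : Matrix.vecMul y M = lin l • z := by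
    ext j
    rw [Pi.smul_apply, smul_eq_mul, ← hz j, ev_eq_sum v]
    simp only [Matrix.vecMul, dotProduct, M, y, Basis.toMatrix_apply, derBasis_repr,
      Algebra.smul_def]
  have h2 : M.det • y = lin l • Matrix.vecMul z M.adjugate := by
    rw [← Matrix.smul_vecMul, ← h1, Matrix.vecMul_vecMul, Matrix.mul_adjugate,
      Matrix.vecMul_smul, Matrix.vecMul_one]
  have h3 := congrFun h2 i
  rw [Pi.smul_apply, Pi.smul_apply, smul_eq_mul, smul_eq_mul] at h3
  rw [Basis.det_apply]
  exact (((IsUnit.mk0 _ hi).map (algebraMap F (Poly F V))).dvd_mul_right).1 ⟨_, h3⟩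

/-- Derivations invariant under a reflection are tangent to its hyperplane. -/
theorem mem_logDer_of_invariant {s : V ≃ₗ[F] V} {l : Dual F V} (hs : s ≠ 1) (hl : l ≠ 0)
    (hfix : FixesKer s l) {φ : Der F V} (hφ : derAct s φ = φ) : φ ∈ logDer l := by
  obtain ⟨u, hu⟩ := exists_apply_eq_one hl
  have hne : s⁻¹ u - u ≠ 0 := fun h => hs <| by
    have h1 : s u = u := by
      have : s (s⁻¹ u) = u := by simp
      rwa [sub_eq_zero.1 h] at this
    ext w
    rw [hfix.apply_eq hu, h1]
    simp
  obtain ⟨y, hy⟩ : ∃ y : Dual F V, y (s⁻¹ u - u) ≠ 0 := by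
    by_contra! hcon
    exact hne ((Module.forall_dual_apply_eq_zero_iff F _).1 hcon)
  have h1 := ev_dualAct_derAct s y φ
  rw [hφ, hfix.dualAct_eq hu, ev_add, ev_smul, ← map_sub] at h1
  have h2 := hfix.lin_dvd hl (ev y φ)
  rw [← h1, add_sub_cancel_left, Algebra.smul_def] at h2
  exact (((IsUnit.mk0 _ hy).map (algebraMap F (Poly F V))).dvd_mul_left).1 h2

/-- The Euler derivation `∑ x_i ⊗ v_i`. -/
noncomputable def euler : Der F V := ∑ i, lin (v.coord i) ⊗ₜ v i

theorem ev_euler (y : Dual F V) : ev y (euler v) = lin y := by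
  rw [lin]
  conv_rhs => rw [← v.sum_dual_apply_smul_coord y, map_sum]
  rw [euler, map_sum]
  refine Finset.sum_congr rfl fun i _ => ?_
  rw [ev_tmul, map_smul]

theorem derAct_euler (g : V ≃ₗ[F] V) : derAct g (euler v) = euler v := by
  refine der_ext_ev v fun i => ?_
  have h : v.coord i = dualAct g (dualAct g⁻¹ (v.coord i)) := by
    rw [← dualAct_mul, mul_inv_cancel, dualAct_one]
  rw [ev_euler]
  conv_lhs => rw [h, ev_dualAct_derAct, ev_euler, polyAct_lin, ← h]

end Derivations

/-! ### Invariants of inertia groups -/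

section Inertia

variable {F V : Type*} [Field F] [AddCommGroup V] [Module F V] {G : Subgroup (V ≃ₗ[F] V)}

/-- The inertia subgroup of `f`: the elements of `G` that act trivially modulo `f`. -/
noncomputable def inertia (G : Subgroup (V ≃ₗ[F] V)) (f : Poly F V) : Subgroup G where
  carrier := {g | ∀ a, f ∣ polyAct (g : V ≃ₗ[F] V) a - a}
  one_mem' a := by simp
  mul_mem' {g h} hg hh a := by
    have h1 := dvd_add (hg (polyAct (h : V ≃ₗ[F] V) a)) (hh a)
    rwa [sub_add_sub_cancel, ← polyAct_mul] at h1
  inv_mem' {g} hg a := by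
    have h1 := hg (polyAct (g⁻¹ : V ≃ₗ[F] V) a)
    rw [polyAct_inv_apply, ← dvd_neg, neg_sub] at h1
    exact h1

/-- If `g` is not in the inertia group `T` of the prime `f`, then `g` moves some `T`-invariant
modulo `f`: otherwise `g` would fix, modulo `f`, the coefficients of the polynomial
`∏_{t ∈ T} (X - t a)`, so that `g a` would be one of its roots modulo `f`. -/
theorem exists_invariant_not_dvd (hG : Finite G) {f : Poly F V} (hf : Prime f) {g : G}
    (hg : g ∉ inertia G f) :
    ∃ a, (∀ t ∈ inertia G f, polyAct (t : V ≃ₗ[F] V) a = a) ∧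
      ¬ f ∣ polyAct (g : V ≃ₗ[F] V) a - a := by
  by_contra! hcon
  refine hg fun a => ?_
  have := Fintype.ofFinite (inertia G f)
  let act : G → Poly F V →ₐ[F] Poly F V := fun g => polyAct (g : V ≃ₗ[F] V)
  let p : Polynomial (Poly F V) := ∏ t : inertia G f, (Polynomial.X - Polynomial.C (act t a))
  have hpT : ∀ t ∈ inertia G f, p.map (act t : Poly F V →+* Poly F V) = p := by
    intro t ht
    simp only [p, Polynomial.map_prod, Polynomial.map_sub, Polynomial.map_X, Polynomial.map_C]
    refine Fintype.prod_equiv (Equiv.mulLeft (⟨t, ht⟩ : inertia G f)) _ _ fun s => ?_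
    congr 2
    exact (polyAct_mul _ _ a).symm
  have hcoeff : Polynomial.C f ∣ p.map (act g : Poly F V →+* Poly F V) - p := by
    rw [Polynomial.C_dvd_iff_dvd_coeff]
    intro i
    rw [Polynomial.coeff_sub, Polynomial.coeff_map]
    refine hcon _ fun t ht => ?_
    conv_rhs => rw [← hpT t ht, Polynomial.coeff_map]
    rfl
  have h1 : p.eval a = 0 := by
    rw [Polynomial.eval_prod]
    refine Finset.prod_eq_zero (Finset.mem_univ 1) ?_
    simp [act]
  have h2 : (p.map (act g : Poly F V →+* Poly F V)).eval (act g a) = 0 := by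
    have := Polynomial.eval_map_apply (p := p) (act g : Poly F V →+* Poly F V) a
    rw [h1, map_zero] at this
    exact this
  have h3 : f ∣ p.eval (act g a) := by
    obtain ⟨q, hq⟩ := hcoeff
    have := congrArg (Polynomial.eval (act g a)) hq
    rw [Polynomial.eval_sub, h2, Polynomial.eval_mul, Polynomial.eval_C, zero_sub] at this
    rw [← dvd_neg, this]
    exact Dvd.intro _ rfl
  rw [Polynomial.eval_prod] at h3
  obtain ⟨t, -, ht⟩ := hf.exists_mem_finset_dvd h3
  rw [Polynomial.eval_sub, Polynomial.eval_X, Polynomial.eval_C] at ht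
  have h4 := dvd_add ht (t.2 a)
  rwa [sub_add_sub_cancel] at h4

/-- There is an `S`-combination of the functions `g ↦ g a`, for `a` invariant under the inertia
group `T` of `f`, which vanishes off `T` and is constant on `T`, with a value prime to `f`. -/
theorem exists_separating_function (hG : Finite G) {f : Poly F V} (hf : Prime f) :
    ∃ Φ ∈ Submodule.span (Poly F V) {Φ : G → Poly F V | ∃ a,
        (∀ t ∈ inertia G f, polyAct (t : V ≃ₗ[F] V) a = a) ∧
          Φ = fun g : G => polyAct (g : V ≃ₗ[F] V) a},
      (∀ g ∉ inertia G f, Φ g = 0) ∧ ∃ c, ¬ f ∣ c ∧ ∀ t ∈ inertia G f, Φ t = c := by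
  classical
  have := Fintype.ofFinite G
  let N : Submonoid (G → Poly F V) :=
    { carrier := {Φ | ∃ a, (∀ t ∈ inertia G f, polyAct (t : V ≃ₗ[F] V) a = a) ∧
          Φ = fun g : G => polyAct (g : V ≃ₗ[F] V) a}
      one_mem' := ⟨1, by simp, by funext g; simp⟩
      mul_mem' := by
        rintro _ _ ⟨a, ha, rfl⟩ ⟨b, hb, rfl⟩
        exact ⟨a * b, fun t ht => by rw [map_mul, ha t ht, hb t ht], by
          funext g; simp⟩ }
  have hspan : Submodule.span (Poly F V) (N : Set (G → Poly F V)) =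
      Subalgebra.toSubmodule (Algebra.adjoin (Poly F V) (N : Set (G → Poly F V))) := by
    rw [Algebra.adjoin_eq_span, Submonoid.closure_eq]
  have hex : ∀ g : G, ∃ a, g ∉ inertia G f →
      (∀ t ∈ inertia G f, polyAct (t : V ≃ₗ[F] V) a = a) ∧
        ¬ f ∣ polyAct (g : V ≃ₗ[F] V) a - a := fun g => by
    by_cases hg : g ∈ inertia G f
    · exact ⟨0, fun h => absurd hg h⟩
    · obtain ⟨a, ha⟩ := exists_invariant_not_dvd hG hf hg
      exact ⟨a, fun _ => ha⟩
  choose a ha using hex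
  let Φ : G → Poly F V := ∏ g ∈ Finset.univ.filter (· ∉ inertia G f),
    ((fun h : G => polyAct (h : V ≃ₗ[F] V) (a g)) -
      algebraMap (Poly F V) (G → Poly F V) (polyAct (g : V ≃ₗ[F] V) (a g)))
  have hΦ : ∀ h, Φ h = ∏ g ∈ Finset.univ.filter (· ∉ inertia G f),
      (polyAct (h : V ≃ₗ[F] V) (a g) - polyAct (g : V ≃ₗ[F] V) (a g)) := by
    intro h
    simp only [Φ, Finset.prod_apply]
    rfl
  refine ⟨Φ, ?_, fun g hg => ?_, ∏ g ∈ Finset.univ.filter (· ∉ inertia G f),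
    (a g - polyAct (g : V ≃ₗ[F] V) (a g)), fun hd => ?_, fun t ht => ?_⟩
  · change Φ ∈ Submodule.span (Poly F V) (N : Set (G → Poly F V))
    rw [hspan]
    refine Subalgebra.prod_mem _ fun g hg => ?_
    rw [Finset.mem_filter] at hg
    exact Subalgebra.sub_mem _ (Algebra.subset_adjoin ⟨a g, (ha g hg.2).1, rfl⟩)
      (Subalgebra.algebraMap_mem _ _)
  · rw [hΦ]
    exact Finset.prod_eq_zero (Finset.mem_filter.2 ⟨Finset.mem_univ g, hg⟩) (sub_self _)
  · obtain ⟨g, hg, hgd⟩ := hf.exists_mem_finset_dvd hd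
    rw [Finset.mem_filter] at hg
    rw [← dvd_neg, neg_sub] at hgd
    exact (ha g hg.2).2 hgd
  · rw [hΦ]
    refine Finset.prod_congr rfl fun g hg => ?_
    rw [Finset.mem_filter] at hg
    rw [(ha g hg.2).1 t ht]

/-- The sum of the translates of a derivation over the cosets of a group that fixes it. -/
theorem sum_derAct_mem_invDer {T : Subgroup G} [Fintype (G ⧸ T)] {φ : Der F V}
    (hφ : ∀ t ∈ T, derAct (t : V ≃ₗ[F] V) φ = φ) :
    ∑ q : G ⧸ T, derAct (q.out : V ≃ₗ[F] V) φ ∈ invDer G := by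
  have hout : ∀ g : G, derAct (((g : G ⧸ T).out : G) : V ≃ₗ[F] V) φ =
      derAct (g : V ≃ₗ[F] V) φ := by
    intro g
    obtain ⟨t, ht⟩ := QuotientGroup.mk_out_eq_mul T g
    rw [ht, Subgroup.coe_mul, derAct_mul, hφ _ t.2]
  let Ψ : G ⧸ T → Der F V := fun q => derAct (q.out : V ≃ₗ[F] V) φ
  have hΨ : ∀ (h : G) q, derAct (h : V ≃ₗ[F] V) (Ψ q) = Ψ (h • q) := by
    intro h q
    induction q using QuotientGroup.induction_on with
    | H g =>
      change derAct (h : V ≃ₗ[F] V) (derAct _ φ) = derAct (((h * g : G) : G ⧸ T).out.1) φ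
      rw [hout, hout, ← derAct_mul]
      rfl
  refine mem_invDer.2 fun h hh => ?_
  change derAct h (∑ q, Ψ q) = ∑ q, Ψ q
  rw [map_sum, ← Equiv.sum_comp (MulAction.toPerm (⟨h, hh⟩ : G)) Ψ]
  exact Finset.sum_congr rfl fun q _ => hΨ ⟨h, hh⟩ q

/-- Locally at a prime `f` of `S`, the `S`-module spanned by the `G`-invariant derivations contains
all derivations that are invariant under the inertia group of `f`. -/
theorem exists_smul_mem_span_invDer (hG : Finite G) {f : Poly F V} (hf : Prime f) :
    ∃ c, ¬ f ∣ c ∧ ∀ ψ : Der F V, (∀ t ∈ inertia G f, derAct (t : V ≃ₗ[F] V) ψ = ψ) →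
      c • ψ ∈ Submodule.span (Poly F V) (invDer G : Set (Der F V)) := by
  classical
  obtain ⟨Φ, hΦ, hoff, c, hc, hon⟩ := exists_separating_function hG hf
  refine ⟨c, hc, fun ψ hψ => ?_⟩
  have := Fintype.ofFinite (G ⧸ inertia G f)
  have key : ∀ Φ ∈ Submodule.span (Poly F V) {Φ : G → Poly F V | ∃ a,
        (∀ t ∈ inertia G f, polyAct (t : V ≃ₗ[F] V) a = a) ∧
          Φ = fun g : G => polyAct (g : V ≃ₗ[F] V) a},
      ∑ q : G ⧸ inertia G f, Φ q.out • derAct (q.out : V ≃ₗ[F] V) ψ ∈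
        Submodule.span (Poly F V) (invDer G : Set (Der F V)) := by
    intro Φ hΦ
    induction hΦ using Submodule.span_induction with
    | mem Φ hΦ =>
      obtain ⟨a, ha, rfl⟩ := hΦ
      have h1 : ∀ t ∈ inertia G f, derAct (t : V ≃ₗ[F] V) (a • ψ) = a • ψ := fun t ht => by
        rw [derAct_smul, ha t ht, hψ t ht]
      simp only [← derAct_smul]
      exact Submodule.subset_span (sum_derAct_mem_invDer h1)
    | zero => simp
    | add Φ Ψ _ _ h1 h2 =>
      simp only [Pi.add_apply, add_smul, Finset.sum_add_distrib]
      exact Submodule.add_mem _ h1 h2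
    | smul b Φ _ h1 =>
      simp only [Pi.smul_apply, smul_eq_mul, mul_smul, ← Finset.smul_sum]
      exact Submodule.smul_mem _ b h1
  have h1 := key Φ hΦ
  rw [Finset.sum_eq_single ((1 : G) : G ⧸ inertia G f)] at h1
  · obtain ⟨t, ht⟩ := QuotientGroup.mk_out_eq_mul (inertia G f) 1
    rw [one_mul] at ht
    rwa [ht, hon _ t.2, hψ _ t.2] at h1
  · intro q _ hq
    rw [hoff, zero_smul]
    intro hmem
    refine hq ?_
    rw [← QuotientGroup.out_eq' q]
    refine QuotientGroup.eq.2 ?_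
    rw [mul_one]
    exact Subgroup.inv_mem _ hmem
  · exact fun h => absurd (Finset.mem_univ _) h

end Inertia

/-! ### Saito's criterion for the invariant derivations -/

section Saito

variable {F V : Type*} [Field F] [AddCommGroup V] [Module F V] {n : ℕ}

theorem det_dvd_det_of_mem_span (v : Basis (Fin n) F V) {θ φ : Fin n → Der F V}
    (h : ∀ i, φ i ∈ Submodule.span (Poly F V) (Set.range θ)) :
    (derBasis v).det θ ∣ (derBasis v).det φ := by
  have h1 : ∀ i, ∃ c : Fin n → Poly F V, ∑ j, c j • θ j = φ i := fun i =>
    (Submodule.mem_span_range_iff_exists_fun _).1 (h i)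
  choose c hc using h1
  have h2 : (derBasis v).toMatrix φ =
      (derBasis v).toMatrix θ * Matrix.of fun j i => c i j := by
    ext k i
    rw [Basis.toMatrix_apply, ← hc i, Matrix.mul_apply, map_sum, Finsupp.finsetSum_apply]
    refine Finset.sum_congr rfl fun j _ => ?_
    rw [map_smul, Finsupp.smul_apply, Basis.toMatrix_apply, Matrix.of_apply, smul_eq_mul, mul_comm]
  rw [Basis.det_apply, Basis.det_apply, h2, Matrix.det_mul]
  exact Dvd.intro _ rfl

/-- A prime with nontrivial inertia group is, up to a scalar, the linear form of a reflecting
hyperplane. -/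
theorem exists_associated_form {G : Subgroup (V ≃ₗ[F] V)} {ℓ : Submodule F V → Dual F V}
    (hℓ : ∀ H ∈ reflArrangement G, LinearMap.ker (ℓ H) = H) {f : Poly F V} (hf : Prime f) {g : G}
    (hg : g ∈ inertia G f) (hg1 : g ≠ 1) :
    ∃ H ∈ reflArrangement G, Associated (lin (ℓ H)) f := by
  have hg2 : (g : V ≃ₗ[F] V)⁻¹ ≠ 1 := fun h => hg1 (by
    rw [inv_eq_one] at h
    exact Subtype.ext h)
  obtain ⟨y, hy⟩ : ∃ y : Dual F V, dualAct (g : V ≃ₗ[F] V) y - y ≠ 0 := by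
    by_contra! hcon
    refine hg2 (LinearEquiv.ext fun w => ?_)
    rw [← sub_eq_zero, ← Module.forall_dual_apply_eq_zero_iff F]
    intro y
    rw [map_sub, LinearEquiv.coe_one, id, ← dualAct_apply, ← LinearMap.sub_apply, hcon y,
      LinearMap.zero_apply]
  set z := dualAct (g : V ≃ₗ[F] V) y - y with hz
  have hlin : ∀ x : Dual F V, f ∣ lin (dualAct (g : V ≃ₗ[F] V) x - x) := fun x => by
    have := hg (lin x)
    rwa [polyAct_lin, lin, lin, ← map_sub] at this
  have hassoc : Associated f (lin z) := hf.associated_of_dvd (prime_lin hy) (hlin y)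
  have hfix : FixesKer (g : V ≃ₗ[F] V)⁻¹ z := fun w hw => by
    rw [← sub_eq_zero, ← Module.forall_dual_apply_eq_zero_iff F]
    intro x
    have := ker_le_of_lin_dvd_lin (hassoc.symm.dvd.trans (hlin x)) hw
    rwa [LinearMap.mem_ker, LinearMap.sub_apply, dualAct_apply, ← map_sub] at this
  have hH : LinearMap.ker z ∈ reflArrangement G :=
    ⟨_, G.inv_mem g.2, hg2, isCoatom_ker hy, fun w hw => hfix w hw⟩
  refine ⟨_, hH, ?_⟩
  have h1 : LinearMap.ker (ℓ (LinearMap.ker z)) = LinearMap.ker z := hℓ _ hH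
  obtain ⟨u, hu⟩ := exists_apply_eq_one hy
  have h2 : ℓ (LinearMap.ker z) = (ℓ (LinearMap.ker z)) u • z :=
    eq_smul_of_ker_le hu fun w hw => by
      rw [← LinearMap.mem_ker, h1]
      exact hw
  have h3 : lin z ∣ lin (ℓ (LinearMap.ker z)) := by
    rw [h2, lin_smul, Algebra.smul_def]
    exact Dvd.intro_left _ rfl
  exact (((prime_lin hy).associated_of_dvd (prime_lin (form_ne_zero hℓ hH)) h3).symm).trans
    hassoc.symm

/-- There is a basis of `V`, all but one of whose vectors lie in a given hyperplane. -/
theorem exists_adapted_basis (v : Basis (Fin n) F V) {l : Dual F V} {u : V} (hu : l u = 1) :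
    ∃ (w : Basis (Fin n) F V) (i : Fin n), w i = u ∧ w.coord i = l ∧ ∀ j ≠ i, l (w j) = 0 := by
  have := Module.Finite.of_basis v
  obtain ⟨ι, b, i, hv, hf⟩ := exists_basis_of_pairing_ne_zero (f := l) (v := u) (by
    rw [hu]; exact one_ne_zero)
  rw [hu, one_smul] at hf
  refine ⟨b.reindex (b.indexEquiv v), b.indexEquiv v i, by simp [hv], ?_, fun j hj => ?_⟩
  · ext x
    rw [hf]
    simp
  · rw [hf]
    have : (b.indexEquiv v).symm j ≠ i := fun h => hj (by rw [← h, Equiv.apply_symm_apply])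
    simp [Finsupp.single_eq_of_ne this.symm]

variable {G : Subgroup (V ≃ₗ[F] V)} {ℓ : Submodule F V → Dual F V} (v : Basis (Fin n) F V)
  (θ : Basis (Fin n) (invPoly G) (invDer G))

/-- The elements of a basis of the invariant derivations, as derivations. -/
noncomputable def basicDer (j : Fin n) : Der F V := θ j

theorem span_invDer :
    Submodule.span (Poly F V) (invDer G : Set (Der F V)) =
      Submodule.span (Poly F V) (Set.range (basicDer θ)) := by
  refine le_antisymm (Submodule.span_le.2 fun φ hφ => ?_)
    (Submodule.span_mono ?_)
  · have h1 := congrArg Subtype.val (θ.sum_repr ⟨φ, hφ⟩)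
    rw [AddSubmonoidClass.coe_finsetSum] at h1
    change φ ∈ _
    have h2 : φ = _ := h1.symm
    rw [h2]
    refine Submodule.sum_mem _ fun j _ => ?_
    exact Submodule.smul_mem _ ((θ.repr ⟨φ, hφ⟩ j : invPoly G) : Poly F V)
      (Submodule.subset_span ⟨j, rfl⟩)
  · rintro _ ⟨j, rfl⟩
    exact (θ j).2

/-- Locally at each prime, the coefficient determinant of a basis of the invariant derivations
divides the product of the forms of the reflecting hyperplanes. -/
theorem det_dvd_mul_arrProd (hG : Finite G)
    (hℓ : ∀ H ∈ reflArrangement G, LinearMap.ker (ℓ H) = H) {f : Poly F V} (hf : Prime f) :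
    ∃ c, ¬ f ∣ c ∧ (derBasis v).det (basicDer θ) ∣ c * arrProd G ℓ 1 := by
  obtain ⟨c, hc, hψ⟩ := exists_smul_mem_span_invDer hG hf
  rw [span_invDer θ] at hψ
  refine ⟨c ^ n, fun hd => hc (hf.dvd_of_dvd_pow hd), ?_⟩
  by_cases htriv : ∀ g ∈ inertia G f, g = 1
  · have h1 := det_dvd_det_of_mem_span v (θ := basicDer θ) (φ := fun i => c • derBasis v i)
      fun i => hψ _ fun t ht => by
        rw [htriv t ht, derBasis_apply, derAct_tmul]
        simp
    have h2 := AlternatingMap.map_smul_univ (derBasis v).det (fun _ => c) (derBasis v)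
    rw [Basis.det_self, Finset.prod_const, Finset.card_univ, Fintype.card_fin, smul_eq_mul,
      mul_one] at h2
    rw [h2] at h1
    exact h1.mul_right _
  push Not at htriv
  obtain ⟨g, hg, hg1⟩ := htriv
  obtain ⟨H, hH, hassoc⟩ := exists_associated_form hℓ hf hg hg1
  have hl := form_ne_zero hℓ hH
  obtain ⟨u, hu⟩ := exists_apply_eq_one hl
  obtain ⟨w, i, hwi, hcoord, hw⟩ := exists_adapted_basis v hu
  -- the inertia group fixes the hyperplane pointwise
  have hfix : ∀ t ∈ inertia G f, ∀ x, ℓ H x = 0 → (t : V ≃ₗ[F] V) x = x := by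
    intro t ht x hx
    have h1 : (t : V ≃ₗ[F] V)⁻¹ x = x := by
      rw [← sub_eq_zero, ← Module.forall_dual_apply_eq_zero_iff F]
      intro y
      have h2 := ht (lin y)
      rw [polyAct_lin, lin, lin, ← map_sub] at h2
      have := ker_le_of_lin_dvd_lin (hassoc.dvd.trans h2) hx
      rwa [LinearMap.mem_ker, LinearMap.sub_apply, dualAct_apply, ← map_sub] at this
    conv_lhs => rw [← h1]
    simp
  have hmem : ∀ j ≠ i, c • derBasis w j ∈ Submodule.span (Poly F V) (Set.range (basicDer θ)) :=
    fun j hj => hψ _ fun t ht => by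
      rw [derBasis_apply, derAct_tmul, map_one, hfix t ht _ (hw j hj)]
  have hmem_i : c • lin (ℓ H) • derBasis w i ∈
      Submodule.span (Poly F V) (Set.range (basicDer θ)) := by
    have h1 : lin (ℓ H) • derBasis w i =
        euler w - ∑ j ∈ Finset.univ.erase i, lin (w.coord j) • derBasis w j := by
      have h2 : euler w = ∑ j, lin (w.coord j) • derBasis w j := by
        rw [euler]
        refine Finset.sum_congr rfl fun j _ => ?_
        rw [derBasis_apply, TensorProduct.smul_tmul', smul_eq_mul, mul_one]
      rw [h2, ← Finset.add_sum_erase _ _ (Finset.mem_univ i), hcoord, add_sub_cancel_right]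
    rw [h1, smul_sub, Finset.smul_sum]
    refine Submodule.sub_mem _ (hψ _ fun t _ => derAct_euler w _)
      (Submodule.sum_mem _ fun j hj => ?_)
    rw [smul_comm]
    exact Submodule.smul_mem _ _ (hmem j (Finset.ne_of_mem_erase hj))
  have h1 := det_dvd_det_of_mem_span v (θ := basicDer θ)
    (φ := fun j => c • Function.update (derBasis w) i (lin (ℓ H) • derBasis w i) j) fun j => by
      by_cases hj : j = i
      · subst hj
        simpa using hmem_i
      · rw [Function.update_of_ne hj]
        exact hmem j hj
  have h2 := AlternatingMap.map_smul_univ (derBasis v).det (fun _ => c)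
    (Function.update (derBasis w) i (lin (ℓ H) • derBasis w i))
  rw [h2, Finset.prod_const, Finset.card_univ, Fintype.card_fin, smul_eq_mul,
    AlternatingMap.map_update_smul, Function.update_eq_self, smul_eq_mul, ← mul_assoc] at h1
  refine ((Basis.isUnit_det (derBasis v) (derBasis w)).dvd_mul_right.1 h1).trans
    (mul_dvd_mul_left _ ?_)
  obtain ⟨R, hR, -⟩ := arrProd_factor hG hℓ 1 hH
  rw [hR, Pi.one_apply, pow_one]
  exact Dvd.intro _ rfl

theorem basicDer_mem_logDer (hℓ : ∀ H ∈ reflArrangement G, LinearMap.ker (ℓ H) = H)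
    {H : Submodule F V} (hH : H ∈ reflArrangement G) (j : Fin n) :
    basicDer θ j ∈ logDer (ℓ H) := by
  obtain ⟨s, hs, h1, -, h3⟩ := id hH
  refine mem_logDer_of_invariant h1 (form_ne_zero hℓ hH) (fun w hw => h3 w ?_)
    (mem_invDer.1 (θ j).2 s hs)
  rw [← hℓ H hH]
  exact hw

theorem arrProd_dvd_det (hG : Finite G) (hℓ : ∀ H ∈ reflArrangement G, LinearMap.ker (ℓ H) = H)
    {φ : Fin n → Der F V} (h : ∀ H ∈ reflArrangement G, ∀ j, φ j ∈ logDer (ℓ H)) :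
    arrProd G ℓ 1 ∣ (derBasis v).det φ :=
  arrProd_dvd hG hℓ fun H hH => by
    rw [Pi.one_apply, pow_one]
    exact lin_dvd_det v (form_ne_zero hℓ hH) (h H hH)

/-- The coefficient determinant of a basis of the invariant derivations is, up to a nonzero scalar,
the product of the forms of the reflecting hyperplanes. -/
theorem exists_det_basicDer_eq (hG : Finite G)
    (hℓ : ∀ H ∈ reflArrangement G, LinearMap.ker (ℓ H) = H) :
    ∃ c : F, c ≠ 0 ∧ (derBasis v).det (basicDer θ) = c • arrProd G ℓ 1 := by
  have hQ := arrProd_ne_zero hG hℓ 1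
  have hne : (derBasis v).det (basicDer θ) ≠ 0 := by
    rcases n with - | n
    · rw [Basis.det_isEmpty]
      exact one_ne_zero
    · have hl : v.coord 0 ≠ 0 := fun h => by
        have := LinearMap.congr_fun h (v 0)
        simp at this
      obtain ⟨c, hc, hd⟩ := det_dvd_mul_arrProd v θ hG hℓ (prime_lin hl)
      refine ne_zero_of_dvd_ne_zero (mul_ne_zero (fun h => hc ?_) hQ) hd
      rw [h]
      exact dvd_zero _
  have h1 := dvd_of_forall_prime_dvd_mul hne fun f hf => det_dvd_mul_arrProd v θ hG hℓ hf
  have h2 := arrProd_dvd_det v hG hℓ fun H hH j => basicDer_mem_logDer θ hℓ hH j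
  obtain ⟨a, ha⟩ := associated_of_dvd_dvd h2 h1
  obtain ⟨c, hc⟩ := isUnit_poly a.isUnit
  refine ⟨c, ?_, by rw [← ha, hc, mul_comm, Algebra.smul_def]⟩
  rintro rfl
  rw [map_zero] at hc
  exact a.isUnit.ne_zero hc

theorem det_basicDer_ne_zero (hG : Finite G)
    (hℓ : ∀ H ∈ reflArrangement G, LinearMap.ker (ℓ H) = H) :
    (derBasis v).det (basicDer θ) ≠ 0 := by
  obtain ⟨c, hc, h⟩ := exists_det_basicDer_eq v θ hG hℓ
  rw [h]
  exact smul_ne_zero hc (arrProd_ne_zero hG hℓ 1)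

theorem det_smul_eq_sum (θ : Fin n → Der F V) (φ : Der F V) :
    (derBasis v).det θ • φ = ∑ j, (derBasis v).det (Function.update θ j φ) • θ j := by
  have h1 := Matrix.mulVec_cramer ((derBasis v).toMatrix θ) ((derBasis v).repr φ)
  refine der_ext_ev v fun i => ?_
  have h2 := congrFun h1 i
  rw [Pi.smul_apply, smul_eq_mul, derBasis_repr, ← Basis.det_apply] at h2
  rw [map_smul, smul_eq_mul, ← h2, map_sum]
  simp only [Matrix.mulVec, dotProduct, Basis.toMatrix_apply, derBasis_repr, map_smul, smul_eq_mul,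
    Matrix.cramer_apply, Basis.det_apply, Basis.toMatrix_update]
  exact Finset.sum_congr rfl fun j _ => mul_comm _ _

/-- The derivations tangent to all reflecting hyperplanes are the `S`-combinations of a basis of the
invariant derivations. -/
theorem exists_sum_basicDer_eq (v : Basis (Fin n) F V) (hG : Finite G)
    (hℓ : ∀ H ∈ reflArrangement G, LinearMap.ker (ℓ H) = H) {φ : Der F V}
    (hφ : ∀ H ∈ reflArrangement G, φ ∈ logDer (ℓ H)) :
    ∃ a : Fin n → Poly F V, φ = ∑ j, a j • basicDer θ j := by
  obtain ⟨c, hc, hdet⟩ := exists_det_basicDer_eq v θ hG hℓ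
  have h1 : ∀ j, arrProd G ℓ 1 ∣ (derBasis v).det (Function.update (basicDer θ) j φ) := by
    refine fun j => arrProd_dvd_det v hG hℓ fun H hH i => ?_
    by_cases hi : i = j
    · subst hi
      simpa using hφ H hH
    · rw [Function.update_of_ne hi]
      exact basicDer_mem_logDer θ hℓ hH i
  choose a ha using h1
  refine ⟨fun j => c⁻¹ • a j, ?_⟩
  have h2 := det_smul_eq_sum v (basicDer θ) φ
  refine (smul_right_injective _ (arrProd_ne_zero hG hℓ 1)).eq_iff.1 ?_
  have h3 : arrProd G ℓ 1 • φ = c⁻¹ • ((derBasis v).det (basicDer θ) • φ) := by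
    rw [hdet, smul_assoc, smul_smul, inv_mul_cancel₀ hc, one_smul]
  change arrProd G ℓ 1 • φ = arrProd G ℓ 1 • _
  rw [h3, h2, Finset.smul_sum, Finset.smul_sum]
  refine Finset.sum_congr rfl fun j _ => ?_
  rw [ha j, mul_smul, smul_assoc, smul_comm c⁻¹]

end Saito

/-! ### Anticommuting families -/

section Anticommuting

/-- The elements `x i` have square zero and anticommute. -/
def IsAnticommuting {ι A : Type*} [Ring A] (x : ι → A) : Prop :=
  (∀ i, x i * x i = 0) ∧ ∀ i j, x i * x j = -(x j * x i)

/-- Reordering a product of anticommuting elements changes it by a sign, which depends only on the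
two orderings. -/
theorem exists_sign_of_perm (F A : Type*) {ι : Type*} [Field F] [Ring A] [Algebra F A]
    {L L' : List ι} (h : L.Perm L') :
    ∃ ε : F, ε * ε = 1 ∧
      ∀ x : ι → A, IsAnticommuting x → (L.map x).prod = ε • (L'.map x).prod := by
  induction h with
  | nil => exact ⟨1, by simp, by simp⟩
  | cons i _ ih =>
    obtain ⟨ε, hε, h⟩ := ih
    exact ⟨ε, hε, fun x hx => by simp [h x hx]⟩
  | swap i j L =>
    refine ⟨-1, by simp, fun x hx => ?_⟩
    simp only [List.map_cons, List.prod_cons, ← mul_assoc]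
    rw [hx.2 j i]
    simp
  | trans _ _ ih1 ih2 =>
    obtain ⟨ε, hε, h⟩ := ih1
    obtain ⟨δ, hδ, h'⟩ := ih2
    exact ⟨ε * δ, by linear_combination hδ + (δ * δ) * hε,
      fun x hx => by rw [h x hx, h' x hx, smul_smul]⟩

theorem mul_prod_eq_zero {ι A : Type*} [Ring A] {x : ι → A} (hx : IsAnticommuting x) {i : ι}
    {L : List ι} (hi : i ∈ L) : x i * (L.map x).prod = 0 := by
  induction L with
  | nil => simp at hi
  | cons j L ih =>
    rw [List.map_cons, List.prod_cons, ← mul_assoc]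
    rcases List.mem_cons.1 hi with rfl | hi
    · rw [hx.1, zero_mul]
    · rw [hx.2, neg_mul, mul_assoc, ih hi, mul_zero, neg_zero]

end Anticommuting

/-! ### Coefficients in the polynomial functions -/

section Embedding

variable {F V : Type*} [Field F] [AddCommGroup V] [Module F V]

/-- The embedding `S ⊗ M → S ⊗ ∧M`. -/
noncomputable def extEmb (S M : Type*) [CommRing S] [Algebra F S] [AddCommGroup M] [Module F M] :
    S ⊗[F] M →ₗ[S] S ⊗[F] ExteriorAlgebra F M :=
  (ExteriorAlgebra.ι F).baseChange S

variable {S M : Type*} [CommRing S] [Algebra F S] [AddCommGroup M] [Module F M]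

@[simp] theorem extEmb_tmul (a : S) (x : M) :
    extEmb S M (a ⊗ₜ[F] x) = a ⊗ₜ ExteriorAlgebra.ι F x := rfl

theorem ι_mul_ι_swap (x y : M) : ExteriorAlgebra.ι F x * ExteriorAlgebra.ι F y =
    -(ExteriorAlgebra.ι F y * ExteriorAlgebra.ι F x) := by
  have h := ExteriorAlgebra.ι_sq_zero (R := F) (x + y)
  rw [map_add, add_mul, mul_add, mul_add, ExteriorAlgebra.ι_sq_zero, ExteriorAlgebra.ι_sq_zero,
    zero_add, add_zero] at h
  exact eq_neg_of_add_eq_zero_left h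

theorem extEmb_mul_swap (φ ψ : S ⊗[F] M) :
    extEmb S M φ * extEmb S M ψ = -(extEmb S M ψ * extEmb S M φ) := by
  induction φ using TensorProduct.induction_on with
  | zero => simp
  | add φ φ' h h' => rw [map_add, add_mul, mul_add, h, h', neg_add]
  | tmul a x =>
    induction ψ using TensorProduct.induction_on with
    | zero => simp
    | add ψ ψ' h h' => rw [map_add, add_mul, mul_add, h, h', neg_add]
    | tmul b y =>
      rw [extEmb_tmul, extEmb_tmul, Algebra.TensorProduct.tmul_mul_tmul,
        Algebra.TensorProduct.tmul_mul_tmul, ι_mul_ι_swap, TensorProduct.tmul_neg, mul_comm a b]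

theorem extEmb_mul_self (φ : S ⊗[F] M) : extEmb S M φ * extEmb S M φ = 0 := by
  induction φ using TensorProduct.induction_on with
  | zero => simp
  | tmul a x =>
    rw [extEmb_tmul, Algebra.TensorProduct.tmul_mul_tmul, ExteriorAlgebra.ι_sq_zero,
      TensorProduct.tmul_zero]
  | add φ ψ h h' =>
    rw [map_add, add_mul, mul_add, mul_add, h, h', extEmb_mul_swap φ ψ]
    abel

theorem isAnticommuting_extEmb {ι : Type*} (φ : ι → S ⊗[F] M) :
    IsAnticommuting fun i => extEmb S M (φ i) :=
  ⟨fun i => extEmb_mul_self (φ i), fun i j => extEmb_mul_swap (φ i) (φ j)⟩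

theorem derToMulti_eq (φ : Der F V) : derToMulti φ = extEmb (Poly F V) V φ := rfl

end Embedding

/-! ### The dual one-forms -/

section DualForms

variable {F V : Type*} [Field F] [AddCommGroup V] [Module F V] {n : ℕ}

/-- The `S`-bilinear pairing of one-forms and derivations. -/
noncomputable def pair : OneForm F V →ₗ[Poly F V] Der F V →ₗ[Poly F V] Poly F V :=
  LinearMap.liftBaseChange (Poly F V)
    { toFun := ev
      map_add' := fun y z => LinearMap.ext fun φ => ev_add y z φ
      map_smul' := fun c y => LinearMap.ext fun φ => ev_smul c y φ }

@[simp] theorem pair_tmul (a : Poly F V) (y : Dual F V) (φ : Der F V) :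
    pair (a ⊗ₜ y) φ = a * ev y φ := rfl

/-- The `S`-linear extension of the coefficient of the volume form. -/
noncomputable def volS (v : Basis (Fin n) F V) : MultiDer F V →ₗ[Poly F V] Poly F V :=
  (Algebra.linearMap F (Poly F V) ∘ₗ volCoeff v).liftBaseChange (Poly F V)

@[simp] theorem volS_tmul (v : Basis (Fin n) F V) (a : Poly F V) (x : ExteriorAlgebra F V) :
    volS v (a ⊗ₜ x) = volCoeff v x • a := by
  simp [volS, Algebra.smul_def, mul_comm]

theorem pair_dualizing (v : Basis (Fin n) F V) (β : MultiDer F V) (φ : Der F V) :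
    pair (TensorProduct.map LinearMap.id (dualizing v) β) φ =
      volS v (extEmb (Poly F V) V φ * β) := by
  induction β using TensorProduct.induction_on with
  | zero => simp
  | add β β' h h' => rw [map_add, map_add, LinearMap.add_apply, h, h', mul_add, map_add]
  | tmul a x =>
    induction φ using TensorProduct.induction_on with
    | zero => simp
    | add φ ψ h h' => rw [map_add, h, h', map_add, add_mul, map_add]
    | tmul b u =>
      rw [TensorProduct.map_tmul, LinearMap.id_apply, pair_tmul, ev_tmul, extEmb_tmul,
        Algebra.TensorProduct.tmul_mul_tmul, volS_tmul, mul_smul_comm, mul_comm a b]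
      rfl

/-- The coefficient of the volume form in `φ₁ ∧ ⋯ ∧ φₙ` is the coefficient determinant, since both
are alternating. -/
theorem volS_prod (v : Basis (Fin n) F V) (φ : Fin n → Der F V) :
    volS v (((List.finRange n).map fun i => extEmb (Poly F V) V (φ i)).prod) =
      (derBasis v).det φ := by
  let L : ExteriorAlgebra (Poly F V) (Der F V) →ₐ[Poly F V] MultiDer F V :=
    ExteriorAlgebra.lift (Poly F V) ⟨extEmb (Poly F V) V, extEmb_mul_self⟩
  let a : Der F V [⋀^Fin n]→ₗ[Poly F V] Poly F V :=
    (volS v ∘ₗ L.toLinearMap).compAlternatingMap (ExteriorAlgebra.ιMulti (Poly F V) n)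
  have ha : ∀ ψ, a ψ =
      volS v (((List.finRange n).map fun i => extEmb (Poly F V) V (ψ i)).prod) := by
    intro ψ
    change volS v (L (ExteriorAlgebra.ιMulti (Poly F V) n ψ)) = _
    rw [ExteriorAlgebra.ιMulti_apply, map_list_prod, List.ofFn_eq_map, List.map_map]
    congr 3
    funext i
    simp [L]
  have h1 : a (derBasis v) = 1 := by
    rw [ha]
    have h2 : ((List.finRange n).map fun i => extEmb (Poly F V) V (derBasis v i)).prod =
        1 ⊗ₜ ExteriorAlgebra.ιMulti F n v := by
      have h3 := map_list_prod (Algebra.TensorProduct.includeRight :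
        ExteriorAlgebra F V →ₐ[F] MultiDer F V)
        ((List.finRange n).map fun i => ExteriorAlgebra.ι F (v i))
      rw [List.map_map] at h3
      rw [ExteriorAlgebra.ιMulti_apply, List.ofFn_eq_map]
      refine Eq.trans ?_ h3.symm
      congr 2
      funext i
      rw [derBasis_apply]
      rfl
    rw [h2, volS_tmul, volCoeff, ExteriorAlgebra.liftAlternating_apply_ιMulti, Pi.single_eq_same,
      Basis.det_self, one_smul]
  rw [← ha, a.eq_smul_basis_det (derBasis v), h1, one_smul]

/-- The dual one-form `ω_i` replaces `θ_i` in the coefficient determinant of the `θ_j`. -/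
theorem exists_pair_dualOneForm (v : Basis (Fin n) F V) (G : Subgroup (V ≃ₗ[F] V))
    (ℓ : Submodule F V → Dual F V) (θ : Fin n → Der F V) (i : Fin n) :
    ∃ ε : F, ε * ε = 1 ∧ ∀ φ, pair (dualOneForm v G ℓ θ i) φ =
      ε • (Qdet G ℓ * (derBasis v).det (Function.update θ i φ)) := by
  have hperm : (i :: (Finset.univ.erase i).sort (· ≤ ·)).Perm (List.finRange n) := by
    refine (List.perm_ext_iff_of_nodup ?_ (List.nodup_finRange n)).2 fun j => ?_
    · exact List.nodup_cons.2 ⟨by simp, Finset.sort_nodup _ _⟩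
    · simp [em]
  obtain ⟨ε, hε, h⟩ := exists_sign_of_perm F (MultiDer F V) hperm
  refine ⟨ε, hε, fun φ => ?_⟩
  have h1 := h _ (isAnticommuting_extEmb (Function.update θ i φ))
  have h2 : (((Finset.univ.erase i).sort (· ≤ ·)).map fun j =>
      extEmb (Poly F V) V (Function.update θ i φ j)) =
      ((Finset.univ.erase i).sort (· ≤ ·)).map fun j => derToMulti (θ j) := by
    refine List.map_congr_left fun j hj => ?_
    have : j ≠ i := by simpa using hj
    rw [Function.update_of_ne this, derToMulti_eq]
  rw [List.map_cons, List.prod_cons, Function.update_self, h2] at h1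
  rw [dualOneForm, pair_dualizing, orderedProd, mul_smul_comm, map_smul, h1,
    LinearMap.map_smul_of_tower, volS_prod, smul_eq_mul, mul_smul_comm]

end DualForms

/-! ### Contraction of differential forms by derivations -/

section Contraction

variable {F V : Type*} [Field F] [AddCommGroup V] [Module F V]

/-- Contraction of forms by vectors. -/
noncomputable def contrF :
    V →ₗ[F] ExteriorAlgebra F (Dual F V) →ₗ[F] ExteriorAlgebra F (Dual F V) :=
  (CliffordAlgebra.contractLeft (Q := (0 : QuadraticForm F (Dual F V)))) ∘ₗ Dual.eval F V

theorem contrF_ι_mul (u : V) (y : Dual F V) (x : ExteriorAlgebra F (Dual F V)) :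
    contrF u (ExteriorAlgebra.ι F y * x) = y u • x - ExteriorAlgebra.ι F y * contrF u x :=
  CliffordAlgebra.contractLeft_ι_mul _ _ _

theorem contrF_algebraMap (u : V) (c : F) :
    contrF u (algebraMap F (ExteriorAlgebra F (Dual F V)) c) = 0 :=
  CliffordAlgebra.contractLeft_algebraMap _ _ _

theorem contrF_comm (u w : V) (x : ExteriorAlgebra F (Dual F V)) :
    contrF u (contrF w x) = -contrF w (contrF u x) :=
  CliffordAlgebra.contractLeft_comm _ _ _

theorem contrF_self (u : V) (x : ExteriorAlgebra F (Dual F V)) :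
    contrF u (contrF u x) = 0 :=
  CliffordAlgebra.contractLeft_contractLeft _ _

theorem contrF_map (g : V ≃ₗ[F] V) (u : V) (x : ExteriorAlgebra F (Dual F V)) :
    contrF (g u) (ExteriorAlgebra.map (dualAct g) x) =
      ExteriorAlgebra.map (dualAct g) (contrF u x) := by
  induction x using CliffordAlgebra.left_induction with
  | algebraMap c =>
    rw [AlgHom.commutes]
    exact (contrF_algebraMap (g u) c).trans
      (((congrArg (ExteriorAlgebra.map (dualAct g)) (contrF_algebraMap u c)).trans
        (map_zero _)).symm)
  | add x y hx hy => simp only [map_add, hx, hy]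
  | ι_mul x y hx =>
    change contrF (g u) (ExteriorAlgebra.map (dualAct g) (ExteriorAlgebra.ι F y * x)) =
      ExteriorAlgebra.map (dualAct g) (contrF u (ExteriorAlgebra.ι F y * x))
    rw [map_mul, ExteriorAlgebra.map_apply_ι, contrF_ι_mul, contrF_ι_mul, hx, map_sub, map_smul,
      map_mul, ExteriorAlgebra.map_apply_ι, dualAct_apply_apply]

/-- Contraction of differential forms by derivations, bilinear over `S`. -/
noncomputable def contr : Der F V →ₗ[Poly F V] DiffForm F V →ₗ[Poly F V] DiffForm F V :=
  LinearMap.liftBaseChange (Poly F V)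
    (LinearMap.baseChangeHom F (Poly F V) _ _ ∘ₗ contrF)

@[simp] theorem contr_tmul (a b : Poly F V) (u : V) (x : ExteriorAlgebra F (Dual F V)) :
    contr (a ⊗ₜ[F] u) (b ⊗ₜ[F] x) = (a * b) ⊗ₜ contrF u x := rfl

theorem contr_extEmb_mul (φ : Der F V) (ω : OneForm F V) (η : DiffForm F V) :
    contr φ (extEmb _ _ ω * η) = pair ω φ • η - extEmb _ _ ω * contr φ η := by
  induction φ using TensorProduct.induction_on with
  | zero => simp
  | add φ ψ h h' => simp only [map_add, LinearMap.add_apply, h, h', mul_add, add_smul]; abel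
  | tmul a u =>
    induction ω using TensorProduct.induction_on with
    | zero => simp
    | add ω ω' h h' => simp only [map_add, LinearMap.add_apply, h, h', add_mul, add_smul]; abel
    | tmul b y =>
      induction η using TensorProduct.induction_on with
      | zero => simp
      | add η η' h h' => simp only [map_add, h, h', mul_add, smul_add]; abel
      | tmul c x =>
        rw [extEmb_tmul, Algebra.TensorProduct.tmul_mul_tmul, contr_tmul, contrF_ι_mul, contr_tmul,
          Algebra.TensorProduct.tmul_mul_tmul, pair_tmul, ev_tmul, TensorProduct.tmul_sub,
          TensorProduct.smul_tmul', TensorProduct.tmul_smul, TensorProduct.smul_tmul', smul_eq_mul]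
        congr 2
        · rw [mul_smul_comm, smul_mul_assoc]
          congr 1
          ring
        · ring

theorem contr_one (φ : Der F V) : contr φ (1 : DiffForm F V) = 0 := by
  induction φ using TensorProduct.induction_on with
  | zero => simp
  | add φ ψ h h' => rw [map_add, LinearMap.add_apply, h, h', add_zero]
  | tmul a u =>
    have h := contrF_algebraMap u (1 : F)
    rw [map_one] at h
    rw [Algebra.TensorProduct.one_def, contr_tmul, h, TensorProduct.tmul_zero]

theorem contr_comm (φ ψ : Der F V) (η : DiffForm F V) :
    contr φ (contr ψ η) = -contr ψ (contr φ η) := by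
  induction φ using TensorProduct.induction_on with
  | zero => simp
  | add φ φ' h h' => simp only [map_add, LinearMap.add_apply, h, h', neg_add]
  | tmul a u =>
    induction ψ using TensorProduct.induction_on with
    | zero => simp
    | add ψ ψ' h h' => simp only [map_add, LinearMap.add_apply, h, h', neg_add]
    | tmul b w =>
      induction η using TensorProduct.induction_on with
      | zero => simp
      | add η η' h h' => simp only [map_add, h, h', neg_add]
      | tmul c x =>
        simp only [contr_tmul]
        rw [contrF_comm, TensorProduct.tmul_neg, mul_left_comm]

theorem contr_self (φ : Der F V) (η : DiffForm F V) : contr φ (contr φ η) = 0 := by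
  induction φ using TensorProduct.induction_on with
  | zero => simp
  | add φ ψ h h' =>
    simp only [map_add, LinearMap.add_apply, h, h', contr_comm φ ψ]
    abel
  | tmul a u =>
    induction η using TensorProduct.induction_on with
    | zero => simp
    | add η η' h h' => simp only [map_add, h, h', add_zero]
    | tmul c x => rw [contr_tmul, contr_tmul, contrF_self, TensorProduct.tmul_zero]

/-- The component of degree zero of a differential form. -/
noncomputable def degZero : DiffForm F V →ₗ[Poly F V] Poly F V :=
  (Algebra.linearMap F (Poly F V) ∘ₗ
    (ExteriorAlgebra.algebraMapInv (R := F) (M := Dual F V)).toLinearMap).liftBaseChange (Poly F V)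

@[simp] theorem degZero_tmul (a : Poly F V) (x : ExteriorAlgebra F (Dual F V)) :
    degZero (a ⊗ₜ[F] x) = ExteriorAlgebra.algebraMapInv x • a := by
  simp [degZero, Algebra.smul_def, mul_comm]

theorem degZero_extEmb_mul (ω : OneForm F V) (η : DiffForm F V) :
    degZero (extEmb _ _ ω * η) = 0 := by
  induction ω using TensorProduct.induction_on with
  | zero => simp
  | add ω ω' h h' => rw [map_add, add_mul, map_add, h, h', add_zero]
  | tmul b y =>
    induction η using TensorProduct.induction_on with
    | zero => simp
    | add η η' h h' => rw [mul_add, map_add, h, h', add_zero]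
    | tmul c x => simp [ExteriorAlgebra.algebraMapInv]

theorem degZero_one : degZero (1 : DiffForm F V) = 1 := by
  rw [Algebra.TensorProduct.one_def, degZero_tmul, map_one, one_smul]

/-- The value of a differential form at a list of derivations. -/
noncomputable def evalAtDers : List (Der F V) → DiffForm F V →ₗ[Poly F V] Poly F V
  | [] => degZero
  | φ :: L => evalAtDers L ∘ₗ contr φ

@[simp] theorem evalAtDers_nil (η : DiffForm F V) : evalAtDers [] η = degZero η := rfl

@[simp] theorem evalAtDers_cons (φ : Der F V) (L : List (Der F V)) (η : DiffForm F V) :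
    evalAtDers (φ :: L) η = evalAtDers L (contr φ η) := rfl

/-- Moving an entry of the list to the front changes the value by a sign. -/
theorem exists_sign_evalAtDers_append (φ : Der F V) (L L' : List (Der F V)) :
    ∃ ε : F, ∀ η : DiffForm F V,
      evalAtDers (L ++ φ :: L') η = ε • evalAtDers (φ :: (L ++ L')) η := by
  induction L with
  | nil => exact ⟨1, fun η => by simp⟩
  | cons ψ L ih =>
    obtain ⟨ε, h⟩ := ih
    refine ⟨-ε, fun η => ?_⟩
    rw [List.cons_append, evalAtDers_cons, h, evalAtDers_cons, evalAtDers_cons, List.cons_append,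
      evalAtDers_cons, contr_comm, map_neg, smul_neg, neg_smul]

/-- The value at a list with a repeated entry vanishes. -/
theorem evalAtDers_eq_zero {φ : Der F V} {L : List (Der F V)} (h : φ ∈ L) (η : DiffForm F V) :
    evalAtDers (φ :: L) η = 0 := by
  obtain ⟨L₁, L₂, rfl⟩ := List.append_of_mem h
  obtain ⟨ε, hε⟩ := exists_sign_evalAtDers_append φ L₁ L₂
  rw [evalAtDers_cons, hε, evalAtDers_cons, contr_self, map_zero, smul_zero]

/-! ### The group action on forms -/

/-- The action of `g` on `S ⊗ V*`. -/
noncomputable def oneAct (g : V ≃ₗ[F] V) : OneForm F V →ₗ[F] OneForm F V :=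
  TensorProduct.map (polyAct g).toLinearMap (dualAct g)

/-- The action of `g` on `S ⊗ ∧V*`, by automorphisms of the ring of forms. -/
noncomputable def formAct (g : V ≃ₗ[F] V) : DiffForm F V →ₐ[F] DiffForm F V :=
  Algebra.TensorProduct.map (polyAct g) (ExteriorAlgebra.map (dualAct g))

@[simp] theorem formAct_tmul (g : V ≃ₗ[F] V) (a : Poly F V) (x : ExteriorAlgebra F (Dual F V)) :
    formAct g (a ⊗ₜ[F] x) = polyAct g a ⊗ₜ ExteriorAlgebra.map (dualAct g) x := rfl

theorem formAct_smul (g : V ≃ₗ[F] V) (a : Poly F V) (η : DiffForm F V) :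
    formAct g (a • η) = polyAct g a • formAct g η :=
  map_polyAct_smul g (ExteriorAlgebra.map (dualAct g)).toLinearMap a η

theorem extEmb_oneAct (g : V ≃ₗ[F] V) (ω : OneForm F V) :
    extEmb _ _ (oneAct g ω) = formAct g (extEmb _ _ ω) := by
  induction ω using TensorProduct.induction_on with
  | zero => simp
  | add ω ω' h h' => simp only [map_add, h, h']
  | tmul a y =>
    rw [extEmb_tmul, formAct_tmul, ExteriorAlgebra.map_apply_ι]
    rfl

theorem pair_oneAct (g : V ≃ₗ[F] V) (ω : OneForm F V) (φ : Der F V) :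
    pair (oneAct g ω) (derAct g φ) = polyAct g (pair ω φ) := by
  induction ω using TensorProduct.induction_on with
  | zero => simp
  | add ω ω' h h' => simp only [map_add, LinearMap.add_apply, h, h']
  | tmul a y =>
    rw [oneAct, TensorProduct.map_tmul, pair_tmul, pair_tmul, ev_dualAct_derAct, map_mul]
    rfl

theorem contr_formAct (g : V ≃ₗ[F] V) (φ : Der F V) (η : DiffForm F V) :
    contr (derAct g φ) (formAct g η) = formAct g (contr φ η) := by
  induction φ using TensorProduct.induction_on with
  | zero => simp
  | add φ φ' h h' => simp only [map_add, LinearMap.add_apply, h, h']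
  | tmul a u =>
    induction η using TensorProduct.induction_on with
    | zero => simp
    | add η η' h h' => simp only [map_add, h, h']
    | tmul b x =>
      rw [derAct_tmul, formAct_tmul, contr_tmul, contr_tmul, formAct_tmul, contrF_map, map_mul]

theorem degZero_formAct (g : V ≃ₗ[F] V) (η : DiffForm F V) :
    degZero (formAct g η) = polyAct g (degZero η) := by
  induction η using TensorProduct.induction_on with
  | zero => simp
  | add η η' h h' => simp only [map_add, h, h']
  | tmul b x =>
    have h : (ExteriorAlgebra.algebraMapInv (R := F)).comp (ExteriorAlgebra.map (dualAct g)) =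
        ExteriorAlgebra.algebraMapInv (M := Dual F V) := by
      apply ExteriorAlgebra.hom_ext
      ext y
      simp [ExteriorAlgebra.algebraMapInv]
    have h1 := DFunLike.congr_fun h x
    rw [AlgHom.comp_apply] at h1
    rw [formAct_tmul, degZero_tmul, degZero_tmul, map_smul, h1]

theorem evalAtDers_formAct (g : V ≃ₗ[F] V) (L : List (Der F V)) (η : DiffForm F V) :
    evalAtDers (L.map (derAct g)) (formAct g η) = polyAct g (evalAtDers L η) := by
  induction L generalizing η with
  | nil => exact degZero_formAct g η
  | cons φ L ih => rw [List.map_cons, evalAtDers_cons, contr_formAct, ih, evalAtDers_cons]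

end Contraction

/-! ### Differential derivations -/

section DiffDers

variable {F V : Type*} [Field F] [AddCommGroup V] [Module F V]

/-- The component of `∧V* ⊗ V` selected by a linear form on `V`. -/
noncomputable def compF (y : Dual F V) :
    ExteriorAlgebra F (Dual F V) ⊗[F] V →ₗ[F] ExteriorAlgebra F (Dual F V) :=
  (TensorProduct.rid F _).toLinearMap ∘ₗ LinearMap.lTensor _ y

/-- The component of a differential derivation selected by a linear form on `V`. -/
noncomputable def comp (y : Dual F V) : DiffDer F V →ₗ[Poly F V] DiffForm F V :=
  (compF y).baseChange (Poly F V)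

@[simp] theorem comp_tmul (y : Dual F V) (a : Poly F V) (x : ExteriorAlgebra F (Dual F V))
    (u : V) : comp y (a ⊗ₜ[F] (x ⊗ₜ[F] u)) = y u • (a ⊗ₜ[F] x) := by
  simp [comp, compF]

theorem diffDer_induction {P : DiffDer F V → Prop} (η : DiffDer F V) (zero : P 0)
    (tmul : ∀ a x u, P (a ⊗ₜ[F] (x ⊗ₜ[F] u))) (add : ∀ η η', P η → P η' → P (η + η')) : P η := by
  induction η using TensorProduct.induction_on with
  | zero => exact zero
  | add η η' h h' => exact add η η' h h'
  | tmul a m =>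
    induction m using TensorProduct.induction_on with
    | zero => simpa using zero
    | add m m' h h' =>
      rw [TensorProduct.tmul_add]
      exact add _ _ h h'
    | tmul x u => exact tmul a x u

theorem comp_add (y z : Dual F V) (η : DiffDer F V) : comp (y + z) η = comp y η + comp z η := by
  induction η using diffDer_induction with
  | zero => simp
  | add η η' h h' => simp only [map_add, h, h']; abel
  | tmul a x u => simp [add_smul]

theorem comp_smul (c : F) (y : Dual F V) (η : DiffDer F V) : comp (c • y) η = c • comp y η := by
  induction η using diffDer_induction with
  | zero => simp
  | add η η' h h' => simp only [map_add, h, h', smul_add]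
  | tmul a x u => simp only [comp_tmul, LinearMap.smul_apply, smul_smul, smul_eq_mul]

theorem formMulDer_tmul (a b : Poly F V) (x : ExteriorAlgebra F (Dual F V)) (u : V) :
    formMulDer (a ⊗ₜ[F] x) (b ⊗ₜ[F] u) = (a * b) ⊗ₜ[F] (x ⊗ₜ[F] u) := rfl

theorem formMulDer_add_left (ω ω' : DiffForm F V) (φ : Der F V) :
    formMulDer (ω + ω') φ = formMulDer ω φ + formMulDer ω' φ := by
  simp only [formMulDer, TensorProduct.add_tmul, map_add]

theorem formMulDer_add_right (ω : DiffForm F V) (φ φ' : Der F V) :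
    formMulDer ω (φ + φ') = formMulDer ω φ + formMulDer ω φ' := by
  simp only [formMulDer, TensorProduct.tmul_add, map_add]

theorem formMulDer_zero_left (φ : Der F V) : formMulDer (0 : DiffForm F V) φ = 0 := by
  simp only [formMulDer, TensorProduct.zero_tmul, map_zero]

theorem formMulDer_zero_right (ω : DiffForm F V) : formMulDer ω (0 : Der F V) = 0 := by
  simp only [formMulDer, TensorProduct.tmul_zero, map_zero]

theorem comp_formMulDer (y : Dual F V) (ω : DiffForm F V) (φ : Der F V) :
    comp y (formMulDer ω φ) = ev y φ • ω := by
  induction ω using TensorProduct.induction_on with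
  | zero => simp [formMulDer_zero_left]
  | add ω ω' h h' => rw [formMulDer_add_left, map_add, h, h', smul_add]
  | tmul a x =>
    induction φ using TensorProduct.induction_on with
    | zero => simp [formMulDer_zero_right]
    | add φ φ' h h' => rw [formMulDer_add_right, map_add, h, h', map_add, add_smul]
    | tmul b u =>
      rw [formMulDer_tmul, comp_tmul, ev_tmul, TensorProduct.smul_tmul', TensorProduct.smul_tmul',
        smul_eq_mul, smul_mul_assoc, mul_comm]

variable {n : ℕ} (v : Basis (Fin n) F V)

theorem sum_formMulDer_comp (η : DiffDer F V) :
    ∑ i, formMulDer (comp (v.coord i) η) (1 ⊗ₜ v i) = η := by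
  induction η using diffDer_induction with
  | zero => simp [formMulDer_zero_left]
  | add η η' h h' => simp only [map_add, formMulDer_add_left, Finset.sum_add_distrib, h, h']
  | tmul a x u =>
    simp only [comp_tmul, TensorProduct.smul_tmul', formMulDer_tmul, mul_one]
    conv_rhs => rw [← v.sum_repr u]
    rw [TensorProduct.tmul_sum, TensorProduct.tmul_sum]
    refine Finset.sum_congr rfl fun i _ => ?_
    rw [TensorProduct.tmul_smul, TensorProduct.tmul_smul, TensorProduct.smul_tmul',
      Basis.coord_apply]

theorem diffDer_ext {η η' : DiffDer F V} (h : ∀ i, comp (v.coord i) η = comp (v.coord i) η') :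
    η = η' := by
  rw [← sum_formMulDer_comp v η, ← sum_formMulDer_comp v η']
  simp only [h]

/-- The diagonal action of `g` on `S ⊗ ∧V* ⊗ V`. -/
noncomputable def diffDerAct (g : V ≃ₗ[F] V) : DiffDer F V →ₗ[F] DiffDer F V :=
  TensorProduct.map (polyAct g).toLinearMap (extAct g)

theorem diffDerAct_tmul (g : V ≃ₗ[F] V) (a : Poly F V) (x : ExteriorAlgebra F (Dual F V)) (u : V) :
    diffDerAct g (a ⊗ₜ[F] (x ⊗ₜ[F] u)) =
      polyAct g a ⊗ₜ (ExteriorAlgebra.map (dualAct g) x ⊗ₜ g u) := rfl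

theorem diffDerAct_smul (g : V ≃ₗ[F] V) (a : Poly F V) (η : DiffDer F V) :
    diffDerAct g (a • η) = polyAct g a • diffDerAct g η := map_polyAct_smul g _ a η

theorem mem_invDiffDer {G : Subgroup (V ≃ₗ[F] V)} {η : DiffDer F V} :
    η ∈ invDiffDer G ↔ ∀ g ∈ G, diffDerAct g η = η := Iff.rfl

theorem comp_diffDerAct (g : V ≃ₗ[F] V) (y : Dual F V) (η : DiffDer F V) :
    comp (dualAct g y) (diffDerAct g η) = formAct g (comp y η) := by
  induction η using diffDer_induction with
  | zero => simp
  | add η η' h h' => simp only [map_add, h, h']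
  | tmul a x u =>
    rw [diffDerAct_tmul, comp_tmul, comp_tmul, dualAct_apply_apply, map_smul, formAct_tmul]

theorem diffDerAct_formMulDer (g : V ≃ₗ[F] V) (ω : DiffForm F V) (φ : Der F V) :
    diffDerAct g (formMulDer ω φ) = formMulDer (formAct g ω) (derAct g φ) := by
  induction ω using TensorProduct.induction_on with
  | zero => simp [formMulDer_zero_left]
  | add ω ω' h h' => simp only [formMulDer_add_left, map_add, h, h']
  | tmul a x =>
    induction φ using TensorProduct.induction_on with
    | zero => simp [formMulDer_zero_right]
    | add φ φ' h h' => simp only [formMulDer_add_right, map_add, h, h']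
    | tmul b u =>
      rw [formMulDer_tmul, diffDerAct_tmul, formAct_tmul, derAct_tmul, formMulDer_tmul, map_mul]

theorem comp_dEuler (y : Dual F V) :
    comp y (dEuler v) = extEmb (Poly F V) (Dual F V) (1 ⊗ₜ y) := by
  conv_rhs => rw [← v.sum_dual_apply_smul_coord y]
  rw [dEuler, map_sum, TensorProduct.tmul_sum, map_sum]
  refine Finset.sum_congr rfl fun i _ => ?_
  rw [comp_tmul, TensorProduct.tmul_smul, LinearMap.map_smul_of_tower, extEmb_tmul]

theorem dEuler_mem_invDiffDer (G : Subgroup (V ≃ₗ[F] V)) : dEuler v ∈ invDiffDer G := by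
  refine mem_invDiffDer.2 fun g _ => diffDer_ext v fun i => ?_
  have h : v.coord i = dualAct g (dualAct g⁻¹ (v.coord i)) := by
    rw [← dualAct_mul, mul_inv_cancel, dualAct_one]
  rw [comp_dEuler]
  conv_lhs => rw [h, comp_diffDerAct, comp_dEuler, extEmb_tmul, formAct_tmul,
    ExteriorAlgebra.map_apply_ι, ← h, map_one]
  rw [extEmb_tmul]

end DiffDers

/-! ### Dual systems of one-forms and derivations -/

section DualSystem

variable {F V : Type*} [Field F] [AddCommGroup V] [Module F V] {n : ℕ}

/-- The one-forms `o i` and the derivations `θ i` are dual to each other up to the factor `q` and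
up to signs. -/
def IsDualSystem (q : Poly F V) (o : Fin n → OneForm F V) (θ : Fin n → Der F V) : Prop :=
  ∀ i, ∃ ε : F, ε * ε = 1 ∧ ∀ j, pair (o i) (θ j) = if i = j then ε • q else 0

/-- The wedge product of the one-forms `o i`, `i ∈ I`. -/
noncomputable def wedge (o : Fin n → OneForm F V) (I : Finset (Fin n)) : DiffForm F V :=
  orderedProd (fun i => oneFormToForm (o i)) I

/-- The value of a form at the derivations `θ i`, `i ∈ I`. -/
noncomputable def evalOn (θ : Fin n → Der F V) (I : Finset (Fin n)) :
    DiffForm F V →ₗ[Poly F V] Poly F V :=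
  evalAtDers ((I.sort (· ≤ ·)).map θ)

variable {q : Poly F V} {o : Fin n → OneForm F V} {θ : Fin n → Der F V}

theorem IsDualSystem.contr_eq_zero (h : IsDualSystem q o θ) {i : Fin n} {L : List (Fin n)}
    (hi : i ∉ L) : contr (θ i) (L.map fun j => extEmb (Poly F V) (Dual F V) (o j)).prod = 0 := by
  induction L with
  | nil => rw [List.map_nil, List.prod_nil, contr_one]
  | cons j L ih =>
    rw [List.mem_cons, not_or] at hi
    obtain ⟨ε, -, hj⟩ := h j
    rw [List.map_cons, List.prod_cons, contr_extEmb_mul, ih hi.2, hj, if_neg (Ne.symm hi.1),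
      zero_smul, mul_zero, sub_zero]

theorem IsDualSystem.evalAtDers_prod (h : IsDualSystem q o θ) (L : List (Fin n)) (hL : L.Nodup)
    (L' : List (Fin n)) (hL' : L'.Nodup) :
    (L.Perm L' → ∃ ε : F, ε * ε = 1 ∧
      evalAtDers (L.map θ) (L'.map fun j => extEmb (Poly F V) (Dual F V) (o j)).prod =
        ε • q ^ L.length) ∧
    (¬ L.Perm L' →
      evalAtDers (L.map θ) (L'.map fun j => extEmb (Poly F V) (Dual F V) (o j)).prod = 0) := by
  induction L generalizing L' with
  | nil =>
    rcases L' with - | ⟨j, L'⟩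
    · exact ⟨fun _ => ⟨1, by simp, by simp [degZero_one]⟩, fun hn => absurd (List.Perm.refl _) hn⟩
    · refine ⟨fun hp => ?_, fun _ => ?_⟩
      · simp at hp
      · rw [List.map_nil, evalAtDers_nil, List.map_cons, List.prod_cons, degZero_extEmb_mul]
  | cons i L ih =>
    rw [List.nodup_cons] at hL
    by_cases hi : i ∈ L'
    · obtain ⟨δ, hδ, hprod⟩ := exists_sign_of_perm F (DiffForm F V) (List.perm_cons_erase hi)
      have hprod := hprod _ (isAnticommuting_extEmb o)
      obtain ⟨ε, hε, hpair⟩ := h i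
      have hnot : i ∉ L'.erase i := fun hmem => (hL'.mem_erase_iff.1 hmem).1 rfl
      have hval : evalAtDers ((i :: L).map θ)
          (L'.map fun j => extEmb (Poly F V) (Dual F V) (o j)).prod = (δ * ε) • (q * evalAtDers
            (L.map θ) ((L'.erase i).map fun j => extEmb (Poly F V) (Dual F V) (o j)).prod) := by
        rw [List.map_cons, evalAtDers_cons, hprod, List.map_cons, List.prod_cons,
          LinearMap.map_smul_of_tower, contr_extEmb_mul, h.contr_eq_zero hnot, mul_zero, sub_zero,
          hpair, if_pos rfl, LinearMap.map_smul_of_tower, map_smul, smul_eq_mul, smul_mul_assoc,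
          smul_smul]
      obtain ⟨h1, h2⟩ := ih hL.2 (L'.erase i) (hL'.erase i)
      rw [List.cons_perm_iff_perm_erase]
      refine ⟨fun hp => ?_, fun hp => ?_⟩
      · obtain ⟨γ, hγ, h1⟩ := h1 hp.2
        refine ⟨δ * ε * γ, by
          linear_combination hδ + (δ * δ) * hε + (δ * δ * ε * ε) * hγ, ?_⟩
        rw [hval, h1, mul_smul_comm, smul_smul, List.length_cons, pow_succ']
      · rw [hval, h2 fun hp' => hp ⟨hi, hp'⟩, mul_zero, smul_zero]
    · rw [List.cons_perm_iff_perm_erase]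
      refine ⟨fun hp => absurd hp.1 hi, fun _ => ?_⟩
      rw [List.map_cons, evalAtDers_cons, h.contr_eq_zero hi, map_zero]

theorem perm_sort_iff {I J : Finset (Fin n)} :
    (I.sort (· ≤ ·)).Perm (J.sort (· ≤ ·)) ↔ I = J := by
  refine ⟨fun h => ?_, fun h => h ▸ List.Perm.refl _⟩
  ext i
  rw [← Finset.mem_sort (· ≤ ·), h.mem_iff, Finset.mem_sort]

theorem IsDualSystem.evalOn_wedge_self (h : IsDualSystem q o θ) (I : Finset (Fin n)) :
    ∃ ε : F, ε * ε = 1 ∧ evalOn θ I (wedge o I) = ε • q ^ I.card := by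
  obtain ⟨ε, hε, h1⟩ := (h.evalAtDers_prod _ (I.sort_nodup (· ≤ ·)) _ (I.sort_nodup (· ≤ ·))).1
    (List.Perm.refl _)
  exact ⟨ε, hε, by rw [Finset.length_sort] at h1; exact h1⟩

theorem IsDualSystem.evalOn_wedge_of_ne (h : IsDualSystem q o θ) {I J : Finset (Fin n)}
    (hIJ : I ≠ J) : evalOn θ I (wedge o J) = 0 :=
  (h.evalAtDers_prod _ (I.sort_nodup (· ≤ ·)) _ (J.sort_nodup (· ≤ ·))).2
    fun hp => hIJ (perm_sort_iff.1 hp)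

/-- A one-form is determined by its values on derivations with nonzero coefficient determinant. -/
theorem oneForm_ext (v : Basis (Fin n) F V) (hdet : (derBasis v).det θ ≠ 0) {ω ω' : OneForm F V}
    (h : ∀ j, pair ω (θ j) = pair ω' (θ j)) : ω = ω' := by
  have h1 : ∀ φ, pair ω φ = pair ω' φ := by
    intro φ
    refine mul_left_cancel₀ hdet ?_
    rw [← smul_eq_mul, ← smul_eq_mul, ← map_smul, ← map_smul, det_smul_eq_sum, map_sum, map_sum]
    simp only [map_smul, h]
  have h2 : ∀ ω : OneForm F V, ∑ i, pair ω (1 ⊗ₜ v i) ⊗ₜ v.coord i = ω := by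
    intro ω
    induction ω using TensorProduct.induction_on with
    | zero => simp
    | add ω ω' h h' =>
      simp only [map_add, LinearMap.add_apply, TensorProduct.add_tmul, Finset.sum_add_distrib,
        h, h']
    | tmul a y =>
      conv_rhs => rw [← v.sum_dual_apply_smul_coord y, TensorProduct.tmul_sum]
      refine Finset.sum_congr rfl fun i _ => ?_
      rw [pair_tmul, ev_tmul, TensorProduct.tmul_smul, TensorProduct.smul_tmul', mul_smul_comm,
        mul_one]
  rw [← h2 ω, ← h2 ω']
  simp only [h1]

/-- The span of the wedge products of the `o i` is stable under multiplication by the `o i`. -/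
theorem extEmb_mul_mem_span_wedge (i : Fin n) {η : DiffForm F V}
    (hη : η ∈ Submodule.span (Poly F V) (Set.range (wedge o))) :
    extEmb _ _ (o i) * η ∈ Submodule.span (Poly F V) (Set.range (wedge o)) := by
  induction hη using Submodule.span_induction with
  | zero => simp
  | add η η' _ _ h h' => rw [mul_add]; exact add_mem h h'
  | smul a η _ h => rw [mul_smul_comm]; exact Submodule.smul_mem _ _ h
  | mem η hη =>
    obtain ⟨I, rfl⟩ := hη
    by_cases hi : i ∈ I
    · have h1 := mul_prod_eq_zero (isAnticommuting_extEmb (S := Poly F V) o)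
        ((Finset.mem_sort (· ≤ ·)).2 hi)
      change extEmb _ _ (o i) * ((I.sort (· ≤ ·)).map fun i => extEmb _ _ (o i)).prod ∈ _
      rw [h1]
      exact zero_mem _
    · have hperm : (i :: I.sort (· ≤ ·)).Perm ((insert i I).sort (· ≤ ·)) := by
        refine (List.perm_ext_iff_of_nodup ?_ (Finset.sort_nodup _ _)).2 fun j => by simp
        exact List.nodup_cons.2 ⟨by simpa using hi, Finset.sort_nodup _ _⟩
      obtain ⟨ε, -, h1⟩ := exists_sign_of_perm F (DiffForm F V) hperm
      have h1 := h1 _ (isAnticommuting_extEmb o)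
      rw [List.map_cons, List.prod_cons] at h1
      change extEmb _ _ (o i) * ((I.sort (· ≤ ·)).map fun i => extEmb _ _ (o i)).prod ∈ _
      rw [h1]
      exact Submodule.smul_of_tower_mem _ ε (Submodule.subset_span ⟨insert i I, rfl⟩)

theorem IsDualSystem.smul_extEmb_eq_sum (h : IsDualSystem q o θ) (v : Basis (Fin n) F V)
    (hdet : (derBasis v).det θ ≠ 0) (ω : OneForm F V) :
    ∃ a : Fin n → Poly F V, q • ω = ∑ i, a i • o i := by
  choose ε hε hpair using h
  refine ⟨fun i => ε i • pair ω (θ i), oneForm_ext v hdet fun j => ?_⟩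
  rw [map_smul, LinearMap.smul_apply, map_sum, LinearMap.sum_apply,
    Finset.sum_eq_single j (fun i _ hi => by
      rw [map_smul, LinearMap.smul_apply, hpair, if_neg hi, smul_zero])
      (fun hj => absurd (Finset.mem_univ j) hj),
    map_smul, LinearMap.smul_apply, hpair, if_pos rfl, smul_eq_mul, smul_eq_mul, smul_mul_smul_comm,
    hε, one_smul, mul_comm]

theorem IsDualSystem.exists_pow_smul_mem_span_wedge (h : IsDualSystem q o θ)
    (v : Basis (Fin n) F V) (hdet : (derBasis v).det θ ≠ 0) (η : DiffForm F V) :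
    ∃ N : ℕ, q ^ N • η ∈ Submodule.span (Poly F V) (Set.range (wedge o)) := by
  have hadd : ∀ η η' : DiffForm F V,
      (∃ N : ℕ, q ^ N • η ∈ Submodule.span (Poly F V) (Set.range (wedge o))) →
      (∃ N : ℕ, q ^ N • η' ∈ Submodule.span (Poly F V) (Set.range (wedge o))) →
      ∃ N : ℕ, q ^ N • (η + η') ∈ Submodule.span (Poly F V) (Set.range (wedge o)) := by
    rintro η η' ⟨N, hN⟩ ⟨N', hN'⟩
    refine ⟨N + N', ?_⟩
    rw [smul_add, pow_add, mul_smul, mul_smul, smul_comm]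
    exact add_mem (Submodule.smul_mem _ _ hN) (Submodule.smul_mem _ _ hN')
  induction η using TensorProduct.induction_on with
  | zero => exact ⟨0, by simp⟩
  | add η η' h h' => exact hadd η η' h h'
  | tmul a x =>
    suffices H : ∃ N : ℕ, q ^ N • ((1 : Poly F V) ⊗ₜ[F] x) ∈
        Submodule.span (Poly F V) (Set.range (wedge o)) by
      obtain ⟨N, hN⟩ := H
      refine ⟨N, ?_⟩
      have : (a ⊗ₜ[F] x : DiffForm F V) = a • ((1 : Poly F V) ⊗ₜ[F] x) := by
        rw [TensorProduct.smul_tmul', smul_eq_mul, mul_one]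
      rw [this, smul_comm]
      exact Submodule.smul_mem _ _ hN
    induction x using CliffordAlgebra.left_induction with
    | algebraMap c =>
      refine ⟨0, ?_⟩
      have h1 : (1 : Poly F V) ⊗ₜ[F] (algebraMap F (ExteriorAlgebra F (Dual F V)) c) =
          c • wedge o ∅ := by
        rw [wedge, orderedProd, Finset.sort_empty, List.map_nil, List.prod_nil,
          Algebra.algebraMap_eq_smul_one, TensorProduct.tmul_smul, Algebra.TensorProduct.one_def]
      rw [pow_zero, one_smul]
      exact h1 ▸ Submodule.smul_of_tower_mem _ c (Submodule.subset_span ⟨∅, rfl⟩)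
    | add x y hx hy =>
      rw [TensorProduct.tmul_add]
      exact hadd _ _ hx hy
    | ι_mul x y hx =>
      obtain ⟨N, hN⟩ := hx
      obtain ⟨a, ha⟩ := h.smul_extEmb_eq_sum v hdet (1 ⊗ₜ y)
      refine ⟨N + 1, ?_⟩
      have h1 : q ^ (N + 1) • ((1 : Poly F V) ⊗ₜ[F] (ExteriorAlgebra.ι F y * x)) =
          extEmb _ _ (q • ((1 : Poly F V) ⊗ₜ[F] y)) * (q ^ N • ((1 : Poly F V) ⊗ₜ[F] x)) := by
        rw [map_smul, extEmb_tmul, smul_mul_smul_comm, Algebra.TensorProduct.tmul_mul_tmul,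
          mul_one, pow_succ']
      refine (congrArg (· ∈ Submodule.span (Poly F V) (Set.range (wedge o))) h1).mpr ?_
      rw [ha, map_sum, Finset.sum_mul]
      refine Submodule.sum_mem _ fun i _ => ?_
      rw [map_smul, smul_mul_assoc]
      exact Submodule.smul_mem _ _ (extEmb_mul_mem_span_wedge i hN)

/-- A form is determined by its values at the families of distinct `θ i`. -/
theorem IsDualSystem.form_ext (h : IsDualSystem q o θ) (hq : q ≠ 0) (v : Basis (Fin n) F V)
    (hdet : (derBasis v).det θ ≠ 0) {η η' : DiffForm F V}
    (heval : ∀ I, evalOn θ I η = evalOn θ I η') : η = η' := by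
  rw [← sub_eq_zero]
  obtain ⟨N, hN⟩ := h.exists_pow_smul_mem_span_wedge v hdet (η - η')
  obtain ⟨c, hc⟩ := (Submodule.mem_span_range_iff_exists_fun _).1 hN
  refine (smul_eq_zero.1 ?_).resolve_left (pow_ne_zero N hq)
  rw [← hc]
  refine Finset.sum_eq_zero fun I _ => ?_
  have h1 := congrArg (evalOn θ I) hc
  rw [map_smul, map_sub, heval, sub_self, smul_zero, map_sum, Finset.sum_eq_single I
    (fun J _ hJ => by rw [map_smul, h.evalOn_wedge_of_ne hJ.symm, smul_zero])
    (fun hI => absurd (Finset.mem_univ I) hI), map_smul] at h1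
  obtain ⟨ε, hε, h2⟩ := h.evalOn_wedge_self I
  have hε0 : ε ≠ 0 := left_ne_zero_of_mul_eq_one hε
  rw [h2, smul_eq_zero] at h1
  rw [h1.resolve_right (smul_ne_zero hε0 (pow_ne_zero _ hq)), zero_smul]

/-- A differential derivation is determined by the values of its components. -/
theorem IsDualSystem.diffDer_ext (h : IsDualSystem q o θ) (hq : q ≠ 0) (v : Basis (Fin n) F V)
    (hdet : (derBasis v).det θ ≠ 0) {η η' : DiffDer F V}
    (heval : ∀ I y, evalOn θ I (comp y η) = evalOn θ I (comp y η')) : η = η' :=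
  InvDiffDer.diffDer_ext v fun i => h.form_ext hq v hdet fun I => heval I (v.coord i)

end DualSystem

/-! ### The twisted wedge products -/

section TwistedWedge

theorem exists_eq_smul_of_dvd_repr {R M ι : Type*} [CommRing R] [AddCommGroup M] [Module R M]
    (b : Basis ι R M) {q : R} {m : M} (h : ∀ i, q ∣ b.repr m i) : ∃ m', m = q • m' := by
  choose c hc using h
  refine ⟨∑ i ∈ (b.repr m).support, c i • b i, ?_⟩
  conv_lhs => rw [← b.linearCombination_repr m, Finsupp.linearCombination_apply, Finsupp.sum]
  rw [Finset.smul_sum]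
  refine Finset.sum_congr rfl fun i _ => ?_
  rw [hc i, mul_smul]

variable {F V : Type*} [Field F] [AddCommGroup V] [Module F V] {n : ℕ}

/-- The `S`-basis of the differential forms coming from a basis of `∧V*`. -/
noncomputable abbrev formBasis (F V : Type*) [Field F] [AddCommGroup V] [Module F V] :
    Basis (Basis.ofVectorSpaceIndex F (ExteriorAlgebra F (Dual F V))) (Poly F V) (DiffForm F V) :=
  Algebra.TensorProduct.basis (Poly F V) (Basis.ofVectorSpace F (ExteriorAlgebra F (Dual F V)))

/-- A one-form whose values are divisible by `l ^ m`, and by `l ^ (m + 1)` at derivations tangent to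
the hyperplane `l = 0`, is a combination of `l ^ m dl` and `l ^ (m + 1) σ`. -/
theorem exists_oneForm_eq (v : Basis (Fin n) F V) {l : Dual F V} (hl : l ≠ 0) {m : ℕ}
    {ω : OneForm F V} (h1 : ∀ φ, lin l ^ m ∣ pair ω φ)
    (h2 : ∀ φ ∈ logDer l, lin l ^ (m + 1) ∣ pair ω φ) :
    ∃ (σ : OneForm F V) (f : Poly F V), ω = lin l ^ m • (lin l • σ + f • (1 ⊗ₜ[F] l)) := by
  obtain ⟨u, hu⟩ := exists_apply_eq_one hl
  obtain ⟨w, i, -, hcoord, hw⟩ := exists_adapted_basis v hu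
  obtain ⟨f, hf⟩ := h1 (derBasis w i)
  have h3 : ∀ j, j ≠ i → ∃ a, pair ω (derBasis w j) = lin l ^ (m + 1) * a := fun j hj =>
    h2 _ (by rw [mem_logDer, derBasis_apply, ev_tmul, hw j hj, zero_smul]; exact dvd_zero _)
  choose! a ha using h3
  refine ⟨∑ j ∈ Finset.univ.erase i, a j • (1 ⊗ₜ w.coord j), f, ?_⟩
  refine oneForm_ext (θ := derBasis w) w (by rw [Basis.det_self]; exact one_ne_zero) fun k => ?_
  have hk : ∀ j, pair (1 ⊗ₜ w.coord j) (derBasis w k) = if j = k then 1 else 0 := by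
    intro j
    rw [derBasis_apply, pair_tmul, ev_tmul, one_mul, Basis.coord_apply, Basis.repr_self,
      Finsupp.single_apply]
    split_ifs with h h' h'
    · rw [one_smul]
    · exact absurd h.symm h'
    · exact absurd h'.symm h
    · rw [zero_smul]
  simp only [map_smul, map_add, map_sum, LinearMap.smul_apply, LinearMap.add_apply,
    LinearMap.sum_apply, ← hcoord, hk, smul_eq_mul, mul_ite, mul_one, mul_zero,
    Finset.sum_ite_eq', Finset.mem_erase, Finset.mem_univ, and_true]
  rw [hcoord]
  by_cases hki : k = i
  · subst hki
    rw [hf]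
    simp
  · rw [if_pos hki, if_neg (Ne.symm hki), ha k hki, add_zero, pow_succ, mul_assoc]

/-- In a product of elements `r ^ m (r s + f x)`, where `x` has square zero and anticommutes with
the `s`, the factor `x` can be used only once. -/
theorem exists_prod_eq {R A ι : Type*} [CommRing R] [Ring A] [Algebra R A] {r : R} {m : ℕ} {x : A}
    (hx : x * x = 0) (z : ι → A) (L : List ι) (hL : L ≠ [])
    (h : ∀ i ∈ L, ∃ (s : A) (f : R), s * x = -(x * s) ∧ z i = r ^ m • (r • s + f • x)) :
    ∃ a b : A, (L.map z).prod = r ^ ((m + 1) * (L.length - 1) + m) • (r • a + x * b) := by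
  induction L with
  | nil => exact absurd rfl hL
  | cons i L ih =>
    obtain ⟨s, f, hs, hi⟩ := h i (by simp)
    rcases L with - | ⟨j, L⟩
    · refine ⟨s, f • 1, ?_⟩
      rw [List.map_cons, List.map_nil, List.prod_cons, List.prod_nil, mul_one, hi, mul_smul_comm,
        mul_one]
      simp
    · obtain ⟨a, b, hab⟩ := ih (by simp) fun i hi => h i (List.mem_cons_of_mem _ hi)
      refine ⟨s * a, f • a - s * b, ?_⟩
      have h1 : (r • s + f • x) * (r • a + x * b) =
          r • (r • (s * a) + x * (f • a - s * b)) := by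
        have h2 : s * (x * b) = -(x * (s * b)) := by
          rw [← mul_assoc, hs, neg_mul, mul_assoc]
        have h3 : x * (x * b) = 0 := by rw [← mul_assoc, hx, zero_mul]
        rw [add_mul, mul_add, mul_add, smul_mul_assoc, smul_mul_assoc, smul_mul_assoc,
          smul_mul_assoc, mul_smul_comm, mul_smul_comm, h2, h3, mul_sub, mul_smul_comm, smul_add,
          smul_sub, smul_zero, add_zero, smul_neg, smul_comm f]
        abel
      rw [List.map_cons, List.prod_cons, hab, hi, smul_mul_smul_comm, h1, smul_smul]
      congr 1
      simp only [List.length_cons, Nat.add_sub_cancel]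
      ring

variable {G : Subgroup (V ≃ₗ[F] V)} {ℓ : Submodule F V → Dual F V} (v : Basis (Fin n) F V)
  (θ : Basis (Fin n) (invPoly G) (invDer G))

/-- The one-forms dual to a basis of the invariant derivations. -/
noncomputable def basicForm (ℓ : Submodule F V → Dual F V) (i : Fin n) : OneForm F V :=
  dualOneForm v G ℓ (basicDer θ) i

theorem exists_isDualSystem (hG : Finite G)
    (hℓ : ∀ H ∈ reflArrangement G, LinearMap.ker (ℓ H) = H) :
    ∃ c : F, c ≠ 0 ∧ IsDualSystem (c • Qe G ℓ) (basicForm v θ ℓ) (basicDer θ) := by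
  obtain ⟨c, hc, hdet⟩ := exists_det_basicDer_eq v θ hG hℓ
  refine ⟨c, hc, fun i => ?_⟩
  obtain ⟨ε, hε, h⟩ := exists_pair_dualOneForm v G ℓ (basicDer θ) i
  refine ⟨ε, hε, fun j => ?_⟩
  rw [basicForm, h]
  split_ifs with hij
  · rw [← hij, Function.update_eq_self, hdet, mul_smul_comm, Qdet_mul_arrProd_one hG]
  · rw [AlternatingMap.map_eq_zero_of_eq (derBasis v).det _ (i := i) (j := j) (by
      rw [Function.update_self, Function.update_of_ne (Ne.symm hij)]) hij, mul_zero, smul_zero]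

theorem lin_pow_dvd_Qdet (hG : Finite G)
    (hℓ : ∀ H ∈ reflArrangement G, LinearMap.ker (ℓ H) = H) {H : Submodule F V}
    (hH : H ∈ reflArrangement G) : lin (ℓ H) ^ (reflIndex G H - 1) ∣ Qdet G ℓ := by
  obtain ⟨R, hR, -⟩ := arrProd_factor hG hℓ (fun H => reflIndex G H - 1) hH
  exact ⟨R, by rw [Qdet_eq_arrProd, hR]⟩

theorem exists_basicForm_eq (hG : Finite G)
    (hℓ : ∀ H ∈ reflArrangement G, LinearMap.ker (ℓ H) = H) {H : Submodule F V}
    (hH : H ∈ reflArrangement G) (i : Fin n) :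
    ∃ (σ : OneForm F V) (f : Poly F V), basicForm v θ ℓ i =
      lin (ℓ H) ^ (reflIndex G H - 1) • (lin (ℓ H) • σ + f • (1 ⊗ₜ ℓ H)) := by
  obtain ⟨ε, -, h⟩ := exists_pair_dualOneForm v G ℓ (basicDer θ) i
  have hl := form_ne_zero hℓ hH
  refine exists_oneForm_eq v hl (fun φ => ?_) (fun φ hφ => ?_) <;> rw [basicForm, h]
  · exact dvd_smul_of_dvd ε ((lin_pow_dvd_Qdet hG hℓ hH).mul_right _)
  · refine dvd_smul_of_dvd ε ?_
    rw [pow_succ]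
    refine mul_dvd_mul (lin_pow_dvd_Qdet hG hℓ hH) (lin_dvd_det v hl fun j => ?_)
    by_cases hj : j = i
    · subst hj
      simpa using hφ
    · rw [Function.update_of_ne hj]
      exact basicDer_mem_logDer θ hℓ hH j

/-- The wedge product of `k` dual one-forms is divisible by `(Q ^ e) ^ (k - 1)`. -/
theorem exists_wedge_eq_smul (hG : Finite G)
    (hℓ : ∀ H ∈ reflArrangement G, LinearMap.ker (ℓ H) = H) {I : Finset (Fin n)}
    (hI : I.Nonempty) :
    ∃ ζ, Qe G ℓ ^ (I.card - 1) • ζ = wedge (basicForm v θ ℓ) I := by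
  have hL : I.sort (· ≤ ·) ≠ [] := by
    intro h
    have := congrArg List.length h
    rw [Finset.length_sort, List.length_nil] at this
    exact hI.card_ne_zero this
  have h1 : Qe G ℓ ^ (I.card - 1) = arrProd G ℓ fun H => reflIndex G H * (I.card - 1) := by
    rw [Qe_eq_arrProd, arrProd_eq hG, arrProd_eq hG, ← Finset.prod_pow]
    simp only [pow_mul]
  obtain ⟨ζ, hζ⟩ := exists_eq_smul_of_dvd_repr (formBasis F V) (q := Qe G ℓ ^ (I.card - 1))
    (m := wedge (basicForm v θ ℓ) I) fun i => by
      rw [h1]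
      refine arrProd_dvd hG hℓ fun H hH => ?_
      obtain ⟨a, b, hη⟩ := exists_prod_eq (extEmb_mul_self ((1 : Poly F V) ⊗ₜ[F] ℓ H))
        (fun i => extEmb _ _ (basicForm v θ ℓ i)) (I.sort (· ≤ ·)) hL fun i _ => by
          obtain ⟨σ, f, hi⟩ := exists_basicForm_eq v θ hG hℓ hH i
          exact ⟨extEmb _ _ σ, f, extEmb_mul_swap _ _, by
            rw [hi, map_smul, map_add, map_smul, map_smul]⟩
      rw [Finset.length_sort, Nat.sub_add_cancel (reflIndex_pos hG H), pow_add, mul_smul] at hη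
      change _ ∣ (formBasis F V).repr
        ((I.sort (· ≤ ·)).map fun i => extEmb _ _ (basicForm v θ ℓ i)).prod i
      rw [hη, map_smul, Finsupp.smul_apply]
      exact Dvd.intro _ rfl
  exact ⟨ζ, hζ.symm⟩

theorem Qe_pow_smul_twistedWedge (hG : Finite G)
    (hℓ : ∀ H ∈ reflArrangement G, LinearMap.ker (ℓ H) = H) (I : Finset (Fin n)) :
    Qe G ℓ ^ (I.card - 1) • twistedWedge G ℓ (basicForm v θ ℓ) I = wedge (basicForm v θ ℓ) I := by
  rcases I.eq_empty_or_nonempty with rfl | hI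
  · rw [twistedWedge, if_pos rfl, wedge, orderedProd, Finset.sort_empty, Finset.card_empty]
    simp
  · have h := exists_wedge_eq_smul v θ hG hℓ hI
    rw [twistedWedge, if_neg hI.ne_empty, divForm]
    exact (dif_pos h ▸ h.choose_spec)

theorem smul_right_cancel {R M : Type*} [CommRing R] [IsDomain R] [AddCommGroup M] [Module R M]
    [Module.IsTorsionFree R M] {q : R} (hq : q ≠ 0) {x y : M} (h : q • x = q • y) : x = y :=
  smul_right_injective M hq h

theorem Qe_ne_zero (hG : Finite G) (hℓ : ∀ H ∈ reflArrangement G, LinearMap.ker (ℓ H) = H) :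
    Qe G ℓ ≠ 0 := arrProd_ne_zero hG hℓ _

theorem evalOn_twistedWedge_of_ne (hG : Finite G)
    (hℓ : ∀ H ∈ reflArrangement G, LinearMap.ker (ℓ H) = H) {I J : Finset (Fin n)} (hIJ : I ≠ J) :
    evalOn (basicDer θ) I (twistedWedge G ℓ (basicForm v θ ℓ) J) = 0 := by
  obtain ⟨c, -, hdual⟩ := exists_isDualSystem v θ hG hℓ
  have h := congrArg (evalOn (basicDer θ) I) (Qe_pow_smul_twistedWedge v θ hG hℓ J)
  rw [hdual.evalOn_wedge_of_ne hIJ, map_smul, smul_eq_zero] at h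
  exact h.resolve_left (pow_ne_zero _ (Qe_ne_zero hG hℓ))

theorem exists_evalOn_twistedWedge_self (hG : Finite G)
    (hℓ : ∀ H ∈ reflArrangement G, LinearMap.ker (ℓ H) = H) {I : Finset (Fin n)}
    (hI : I.Nonempty) :
    ∃ c : F, c ≠ 0 ∧
      evalOn (basicDer θ) I (twistedWedge G ℓ (basicForm v θ ℓ) I) = c • Qe G ℓ := by
  obtain ⟨c, hc, hdual⟩ := exists_isDualSystem v θ hG hℓ
  obtain ⟨ε, hε, h⟩ := hdual.evalOn_wedge_self I
  refine ⟨ε * c ^ I.card, mul_ne_zero (left_ne_zero_of_mul_eq_one hε) (pow_ne_zero _ hc), ?_⟩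
  have h1 := congrArg (evalOn (basicDer θ) I) (Qe_pow_smul_twistedWedge v θ hG hℓ I)
  rw [h, map_smul, smul_pow, smul_smul] at h1
  refine smul_right_cancel (pow_ne_zero (I.card - 1) (Qe_ne_zero hG hℓ)) (h1.trans ?_)
  rw [smul_eq_mul, mul_smul_comm, ← pow_succ, Nat.sub_add_cancel hI.card_pos]

theorem evalOn_empty_twistedWedge :
    evalOn (basicDer θ) ∅ (twistedWedge G ℓ (basicForm v θ ℓ) ∅) = 1 := by
  rw [twistedWedge, if_pos rfl, evalOn, Finset.sort_empty, List.map_nil, evalAtDers_nil,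
    degZero_one]

/-- The dual one-forms are invariant, because their values `± c Q ^ e` at the `θ_j` are. -/
theorem oneAct_basicForm (hG : IsReflectionGroup G)
    (hℓ : ∀ H ∈ reflArrangement G, LinearMap.ker (ℓ H) = H) {g : V ≃ₗ[F] V} (hg : g ∈ G)
    (i : Fin n) : oneAct g (basicForm v θ ℓ i) = basicForm v θ ℓ i := by
  have := Module.Finite.of_basis v
  obtain ⟨c, -, hdual⟩ := exists_isDualSystem v θ hG.1 hℓ
  obtain ⟨ε, -, h⟩ := hdual i
  refine oneForm_ext v (det_basicDer_ne_zero v θ hG.1 hℓ) fun j => ?_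
  have h1 : derAct g (basicDer θ j) = basicDer θ j := mem_invDer.1 (θ j).2 g hg
  conv_lhs => rw [← h1]
  rw [pair_oneAct, h]
  split_ifs
  · rw [map_smul, map_smul, polyAct_Qe hG hℓ hg]
  · rw [map_zero]

theorem formAct_twistedWedge (hG : IsReflectionGroup G)
    (hℓ : ∀ H ∈ reflArrangement G, LinearMap.ker (ℓ H) = H) {g : V ≃ₗ[F] V} (hg : g ∈ G)
    (I : Finset (Fin n)) : formAct g (twistedWedge G ℓ (basicForm v θ ℓ) I) =
      twistedWedge G ℓ (basicForm v θ ℓ) I := by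
  have := Module.Finite.of_basis v
  refine smul_right_cancel (pow_ne_zero (I.card - 1) (Qe_ne_zero hG.1 hℓ)) ?_
  have h1 := congrArg (formAct g) (Qe_pow_smul_twistedWedge v θ hG.1 hℓ I)
  rw [formAct_smul, map_pow, polyAct_Qe hG hℓ hg] at h1
  rw [h1, Qe_pow_smul_twistedWedge v θ hG.1 hℓ, wedge, orderedProd, map_list_prod, List.map_map]
  congr 2
  funext i
  change formAct g (extEmb _ _ _) = extEmb _ _ _
  rw [← extEmb_oneAct, oneAct_basicForm v θ hG hℓ hg]

theorem formMulDer_twistedWedge_mem (hG : IsReflectionGroup G)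
    (hℓ : ∀ H ∈ reflArrangement G, LinearMap.ker (ℓ H) = H) (I : Finset (Fin n)) (j : Fin n) :
    formMulDer (twistedWedge G ℓ (basicForm v θ ℓ) I) (basicDer θ j) ∈ invDiffDer G :=
  mem_invDiffDer.2 fun g hg => by
    rw [diffDerAct_formMulDer, formAct_twistedWedge v θ hG hℓ hg]
    congr 1
    exact mem_invDer.1 (θ j).2 g hg

end TwistedWedge

/-! ### Invariants along a hyperplane with maximal transvection root space -/

section Local

variable {F V : Type*} [Field F] [AddCommGroup V] [Module F V] {G : Subgroup (V ≃ₗ[F] V)}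

/-- To prove a linear property of the vectors of a hyperplane `l = 0` with maximal transvection root
space, it is enough to consider the root vectors `t u - u` of transvections `t`, where `l u = 1`. -/
theorem hyperplane_induction {H : Submodule F V} {l : Dual F V} (hker : LinearMap.ker l = H)
    (hroot : transvectionRootSpace G H = H) {u : V} (hu : l u = 1) {P : V → Prop} (zero : P 0)
    (add : ∀ w w', l w = 0 → l w' = 0 → P w → P w' → P (w + w'))
    (smul : ∀ (c : F) w, l w = 0 → P w → P (c • w))
    (mem : ∀ t ∈ G, FixesKer t l → l (t u - u) = 0 → P (t u - u)) {w : V} (hw : l w = 0) :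
    P w := by
  have hle : ∀ x ∈ transvectionRootSpace G H, l x = 0 := fun x hx => by
    rw [hroot, ← hker] at hx
    exact hx
  have hmem : w ∈ transvectionRootSpace G H := by
    rw [hroot, ← hker]
    exact hw
  rw [transvectionRootSpace] at hmem hle
  induction hmem using Submodule.span_induction with
  | mem x hx =>
    obtain ⟨t, ht, ⟨⟨-, -, hfix⟩, htr⟩, v, rfl⟩ := hx
    have hfix' : FixesKer t l := fun w hw => hfix w (by rw [← hker]; exact hw)
    have h0 : l (t u - u) = 0 := by
      have := htr u
      rwa [← hker] at this
    rw [hfix'.apply_eq hu v, add_sub_cancel_left]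
    exact smul _ _ h0 (mem t ht hfix' h0)
  | zero => exact zero
  | add x y hx hy h h' => exact add x y (hle x hx) (hle y hy) (h (hle x hx)) (h' (hle y hy))
  | smul c x hx h => exact smul c x (hle x hx) (h (hle x hx))

theorem exists_dual_apply_eq_one {l : Dual F V} {u : V} (hu : l u = 1) {w : V} (hw : l w = 0)
    (hw0 : w ≠ 0) : ∃ y : Dual F V, y u = 0 ∧ y w = 1 := by
  obtain ⟨y, hy⟩ : ∃ y : Dual F V, y w ≠ 0 := by
    by_contra! hcon
    exact hw0 ((Module.forall_dual_apply_eq_zero_iff F _).1 hcon)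
  refine ⟨(y w)⁻¹ • (y - y u • l), ?_, ?_⟩
  · simp [hu]
  · simp [hw, hy]

theorem polyAct_sub_dvd_of_pow_dvd {t : V ≃ₗ[F] V} {l : Dual F V} (ht : FixesKer t l) (hl : l ≠ 0)
    (htl : dualAct t l = l) {m : ℕ} {a : Poly F V} (ha : lin l ^ m ∣ a) :
    lin l ^ (m + 1) ∣ polyAct t a - a := by
  obtain ⟨b, rfl⟩ := ha
  rw [map_mul, map_pow, polyAct_lin, htl, ← mul_sub, pow_succ]
  exact mul_dvd_mul_left _ (ht.lin_dvd hl b)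

theorem dvd_of_dvd_smul {a b : Poly F V} {c : F} (hc : c ≠ 0) (h : a ∣ c • b) : a ∣ b := by
  have := dvd_smul_of_dvd c⁻¹ h
  rwa [smul_smul, inv_mul_cancel₀ hc, one_smul] at this

/-- Let `A` be a bilinear map on `V × V*` with polynomial values, equivariant under the pointwise
stabilizer of the hyperplane `l = 0`. If the root vectors of transvections span the hyperplane, then
`A` is, along the hyperplane, a multiple of the evaluation pairing up to order `e_H`. -/
theorem local_structure [Module.Finite F V] (hchar : ringChar F ≠ 2) (hG : Finite G)
    {H : Submodule F V} {l : Dual F V} (hl : l ≠ 0) (hker : LinearMap.ker l = H)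
    (hroot : transvectionRootSpace G H = H) :
    ∃ u, l u = 1 ∧ ∀ A : V →ₗ[F] Dual F V →ₗ[F] Poly F V,
      (∀ g ∈ G, FixesKer g l → ∀ w y, polyAct g (A w y) = A (g w) (dualAct g y)) →
      (∀ w, l w = 0 → ∀ y, y u = 0 → lin l ^ reflIndex G H ∣ A w y - y w • A u l) ∧
      (∀ w, l w = 0 → lin l ^ (reflIndex G H + 1) ∣ A w l) ∧
      (∀ y, y u = 0 → lin l ^ reflIndex G H ∣ lin l * A u y) := by
  obtain ⟨s, hs, hsfix, u, ζ, hu, hsu, hζ⟩ := exists_diagonal_generator hG hl hker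
  refine ⟨u, hu, fun A hA => ?_⟩
  have hζ0 : ζ ≠ 0 := hζ.ne_zero (reflIndex_pos hG H).ne'
  have hsl : dualAct s l = ζ⁻¹ • l := dualAct_eq_smul_of_eigenvector hsfix hu hζ0 hsu
  have hsy : ∀ y : Dual F V, y u = 0 → dualAct s y = y := fun y hy => by
    have h1 : s⁻¹ u = ζ⁻¹ • u := by
      rw [LinearEquiv.coe_inv, LinearEquiv.symm_apply_eq, map_smul, hsu, smul_smul,
        inv_mul_cancel₀ hζ0, one_smul]
    rw [hsfix.dualAct_eq hu, h1, map_smul, hy, smul_zero, sub_zero, zero_smul, add_zero]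
  -- the action of a transvection `t` on `V*`, in terms of its root vector `t u - u`
  have hty : ∀ t, FixesKer t l → l (t u - u) = 0 → ∀ y : Dual F V,
      dualAct t y = y - y (t u - u) • l := fun t ht h0 y => by
    have h1 : t⁻¹ u = u - (t u - u) := by
      rw [LinearEquiv.coe_inv, LinearEquiv.symm_apply_eq, map_sub, ht _ h0]
      abel
    rw [ht.dualAct_eq hu, h1, map_sub]
    module
  have htl : ∀ t, FixesKer t l → l (t u - u) = 0 → dualAct t l = l := fun t ht h0 => by
    rw [hty t ht h0, h0, zero_smul, sub_zero]
  have hAu : ∀ t ∈ G, FixesKer t l → l (t u - u) = 0 →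
      polyAct t (A u l) = A u l + A (t u - u) l := fun t ht hfix h0 => by
    rw [hA t ht hfix, htl t hfix h0, ← LinearMap.add_apply, ← map_add, add_sub_cancel]
  have hdiv1 : ∀ w, l w = 0 → lin l ∣ A w l := fun w hw =>
    hyperplane_induction (P := fun w => lin l ∣ A w l) hker hroot hu (by simp)
      (fun w w' _ _ h h' => by
        rw [map_add, LinearMap.add_apply]
        exact dvd_add h h')
      (fun c w _ h => by
        rw [map_smul, LinearMap.smul_apply]
        exact dvd_smul_of_dvd c h)
      (fun t ht hfix h0 => by
        have := hfix.lin_dvd hl (A u l)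
        rwa [hAu t ht hfix h0, add_sub_cancel_left] at this) hw
  have hdiv2 : ∀ y : Dual F V, ∀ w, l w = 0 → lin l ∣ A w y - y w • A u l :=
    fun y w hw =>
    hyperplane_induction (P := fun w => lin l ∣ A w y - y w • A u l) hker hroot hu (by simp)
      (fun w w' _ _ h h' => by
        have := dvd_add h h'
        rw [map_add, map_add, LinearMap.add_apply, add_smul]
        convert this using 1
        ring)
      (fun c w _ h => by
        rw [map_smul, map_smul, LinearMap.smul_apply, smul_eq_mul, mul_smul, ← smul_sub]
        exact dvd_smul_of_dvd c h)
      (fun t ht hfix h0 => by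
        have h1 := hfix.lin_dvd hl (A u y)
        have h2 : t u = u + (t u - u) := by abel
        rw [hA t ht hfix, hty t hfix h0] at h1
        set w := t u - u
        rw [h2, map_add, LinearMap.add_apply, (A u).map_sub, (A w).map_sub, (A u).map_smul,
          (A w).map_smul] at h1
        have h3 := dvd_add h1 (dvd_smul_of_dvd (y w) (hdiv1 w h0))
        convert h3 using 1
        abel) hw
  have hdiv3 : ∀ w, l w = 0 → ∀ y, y u = 0 →
      lin l ^ reflIndex G H ∣ A w y - y w • A u l := by
    intro w hw y hy
    refine lin_pow_dvd_of_invariant hsfix hl hζ hsl ?_ (hdiv2 y w hw)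
    have h1 : A (s u) (ζ⁻¹ • l) = A u l := by
      rw [hsu, map_smul, map_smul, LinearMap.smul_apply, smul_smul, inv_mul_cancel₀ hζ0, one_smul]
    rw [map_sub, map_smul, hA s hs hsfix, hA s hs hsfix, hsfix w hw, hsy y hy, hsl, h1]
  refine ⟨hdiv3, fun w hw => ?_, fun y hy => ?_⟩
  · rcases eq_or_ne w 0 with rfl | hw0
    · rw [map_zero, LinearMap.zero_apply]
      exact dvd_zero _
    obtain ⟨y, hyu, hyw⟩ := exists_dual_apply_eq_one hu hw hw0
    -- a transvection moves `A w y - y w • A u l` by a multiple of `l ^ (e_H + 1)`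
    have hsym : ∀ x, l x = 0 →
        lin l ^ (reflIndex G H + 1) ∣ y x • A w l + y w • A x l := fun x hx =>
      hyperplane_induction (P := fun x => lin l ^ (reflIndex G H + 1) ∣ y x • A w l + y w • A x l)
        hker hroot hu (by simp)
        (fun x x' _ _ h h' => by
          have := dvd_add h h'
          rw [map_add, map_add, LinearMap.add_apply, add_smul, smul_add]
          convert this using 1
          abel)
        (fun c x _ h => by
          rw [map_smul, map_smul, LinearMap.smul_apply, smul_eq_mul, mul_smul, smul_comm (y w) c,
            ← smul_add]
          exact dvd_smul_of_dvd c h)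
        (fun t ht hfix h0 => by
          have h1 := polyAct_sub_dvd_of_pow_dvd hfix hl (htl t hfix h0) (hdiv3 w hw y hyu)
          rw [map_sub, map_smul, hA t ht hfix w y, hAu t ht hfix h0, hfix w hw,
            hty t hfix h0] at h1
          set x := t u - u
          rw [map_sub, map_smul, ← dvd_neg] at h1
          convert h1 using 1
          rw [smul_add]
          abel) hx
    have h2 := hsym w hw
    rw [hyw, one_smul, ← two_smul F] at h2
    exact dvd_of_dvd_smul (Ring.two_ne_zero hchar) h2
  · refine lin_pow_dvd_of_invariant hsfix hl hζ hsl ?_ (Dvd.intro _ rfl)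
    rw [map_mul, polyAct_lin, hA s hs hsfix, hsl, hsy y hy, hsu, lin_smul, map_smul,
      LinearMap.smul_apply, smul_mul_smul_comm, inv_mul_cancel₀ hζ0, one_smul]

variable {n : ℕ}

/-- The derivations tangent to `l = 0` are generated by the vectors of this hyperplane and by `l u`
for a vector `u` outside. -/
theorem logDer_le_span (v : Basis (Fin n) F V) {l : Dual F V} {u : V} (hu : l u = 1) :
    logDer l ≤ Submodule.span (Poly F V)
      ({φ | ∃ w, l w = 0 ∧ φ = 1 ⊗ₜ w} ∪ {lin l • (1 ⊗ₜ u)}) := by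
  obtain ⟨w, i, hwi, hcoord, hw⟩ := exists_adapted_basis v hu
  intro φ hφ
  rw [← sum_ev_coord w φ]
  refine Submodule.sum_mem _ fun j _ => ?_
  by_cases hj : j = i
  · subst hj
    obtain ⟨a, ha⟩ := mem_logDer.1 hφ
    rw [hcoord, hwi, ha, mul_comm, mul_smul]
    exact Submodule.smul_mem _ _ (Submodule.subset_span (Or.inr rfl))
  · exact Submodule.smul_mem _ _ (Submodule.subset_span (Or.inl ⟨w j, hw j hj, rfl⟩))

/-- The family `B` of polynomials, indexed by linear forms, consists of the components of a
derivation that is `l ^ m` times a derivation tangent to `l = 0`. -/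
def IsTangent (l : Dual F V) (m : ℕ) (B : Dual F V → Poly F V) : Prop :=
  (∀ y, lin l ^ m ∣ B y) ∧ lin l ^ (m + 1) ∣ B l

theorem isTangent_zero (l : Dual F V) (m : ℕ) : IsTangent l m fun _ => 0 :=
  ⟨fun _ => dvd_zero _, dvd_zero _⟩

theorem IsTangent.add {l : Dual F V} {m : ℕ} {B C : Dual F V → Poly F V} (hB : IsTangent l m B)
    (hC : IsTangent l m C) : IsTangent l m fun y => B y + C y :=
  ⟨fun y => dvd_add (hB.1 y) (hC.1 y), dvd_add hB.2 hC.2⟩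

theorem IsTangent.mul {l : Dual F V} {m : ℕ} {B : Dual F V → Poly F V} (hB : IsTangent l m B)
    (a : Poly F V) : IsTangent l m fun y => a * B y :=
  ⟨fun y => (hB.1 y).mul_left a, hB.2.mul_left a⟩

theorem isTangent_of_forall {l : Dual F V} {u : V} (hu : l u = 1) {m : ℕ}
    {B : Dual F V →ₗ[F] Poly F V} (h1 : ∀ y, y u = 0 → lin l ^ m ∣ B y)
    (h2 : lin l ^ (m + 1) ∣ B l) : IsTangent l m B := by
  refine ⟨fun y => ?_, h2⟩
  have h3 : y = (y - y u • l) + y u • l := by abel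
  rw [h3, map_add, map_smul]
  exact dvd_add (h1 _ (by simp [hu]))
    (dvd_smul_of_dvd _ ((pow_dvd_pow _ (Nat.le_succ m)).trans h2))

/-- Values of a differential derivation, with one argument and the component left free. -/
noncomputable def evalBilin (η : DiffDer F V) (L : List V) : V →ₗ[F] Dual F V →ₗ[F] Poly F V :=
  LinearMap.mk₂ F (fun w y => evalAtDers ((w :: L).map fun w => (1 ⊗ₜ w : Der F V)) (comp y η))
    (fun w w' y => by simp [TensorProduct.tmul_add])
    (fun c w y => by
      simp only [List.map_cons, evalAtDers_cons, TensorProduct.tmul_smul,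
        LinearMap.map_smul_of_tower, LinearMap.smul_apply])
    (fun w y y' => by simp [comp_add])
    (fun c w y => by simp only [comp_smul, LinearMap.map_smul_of_tower])

theorem evalBilin_apply (η : DiffDer F V) (L : List V) (w : V) (y : Dual F V) :
    evalBilin η L w y =
      evalAtDers ((w :: L).map fun w => (1 ⊗ₜ w : Der F V)) (comp y η) := rfl

theorem polyAct_evalBilin {η : DiffDer F V} (hη : η ∈ invDiffDer G) {g : V ≃ₗ[F] V} (hg : g ∈ G)
    {L : List V} (hL : ∀ w ∈ L, g w = w) (w : V) (y : Dual F V) :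
    polyAct g (evalBilin η L w y) = evalBilin η L (g w) (dualAct g y) := by
  rw [evalBilin_apply, evalBilin_apply, ← evalAtDers_formAct, ← comp_diffDerAct,
    mem_invDiffDer.1 hη g hg, List.map_map, List.map_cons, List.map_cons]
  have h1 : ∀ w : V, (derAct g ∘ fun w => (1 ⊗ₜ w : Der F V)) w = 1 ⊗ₜ g w := fun w => by
    rw [Function.comp_apply, derAct_tmul, map_one]
  rw [h1]
  congr 3
  refine List.map_congr_left fun x hx => ?_
  rw [h1, hL x hx]

end Local

/-! ### Values of invariant differential derivations -/

section Values

variable {F V : Type*} [Field F] [AddCommGroup V] [Module F V] {G : Subgroup (V ≃ₗ[F] V)}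

/-- Tangency of all values at lists of derivations from a set extends to the span of the set, by
linearity in each argument. -/
theorem isTangent_evalAtDers_span {l : Dual F V} {m : ℕ} (Γ : Set (Der F V)) (k : ℕ)
    (Λ : Dual F V → DiffForm F V)
    (h : ∀ L : List (Der F V), L.length = k → (∀ φ ∈ L, φ ∈ Γ) →
      IsTangent l m fun y => evalAtDers L (Λ y))
    (L : List (Der F V)) (hk : L.length = k)
    (hL : ∀ φ ∈ L, φ ∈ Submodule.span (Poly F V) Γ) :
    IsTangent l m fun y => evalAtDers L (Λ y) := by
  induction k generalizing Λ L with
  | zero =>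
    rw [List.length_eq_zero_iff] at hk
    subst hk
    exact h [] rfl (by simp)
  | succ k ih =>
    rcases L with - | ⟨φ, L⟩
    · simp at hk
    refine ih (fun y => contr φ (Λ y)) (fun M hM hMΓ => ?_) L (by simpa using hk)
      fun ψ hψ => hL ψ (List.mem_cons_of_mem _ hψ)
    have hφ := hL φ List.mem_cons_self
    clear hk hL
    induction hφ using Submodule.span_induction with
    | mem φ hφ =>
      exact h (φ :: M) (by simp [hM]) fun ψ hψ => by
        rcases List.mem_cons.1 hψ with rfl | hψ
        · exact hφ
        · exact hMΓ ψ hψ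
    | zero => simpa using isTangent_zero l m
    | add φ ψ _ _ h1 h2 => simpa using h1.add h2
    | smul a φ _ h1 => simpa using h1.mul a

variable [Module.Finite F V] {n : ℕ}

/-- An invariant differential derivation of degree at least two takes values divisible by
`ℓ_H ^ e_H` at derivations tangent to `H`, with a quotient tangent to `H`. -/
theorem isTangent_evalAtDers (v : Basis (Fin n) F V) (hchar : ringChar F ≠ 2) (hG : Finite G)
    {H : Submodule F V} {l : Dual F V} (hl : l ≠ 0) (hker : LinearMap.ker l = H)
    (hroot : transvectionRootSpace G H = H) {η : DiffDer F V} (hη : η ∈ invDiffDer G)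
    (L : List (Der F V)) (hL : 2 ≤ L.length) (hmem : ∀ φ ∈ L, φ ∈ logDer l) :
    IsTangent l (reflIndex G H) fun y => evalAtDers L (comp y η) := by
  classical
  obtain ⟨u, hu, hloc⟩ := local_structure hchar hG hl hker hroot
  -- lists of vectors of the hyperplane, with one entry `w₀` set apart to obtain a repetition
  have hbase : ∀ w₀, l w₀ = 0 → ∀ L₀ : List V, (∀ w ∈ L₀, l w = 0) →
      (∀ w, l w = 0 → IsTangent l (reflIndex G H) (evalBilin η (w₀ :: L₀) w)) ∧
      IsTangent l (reflIndex G H) fun y => lin l * evalBilin η (w₀ :: L₀) u y := by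
    intro w₀ hw₀ L₀ hL₀
    obtain ⟨h1, h2, h3⟩ := hloc (evalBilin η (w₀ :: L₀)) fun g hg hfix w y =>
      polyAct_evalBilin hη hg (fun x hx => hfix x (by
        rcases List.mem_cons.1 hx with rfl | hx
        · exact hw₀
        · exact hL₀ x hx)) w y
    have h4 : lin l ^ reflIndex G H ∣ evalBilin η (w₀ :: L₀) u l := by
      rcases eq_or_ne w₀ 0 with rfl | hne
      · simp [evalBilin_apply]
      · obtain ⟨y, hyu, hyw⟩ := exists_dual_apply_eq_one hu hw₀ hne
        have h5 := h1 w₀ hw₀ y hyu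
        have h6 : evalBilin η (w₀ :: L₀) w₀ y = 0 := by
          rw [evalBilin_apply, List.map_cons]
          exact evalAtDers_eq_zero (by simp) _
        rwa [h6, hyw, one_smul, zero_sub, dvd_neg] at h5
    refine ⟨fun w hw => isTangent_of_forall hu (fun y hy => ?_) (h2 w hw), ?_⟩
    · have := dvd_add (h1 w hw y hy) (dvd_smul_of_dvd (y w) h4)
      rwa [sub_add_cancel] at this
    · refine isTangent_of_forall (B := (LinearMap.mulLeft F (lin l)) ∘ₗ evalBilin η (w₀ :: L₀) u)
        hu h3 ?_
      rw [LinearMap.comp_apply, LinearMap.mulLeft_apply, pow_succ']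
      exact mul_dvd_mul_left _ h4
  have hvec : ∀ L : List (Der F V), (∀ φ ∈ L, ∃ w, l w = 0 ∧ φ = 1 ⊗ₜ w) →
      ∃ L₀ : List V, (∀ w ∈ L₀, l w = 0) ∧ L = L₀.map fun w => 1 ⊗ₜ w := by
    intro L hL
    induction L with
    | nil => exact ⟨[], by simp⟩
    | cons φ L ih =>
      obtain ⟨L₀, h1, rfl⟩ := ih fun ψ hψ => hL ψ (List.mem_cons_of_mem _ hψ)
      obtain ⟨w, hw, rfl⟩ := hL φ List.mem_cons_self
      refine ⟨w :: L₀, fun x hx => ?_, rfl⟩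
      rcases List.mem_cons.1 hx with rfl | hx
      · exact hw
      · exact h1 x hx
  refine isTangent_evalAtDers_span _ L.length (fun y => comp y η) (fun M hM hMΓ => ?_) L rfl
    fun φ hφ => logDer_le_span v hu (hmem φ hφ)
  rw [← hM] at hL
  by_cases hall : ∀ φ ∈ M, ∃ w, l w = 0 ∧ φ = 1 ⊗ₜ w
  · obtain ⟨L₀, h1, rfl⟩ := hvec M hall
    rcases L₀ with - | ⟨w, - | ⟨w₀, L₀⟩⟩
    · simp at hL
    · simp at hL
    · exact (hbase w₀ (h1 w₀ (by simp)) L₀ fun x hx => h1 x (by simp [hx])).1 w (h1 w (by simp))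
  · push Not at hall
    obtain ⟨ξ, hξ, hnot⟩ := hall
    have hξeq : ξ = lin l • (1 ⊗ₜ u) := (hMΓ ξ hξ).resolve_left fun ⟨w, hw, hw'⟩ => hnot w hw hw'
    obtain ⟨L₁, L₂, rfl⟩ := List.append_of_mem hξ
    obtain ⟨ε, hε⟩ := exists_sign_evalAtDers_append ξ L₁ L₂
    have hsmul : ∀ M y, evalAtDers (ξ :: M) (comp y η) =
        lin l * evalAtDers ((1 ⊗ₜ u) :: M) (comp y η) := fun M y => by
      rw [evalAtDers_cons, hξeq, map_smul, LinearMap.smul_apply, map_smul, smul_eq_mul,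
        evalAtDers_cons]
    simp only [hε]
    suffices hgoal : IsTangent l (reflIndex G H) fun y => evalAtDers (ξ :: (L₁ ++ L₂)) (comp y η) by
      simp only [Algebra.smul_def]
      exact hgoal.mul _
    by_cases hall : ∀ φ ∈ L₁ ++ L₂, ∃ w, l w = 0 ∧ φ = 1 ⊗ₜ w
    · obtain ⟨L₀, h1, h2⟩ := hvec _ hall
      simp only [hsmul, h2]
      rcases L₀ with - | ⟨w₀, L₀⟩
      · rw [List.map_nil, List.append_eq_nil_iff] at h2
        obtain ⟨rfl, rfl⟩ := h2
        simp at hL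
      · exact (hbase w₀ (h1 w₀ (by simp)) L₀ fun x hx => h1 x (by simp [hx])).2
    · push Not at hall
      obtain ⟨ξ', hξ', hnot'⟩ := hall
      have hξ'eq : ξ' = ξ := by
        rw [hξeq]
        refine (hMΓ ξ' ?_).resolve_left fun ⟨w, hw, hw'⟩ => hnot' w hw hw'
        rw [List.mem_append, List.mem_cons]
        rcases List.mem_append.1 hξ' with h | h
        · exact Or.inl h
        · exact Or.inr (Or.inr h)
      simp only [evalAtDers_eq_zero (hξ'eq ▸ hξ')]
      exact isTangent_zero _ _

/-- Up to a multiple of the identity, an invariant differential derivation of degree one maps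
derivations tangent to `H` to `ℓ_H ^ e_H` times derivations tangent to `H`. -/
theorem exists_isTangent_sub (v : Basis (Fin n) F V) (hchar : ringChar F ≠ 2) (hG : Finite G)
    {H : Submodule F V} {l : Dual F V} (hl : l ≠ 0) (hker : LinearMap.ker l = H)
    (hroot : transvectionRootSpace G H = H) {η : DiffDer F V} (hη : η ∈ invDiffDer G) :
    ∃ b : Poly F V, ∀ φ ∈ logDer l,
      IsTangent l (reflIndex G H) fun y => evalAtDers [φ] (comp y η) - b * ev y φ := by
  obtain ⟨u, hu, hloc⟩ := local_structure hchar hG hl hker hroot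
  obtain ⟨h1, h2, h3⟩ := hloc (evalBilin η []) fun g hg _ w y =>
    polyAct_evalBilin hη hg (by simp) w y
  refine ⟨evalBilin η [] u l, fun φ hlog => ?_⟩
  have hφ := logDer_le_span v hu hlog
  clear hlog
  have hlin : ∀ w, IsTangent l (reflIndex G H)
      (fun y => evalBilin η [] w y - y w • evalBilin η [] u l) →
      IsTangent l (reflIndex G H) fun y => evalAtDers [(1 ⊗ₜ w : Der F V)] (comp y η) -
        evalBilin η [] u l * ev y (1 ⊗ₜ w) := fun w hw => by
    have h4 : ∀ y, evalBilin η [] u l * ev y (1 ⊗ₜ w) = y w • evalBilin η [] u l := fun y => by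
      rw [ev_tmul, mul_smul_comm, mul_one]
    simp only [h4]
    exact hw
  induction hφ using Submodule.span_induction with
  | mem φ hφ =>
    rcases hφ with ⟨w, hw, rfl⟩ | rfl
    · refine hlin w (isTangent_of_forall (B := evalBilin η [] w -
        (Dual.eval F V w).smulRight (evalBilin η [] u l)) hu (fun y hy => h1 w hw y hy) ?_)
      rw [LinearMap.sub_apply, LinearMap.smulRight_apply, Dual.eval_apply, hw, zero_smul, sub_zero]
      exact h2 w hw
    · have h4 : IsTangent l (reflIndex G H) fun y =>
          lin l * (evalBilin η [] u y - y u • evalBilin η [] u l) := by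
        refine isTangent_of_forall (B := (LinearMap.mulLeft F (lin l)) ∘ₗ (evalBilin η [] u -
          (Dual.eval F V u).smulRight (evalBilin η [] u l))) hu (fun y hy => ?_) ?_
        · rw [LinearMap.comp_apply, LinearMap.mulLeft_apply, LinearMap.sub_apply,
            LinearMap.smulRight_apply, Dual.eval_apply, hy, zero_smul, sub_zero]
          exact h3 y hy
        · rw [LinearMap.comp_apply, LinearMap.mulLeft_apply, LinearMap.sub_apply,
            LinearMap.smulRight_apply, Dual.eval_apply, hu, one_smul, sub_self, mul_zero]
          exact dvd_zero _
      convert h4 using 2 with y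
      have h5 : evalBilin η [] u y = evalAtDers [] (contr (1 ⊗ₜ u) (comp y η)) := by
        rw [evalBilin_apply, List.map_cons, List.map_nil, evalAtDers_cons]
      rw [evalAtDers_cons, map_smul, LinearMap.smul_apply, map_smul, map_smul, smul_eq_mul,
        smul_eq_mul, ev_tmul, ← h5, mul_sub, mul_smul_comm, mul_smul_comm, mul_smul_comm, mul_one,
        mul_comm (evalBilin η [] u l)]
  | zero => simpa using isTangent_zero l _
  | add φ ψ _ _ h4 h5 =>
    convert h4.add h5 using 2 with y
    simp only [evalAtDers_cons, map_add, LinearMap.add_apply]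
    ring
  | smul a φ _ h4 =>
    convert h4.mul a using 2 with y
    simp only [evalAtDers_cons, map_smul, LinearMap.smul_apply, smul_eq_mul]
    ring

end Values

/-! ### Expansion of invariant differential derivations -/

section Expansion

variable {F V : Type*} [Field F] [AddCommGroup V] [Module F V] {n : ℕ}

theorem sum_sub_smul {R M ι : Type*} [Ring R] [AddCommGroup M] [Module R M] [Fintype ι]
    (a b : ι → R) (x : ι → M) :
    ∑ i, (a i - b i) • x i = ∑ i, a i • x i - ∑ i, b i • x i := by
  simp only [sub_smul, Finset.sum_sub_distrib]

theorem sum_sub_ite_smul {R M ι : Type*} [Ring R] [AddCommGroup M] [Module R M] [Fintype ι]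
    [DecidableEq ι] (a : ι → R) (b : R) (x : ι → M) (i : ι) :
    ∑ j, (a j - if j = i then b else 0) • x j = ∑ j, a j • x j - b • x i := by
  simp [sum_sub_smul]

/-- The values of the components of a differential derivation at a list of derivations. -/
noncomputable def valueMap (L : List (Der F V)) (η : DiffDer F V) :
    Dual F V →ₗ[F] Poly F V where
  toFun y := evalAtDers L (comp y η)
  map_add' y z := by rw [comp_add, map_add]
  map_smul' c y := by rw [comp_smul, LinearMap.map_smul_of_tower, RingHom.id_apply]

theorem valueMap_apply (L : List (Der F V)) (η : DiffDer F V) (y : Dual F V) :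
    valueMap L η y = evalAtDers L (comp y η) := rfl

theorem exists_der_of_dvd (v : Basis (Fin n) F V) {q : Poly F V} (B : Dual F V →ₗ[F] Poly F V)
    (h : ∀ y, q ∣ B y) : ∃ d : Der F V, ∀ y, B y = q * ev y d := by
  choose c hc using h
  refine ⟨∑ i, c (v.coord i) ⊗ₜ v i, fun y => ?_⟩
  conv_lhs => rw [← v.sum_dual_apply_smul_coord y, map_sum]
  rw [map_sum, Finset.mul_sum]
  refine Finset.sum_congr rfl fun i _ => ?_
  rw [map_smul, hc, ev_tmul, mul_smul_comm]

theorem evalAtDers_pair_extEmb (φ : Der F V) (ω : OneForm F V) :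
    evalAtDers [φ] (extEmb (Poly F V) (Dual F V) ω) = pair ω φ := by
  have h := contr_extEmb_mul φ ω 1
  rw [mul_one, contr_one, mul_zero, sub_zero] at h
  rw [evalAtDers_cons, evalAtDers_nil, h, map_smul, degZero_one, smul_eq_mul, mul_one]

theorem evalAtDers_extEmb_eq_zero {L : List (Der F V)} (hL : L.length ≠ 1) (ω : OneForm F V) :
    evalAtDers L (extEmb (Poly F V) (Dual F V) ω) = 0 := by
  rcases L with - | ⟨φ, - | ⟨ψ, L⟩⟩
  · rw [evalAtDers_nil, ← mul_one (extEmb _ _ ω), degZero_extEmb_mul]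
  · exact absurd rfl hL
  · have h := contr_extEmb_mul φ ω 1
    rw [mul_one, contr_one, mul_zero, sub_zero] at h
    rw [evalAtDers_cons, evalAtDers_cons, h, map_smul, contr_one, smul_zero, map_zero]

theorem evalOn_dEuler_singleton (v : Basis (Fin n) F V) (θ : Fin n → Der F V) (i : Fin n)
    (y : Dual F V) : evalOn θ {i} (comp y (dEuler v)) = ev y (θ i) := by
  rw [comp_dEuler, evalOn, Finset.sort_singleton, List.map_cons, List.map_nil,
    evalAtDers_pair_extEmb, pair_tmul, one_mul]

theorem evalOn_dEuler_eq_zero (v : Basis (Fin n) F V) (θ : Fin n → Der F V)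
    {I : Finset (Fin n)} (hI : I.card ≠ 1) (y : Dual F V) :
    evalOn θ I (comp y (dEuler v)) = 0 := by
  rw [comp_dEuler, evalOn, evalAtDers_extEmb_eq_zero (by simpa using hI)]

variable {G : Subgroup (V ≃ₗ[F] V)} {ℓ : Submodule F V → Dual F V}

theorem lin_pow_dvd_of_dvd_Qe_mul (hG : Finite G)
    (hℓ : ∀ H ∈ reflArrangement G, LinearMap.ker (ℓ H) = H) {H : Submodule F V}
    (hH : H ∈ reflArrangement G) {m : ℕ} {a : Poly F V}
    (h : lin (ℓ H) ^ (reflIndex G H + m) ∣ Qe G ℓ * a) : lin (ℓ H) ^ m ∣ a := by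
  obtain ⟨R, hR, hndvd⟩ := arrProd_factor hG hℓ (reflIndex G) hH
  have hp := prime_lin (form_ne_zero hℓ hH)
  rw [Qe_eq_arrProd, hR, pow_add, mul_assoc] at h
  exact hp.pow_dvd_of_dvd_mul_left m hndvd
    ((mul_dvd_mul_iff_left (pow_ne_zero _ hp.ne_zero)).1 h)

variable (v : Basis (Fin n) F V) (θ : Basis (Fin n) (invPoly G) (invDer G))

theorem exists_pair_sum_basicDer (hG : Finite G)
    (hℓ : ∀ H ∈ reflArrangement G, LinearMap.ker (ℓ H) = H) (k : Fin n) :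
    ∃ c : F, c ≠ 0 ∧ ∀ a : Fin n → Poly F V,
      pair (basicForm v θ ℓ k) (∑ j, a j • basicDer θ j) = c • (Qe G ℓ * a k) := by
  obtain ⟨c, hc, h⟩ := exists_isDualSystem v θ hG hℓ
  obtain ⟨ε, hε, h⟩ := h k
  refine ⟨ε * c, mul_ne_zero (left_ne_zero_of_mul_eq_one hε) hc, fun a => ?_⟩
  rw [map_sum, Finset.sum_eq_single k
    (fun j _ hj => by rw [map_smul, h, if_neg (Ne.symm hj), smul_zero])
    (fun hk => absurd (Finset.mem_univ k) hk), map_smul, h, if_pos rfl, smul_smul, smul_eq_mul,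
    mul_smul_comm,
    mul_comm (a k)]

theorem eq_zero_of_sum_basicDer_eq_zero (v : Basis (Fin n) F V) (hG : Finite G)
    (hℓ : ∀ H ∈ reflArrangement G, LinearMap.ker (ℓ H) = H) {a : Fin n → Poly F V}
    (h : ∑ j, a j • basicDer θ j = 0) (k : Fin n) : a k = 0 := by
  obtain ⟨c, hc, hpair⟩ := exists_pair_sum_basicDer v θ hG hℓ k
  have h1 := hpair a
  rw [h, map_zero, eq_comm, smul_eq_zero] at h1
  exact (mul_eq_zero.1 (h1.resolve_left hc)).resolve_left (Qe_ne_zero hG hℓ)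

/-- The degree zero part of an invariant differential derivation is an invariant derivation. -/
theorem exists_values_empty (v : Basis (Fin n) F V) {η : DiffDer F V} (hη : η ∈ invDiffDer G) :
    ∃ a : Fin n → Poly F V, ∀ y,
      evalOn (basicDer θ) ∅ (comp y η) = ev y (∑ j, a j • basicDer θ j) := by
  obtain ⟨φ, hφ⟩ := exists_der_of_dvd v (valueMap [] η) fun y => one_dvd _
  simp only [one_mul, valueMap_apply] at hφ
  have hinv : φ ∈ invDer G := by
    refine mem_invDer.2 fun g hg => der_ext_ev v fun i => ?_
    have h : v.coord i = dualAct g (dualAct g⁻¹ (v.coord i)) := by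
      rw [← dualAct_mul, mul_inv_cancel, dualAct_one]
    rw [h, ev_dualAct_derAct, ← hφ, ← hφ, evalAtDers_nil, evalAtDers_nil,
      ← degZero_formAct, ← comp_diffDerAct,
      mem_invDiffDer.1 hη g hg]
  have hspan : φ ∈ Submodule.span (Poly F V) (invDer G : Set (Der F V)) :=
    Submodule.subset_span hinv
  rw [span_invDer θ] at hspan
  obtain ⟨a, ha⟩ := (Submodule.mem_span_range_iff_exists_fun _).1 hspan
  refine ⟨a, fun y => ?_⟩
  rw [ha, ← hφ, evalOn, Finset.sort_empty, List.map_nil]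

theorem exists_values_of_two_le (v : Basis (Fin n) F V) (hchar : ringChar F ≠ 2)
    (hG : Finite G) (hmax : TransvectionRootSpacesMaximal G)
    (hℓ : ∀ H ∈ reflArrangement G, LinearMap.ker (ℓ H) = H) {η : DiffDer F V}
    (hη : η ∈ invDiffDer G) {I : Finset (Fin n)} (hI : 2 ≤ I.card) :
    ∃ a : Fin n → Poly F V, ∀ y,
      evalOn (basicDer θ) I (comp y η) = Qe G ℓ * ev y (∑ j, a j • basicDer θ j) := by
  have := Module.Finite.of_basis v
  have htan : ∀ H ∈ reflArrangement G, IsTangent (ℓ H) (reflIndex G H)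
      (valueMap ((I.sort (· ≤ ·)).map (basicDer θ)) η) := fun H hH => by
    refine isTangent_evalAtDers v hchar hG (form_ne_zero hℓ hH) (hℓ H hH) (hmax H hH) hη _
      (by simpa using hI) fun φ hφ => ?_
    obtain ⟨j, -, rfl⟩ := List.mem_map.1 hφ
    exact basicDer_mem_logDer θ hℓ hH j
  obtain ⟨d, hd⟩ := exists_der_of_dvd v (q := Qe G ℓ)
    (valueMap ((I.sort (· ≤ ·)).map (basicDer θ)) η) fun y =>
      arrProd_dvd hG hℓ fun H hH => (htan H hH).1 y
  obtain ⟨a, rfl⟩ := exists_sum_basicDer_eq θ v hG hℓ (φ := d) fun H hH => by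
    have h := (htan H hH).2
    rw [hd] at h
    have h1 := lin_pow_dvd_of_dvd_Qe_mul hG hℓ hH h
    rwa [pow_one] at h1
  exact ⟨a, hd⟩

/-- The endomorphism of the module of derivations given by an invariant differential derivation of
degree one is, in the basis `θ`, congruent modulo `Q ^ e` to a multiple of the identity: this holds
modulo each factor `ℓ_H ^ e_H`. -/
theorem exists_values_singleton (v : Basis (Fin n) F V) (hchar : ringChar F ≠ 2)
    (hG : Finite G) (hmax : TransvectionRootSpacesMaximal G)
    (hℓ : ∀ H ∈ reflArrangement G, LinearMap.ker (ℓ H) = H) {η : DiffDer F V}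
    (hη : η ∈ invDiffDer G) :
    ∃ m : Fin n → Fin n → Poly F V,
      (∀ i y, evalOn (basicDer θ) {i} (comp y η) = ev y (∑ j, m i j • basicDer θ j)) ∧
      (∀ i j, i ≠ j → Qe G ℓ ∣ m i j) ∧ ∀ i j, Qe G ℓ ∣ m i i - m j j := by
  have := Module.Finite.of_basis v
  have hex : ∀ H ∈ reflArrangement G, ∃ b : Poly F V, ∀ i, IsTangent (ℓ H) (reflIndex G H)
      fun y => valueMap [basicDer θ i] η y - b * ev y (basicDer θ i) := fun H hH => by
    obtain ⟨b, hb⟩ := exists_isTangent_sub v hchar hG (form_ne_zero hℓ hH) (hℓ H hH) (hmax H hH) hη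
    exact ⟨b, fun i => hb _ (basicDer_mem_logDer θ hℓ hH i)⟩
  choose! b hb using hex
  have hm : ∀ i, ∃ m : Fin n → Poly F V, ∀ y,
      valueMap [basicDer θ i] η y = ev y (∑ j, m j • basicDer θ j) := fun i => by
    obtain ⟨d, hd⟩ := exists_der_of_dvd v (valueMap [basicDer θ i] η) fun y => one_dvd _
    simp only [one_mul] at hd
    obtain ⟨m, rfl⟩ := exists_sum_basicDer_eq θ v hG hℓ (φ := d) fun H hH => by
      have h := (dvd_pow_self _ (Nat.succ_ne_zero _)).trans (hb H hH i).2
      beta_reduce at h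
      rw [hd] at h
      exact (dvd_sub_left ((mem_logDer.1 (basicDer_mem_logDer θ hℓ hH i)).mul_left _)).1 h
    exact ⟨m, hd⟩
  choose m hm using hm
  have hdvd : ∀ H ∈ reflArrangement G, ∀ i k,
      lin (ℓ H) ^ reflIndex G H ∣ m i k - if k = i then b H else 0 := fun H hH i k => by
    obtain ⟨d, hd⟩ := exists_der_of_dvd v (q := lin (ℓ H) ^ reflIndex G H)
      { toFun := fun y => valueMap [basicDer θ i] η y - b H * ev y (basicDer θ i)
        map_add' := fun y z => by rw [map_add, ev_add]; ring
        map_smul' := fun c y => by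
          rw [map_smul, ev_smul, mul_smul_comm, ← smul_sub, RingHom.id_apply] }
      (hb H hH i).1
    have hlin := prime_lin (form_ne_zero hℓ hH)
    have hdlog : d ∈ logDer (ℓ H) := by
      have h := (hb H hH i).2
      have h1 := hd (ℓ H)
      rw [LinearMap.coe_mk, AddHom.coe_mk] at h1
      beta_reduce at h
      rw [h1, pow_succ] at h
      exact (mul_dvd_mul_iff_left (pow_ne_zero _ hlin.ne_zero)).1 h
    have hsum : ∑ j, (m i j - if j = i then b H else 0) • basicDer θ j =
        lin (ℓ H) ^ reflIndex G H • d := der_ext_ev v fun t => by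
      rw [(sum_sub_ite_smul (m i) (b H) (basicDer θ) i :), map_sub, ← hm, map_smul,
        map_smul, smul_eq_mul, smul_eq_mul, ← hd]
      rfl
    -- pairing with `ω_k` isolates the coefficient of `θ_k`
    obtain ⟨c, hc, hpair⟩ := exists_pair_sum_basicDer v θ hG hℓ k
    have h1 := hpair fun j => m i j - if j = i then b H else 0
    rw [hsum, map_smul, smul_eq_mul] at h1
    refine lin_pow_dvd_of_dvd_Qe_mul hG hℓ hH (dvd_of_dvd_smul hc ?_)
    rw [← h1, pow_add]
    refine mul_dvd_mul_left _ ?_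
    obtain ⟨σ, f, hσ⟩ := exists_basicForm_eq v θ hG hℓ hH k
    obtain ⟨z, hz⟩ := mem_logDer.1 hdlog
    refine ⟨pair σ d + f * z, ?_⟩
    obtain ⟨e, he⟩ := Nat.exists_eq_succ_of_ne_zero (reflIndex_pos hG H).ne'
    rw [hσ, he, Nat.succ_eq_add_one, Nat.add_sub_cancel, map_smul, map_add, map_smul, map_smul,
      LinearMap.smul_apply, LinearMap.add_apply, LinearMap.smul_apply, LinearMap.smul_apply,
      pair_tmul, one_mul, hz, smul_eq_mul, smul_eq_mul, smul_eq_mul]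
    ring
  refine ⟨m, fun i y => ?_, fun i j hij => ?_, fun i j => ?_⟩
  · rw [← hm, evalOn, Finset.sort_singleton, List.map_cons, List.map_nil, valueMap_apply]
  · refine arrProd_dvd hG hℓ fun H hH => ?_
    have h := hdvd H hH i j
    rwa [if_neg hij.symm, sub_zero] at h
  · refine arrProd_dvd hG hℓ fun H hH => ?_
    have h := dvd_sub (hdvd H hH i i) (hdvd H hH j j)
    rwa [if_pos rfl, if_pos rfl, sub_sub_sub_cancel_right] at h

theorem evalOn_comp_sum (hG : Finite G)
    (hℓ : ∀ H ∈ reflArrangement G, LinearMap.ker (ℓ H) = H) (a₀ : Poly F V)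
    (a : Finset (Fin n) × Fin n → Poly F V) (I : Finset (Fin n)) (y : Dual F V) :
    evalOn (basicDer θ) I (comp y (a₀ • dEuler v +
      ∑ p, a p • formMulDer (twistedWedge G ℓ (basicForm v θ ℓ) p.1) (basicDer θ p.2))) =
    a₀ * evalOn (basicDer θ) I (comp y (dEuler v)) +
      evalOn (basicDer θ) I (twistedWedge G ℓ (basicForm v θ ℓ) I) *
        ev y (∑ j, a (I, j) • basicDer θ j) := by
  rw [map_add, map_add, map_smul, map_smul, smul_eq_mul, map_sum, map_sum, Fintype.sum_prod_type,
    Finset.sum_eq_single I (fun J _ hJ => Finset.sum_eq_zero fun j _ => by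
      rw [map_smul, map_smul, comp_formMulDer, map_smul,
        evalOn_twistedWedge_of_ne v θ hG hℓ hJ.symm, smul_zero, smul_zero])
      (fun hI => absurd (Finset.mem_univ I) hI), map_sum, Finset.mul_sum]
  congr 1
  refine Finset.sum_congr rfl fun j _ => ?_
  rw [map_smul, map_smul, comp_formMulDer, map_smul, map_smul, smul_eq_mul, smul_eq_mul,
    smul_eq_mul]
  ring

/-- Every invariant differential derivation is an `S`-linear combination of the basis elements. -/
theorem exists_eq_sum (hchar : ringChar F ≠ 2) (hG : Finite G)
    (hmax : TransvectionRootSpacesMaximal G)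
    (hℓ : ∀ H ∈ reflArrangement G, LinearMap.ker (ℓ H) = H) {η : DiffDer F V}
    (hη : η ∈ invDiffDer G) (r : Fin n) :
    ∃ (a₀ : Poly F V) (a : Finset (Fin n) × Fin n → Poly F V), a ({r}, r) = 0 ∧
      η = a₀ • dEuler v +
        ∑ p, a p • formMulDer (twistedWedge G ℓ (basicForm v θ ℓ) p.1) (basicDer θ p.2) := by
  obtain ⟨m, hm, hne, hdiff⟩ := exists_values_singleton θ v hchar hG hmax hℓ hη
  have hex : ∀ I : Finset (Fin n), ∃ a : Fin n → Poly F V, (I = {r} → a r = 0) ∧ ∀ y,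
      evalOn (basicDer θ) I (comp y η) = m r r * evalOn (basicDer θ) I (comp y (dEuler v)) +
        evalOn (basicDer θ) I (twistedWedge G ℓ (basicForm v θ ℓ) I) *
          ev y (∑ j, a j • basicDer θ j) := fun I => by
    rcases I.eq_empty_or_nonempty with rfl | hI
    · obtain ⟨a, ha⟩ := exists_values_empty θ v hη
      refine ⟨a, fun h => absurd h (Finset.singleton_ne_empty r).symm, fun y => ?_⟩
      rw [ha, evalOn_dEuler_eq_zero v _ (by simp), evalOn_empty_twistedWedge, mul_zero, zero_add,
        one_mul]
    obtain ⟨c, hc, hself⟩ := exists_evalOn_twistedWedge_self v θ hG hℓ hI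
    have hsmul : ∀ (a : Fin n → Poly F V) (y : Dual F V),
        c • Qe G ℓ * ev y (∑ j, (c⁻¹ • a j) • basicDer θ j) =
          ev y (∑ j, (Qe G ℓ * a j) • basicDer θ j) := fun a y => by
      rw [← smul_eq_mul, ← map_smul, Finset.smul_sum]
      congr 1
      refine Finset.sum_congr rfl fun j _ => ?_
      rw [smul_smul, smul_mul_smul_comm, mul_inv_cancel₀ hc, one_smul]
    by_cases hcard : I.card = 1
    · obtain ⟨i, rfl⟩ := Finset.card_eq_one.1 hcard
      have hq : ∀ j, ∃ z, m i j - (if j = i then m r r else 0) = Qe G ℓ * z := fun j => by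
        split_ifs with h
        · exact h ▸ hdiff i r
        · rw [sub_zero]
          exact hne i j (Ne.symm h)
      choose z hz using hq
      refine ⟨fun j => c⁻¹ • z j, fun h => ?_, fun y => ?_⟩
      · have h1 := hz r
        rw [Finset.singleton_injective h, if_pos rfl, sub_self, zero_eq_mul] at h1
        have h2 := h1.resolve_left (Qe_ne_zero hG hℓ)
        simp [h2]
      · rw [hself, hsmul, hm, evalOn_dEuler_singleton]
        simp only [← hz]
        rw [(sum_sub_ite_smul (m i) (m r r) (basicDer θ) i :), map_sub, map_smul, smul_eq_mul]
        ring
    · have hpos := hI.card_pos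
      obtain ⟨a, ha⟩ := exists_values_of_two_le θ v hchar hG hmax hℓ hη (I := I) (by omega)
      refine ⟨fun j => c⁻¹ • a j, fun h => absurd (h ▸ Finset.card_singleton r) hcard,
        fun y => ?_⟩
      rw [ha, evalOn_dEuler_eq_zero v _ hcard, hself, hsmul, mul_zero, zero_add, ← smul_eq_mul,
        ← map_smul, Finset.smul_sum]
      simp only [smul_smul]
  choose a ha hval using hex
  obtain ⟨c, hc, hdual⟩ := exists_isDualSystem v θ hG hℓ
  refine ⟨m r r, fun p => a p.1 p.2, ha {r} rfl, ?_⟩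
  refine hdual.diffDer_ext (smul_ne_zero hc (Qe_ne_zero hG hℓ)) v
    (det_basicDer_ne_zero v θ hG hℓ) fun I y => ?_
  rw [evalOn_comp_sum v θ hG hℓ, hval]

/-- The coefficients of the expansion are unique. -/
theorem eq_zero_of_sum_eq_zero (hG : Finite G)
    (hℓ : ∀ H ∈ reflArrangement G, LinearMap.ker (ℓ H) = H) {r : Fin n} {a₀ : Poly F V}
    {a : Finset (Fin n) × Fin n → Poly F V} (ha : a ({r}, r) = 0)
    (h : a₀ • dEuler v + ∑ p, a p •
      formMulDer (twistedWedge G ℓ (basicForm v θ ℓ) p.1) (basicDer θ p.2) = 0) :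
    a₀ = 0 ∧ ∀ p, a p = 0 := by
  have hval : ∀ I y, a₀ * evalOn (basicDer θ) I (comp y (dEuler v)) +
      evalOn (basicDer θ) I (twistedWedge G ℓ (basicForm v θ ℓ) I) *
        ev y (∑ j, a (I, j) • basicDer θ j) = 0 := fun I y => by
    rw [← evalOn_comp_sum v θ hG hℓ, h, map_zero, map_zero]
  have h₀ : a₀ = 0 := by
    have h1 : ∑ j, ((if j = r then a₀ else 0) +
        evalOn (basicDer θ) {r} (twistedWedge G ℓ (basicForm v θ ℓ) {r}) * a ({r}, j)) •
          basicDer θ j = 0 := der_ext_ev v fun i => by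
      have h2 := hval {r} (v.coord i)
      rw [evalOn_dEuler_singleton] at h2
      rw [← smul_eq_mul, ← smul_eq_mul, ← map_smul, ← map_smul, ← map_add,
        Finset.smul_sum] at h2
      rw [map_zero]
      refine Eq.trans (congrArg _ ?_) h2
      simp only [add_smul, Finset.sum_add_distrib, ite_smul, zero_smul, Finset.sum_ite_eq',
        Finset.mem_univ, if_true, mul_smul]
    have h2 := eq_zero_of_sum_basicDer_eq_zero θ v hG hℓ h1 r
    rwa [if_pos rfl, ha, mul_zero, add_zero] at h2
  refine ⟨h₀, fun p => ?_⟩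
  obtain ⟨I, k⟩ := p
  have hne : evalOn (basicDer θ) I (twistedWedge G ℓ (basicForm v θ ℓ) I) ≠ 0 := by
    rcases I.eq_empty_or_nonempty with rfl | hI
    · rw [evalOn_empty_twistedWedge]
      exact one_ne_zero
    · obtain ⟨c, hc, hself⟩ := exists_evalOn_twistedWedge_self v θ hG hℓ hI
      rw [hself]
      exact smul_ne_zero hc (Qe_ne_zero hG hℓ)
  refine eq_zero_of_sum_basicDer_eq_zero θ v hG hℓ (a := fun j => a (I, j))
    (der_ext_ev v fun i => ?_) k
  have h1 := hval I (v.coord i)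
  rw [h₀, zero_mul, zero_add] at h1
  rw [map_zero]
  exact (mul_eq_zero.1 h1).resolve_left hne

/-- The coefficients of the expansion of an invariant differential derivation are invariant, since
they are unique. -/
theorem mem_invPoly_of_sum_mem (hG : IsReflectionGroup G)
    (hℓ : ∀ H ∈ reflArrangement G, LinearMap.ker (ℓ H) = H) {r : Fin n} {a₀ : Poly F V}
    {a : Finset (Fin n) × Fin n → Poly F V} (ha : a ({r}, r) = 0)
    (h : a₀ • dEuler v + ∑ p, a p •
      formMulDer (twistedWedge G ℓ (basicForm v θ ℓ) p.1) (basicDer θ p.2) ∈ invDiffDer G) :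
    a₀ ∈ invPoly G ∧ ∀ p, a p ∈ invPoly G := by
  suffices hg : ∀ g ∈ G, polyAct g a₀ - a₀ = 0 ∧ ∀ p, polyAct g (a p) - a p = 0 from
    ⟨fun g hgG => sub_eq_zero.1 (hg g hgG).1, fun p g hgG => sub_eq_zero.1 ((hg g hgG).2 p)⟩
  intro g hg
  refine eq_zero_of_sum_eq_zero v θ hG.1 hℓ (r := r) (a := fun p => polyAct g (a p) - a p)
    (by simp only [ha, map_zero, sub_zero]) ?_
  have := Module.Finite.of_basis v
  have h1 := mem_invDiffDer.1 h g hg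
  rw [map_add, map_sum, diffDerAct_smul, mem_invDiffDer.1 (dEuler_mem_invDiffDer v G) g hg] at h1
  have h2 : ∀ p : Finset (Fin n) × Fin n, diffDerAct g (a p •
      formMulDer (twistedWedge G ℓ (basicForm v θ ℓ) p.1) (basicDer θ p.2)) = polyAct g (a p) •
        formMulDer (twistedWedge G ℓ (basicForm v θ ℓ) p.1) (basicDer θ p.2) := fun p => by
    rw [diffDerAct_smul, mem_invDiffDer.1 (formMulDer_twistedWedge_mem v θ hG hℓ p.1 p.2) g hg]
  rw [Finset.sum_congr rfl fun p _ => h2 p] at h1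
  have h3 := sum_sub_smul (fun p => polyAct g (a p)) a fun p : Finset (Fin n) × Fin n =>
    formMulDer (twistedWedge G ℓ (basicForm v θ ℓ) p.1) (basicDer θ p.2)
  have h4 := sub_smul (polyAct g a₀) a₀ (dEuler v)
  refine (congrArg₂ (· + ·) h4 h3).trans ?_
  rw [sub_add_sub_comm, h1, sub_self]

theorem exists_basis_of_forall {R M ι : Type*} [CommRing R] [AddCommGroup M] [Module R M]
    [Fintype ι] (N : Submodule R M) (x : ι → M) (hx : ∀ i, x i ∈ N)
    (hind : ∀ c : ι → R, ∑ i, c i • x i = 0 → ∀ i, c i = 0)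
    (hspan : ∀ m ∈ N, ∃ c : ι → R, m = ∑ i, c i • x i) :
    ∃ B : Basis ι R N, ∀ i, (B i : M) = x i := by
  have hsum : ∀ c : ι → R, ((∑ i, c i • (⟨x i, hx i⟩ : N) : N) : M) = ∑ i, c i • x i := fun c => by
    rw [Submodule.coe_sum]
    rfl
  refine ⟨Basis.mk (v := fun i => (⟨x i, hx i⟩ : N))
    (Fintype.linearIndependent_iff.2 fun c hc => hind c ?_) ?_, fun i => by rw [Basis.mk_apply]⟩
  · rw [← hsum, hc, Submodule.coe_zero]
  · rintro ⟨m, hm⟩ -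
    obtain ⟨c, rfl⟩ := hspan m hm
    exact (Submodule.mem_span_range_iff_exists_fun _).2 ⟨c, Subtype.ext (hsum c)⟩

/-- The basis of the invariant differential derivations obtained by leaving out the element
indexed by `({r}, r)`. -/
theorem exists_basis (hchar : ringChar F ≠ 2) (hG : IsReflectionGroup G)
    (hmax : TransvectionRootSpacesMaximal G)
    (hℓ : ∀ H ∈ reflArrangement G, LinearMap.ker (ℓ H) = H) (r : Fin n) :
    ∃ B : Basis (Option {p : Finset (Fin n) × Fin n // p ≠ ({r}, r)}) (invPoly G) (invDiffDer G),
      (B none : DiffDer F V) = dEuler v ∧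
      ∀ p, (B (some p) : DiffDer F V) =
        formMulDer (twistedWedge G ℓ (basicForm v θ ℓ) p.1.1) (basicDer θ p.1.2) := by
  classical
  set x : Finset (Fin n) × Fin n → DiffDer F V := fun p =>
    formMulDer (twistedWedge G ℓ (basicForm v θ ℓ) p.1) (basicDer θ p.2) with hx
  have hsum : ∀ a : Finset (Fin n) × Fin n → Poly F V, a ({r}, r) = 0 →
      ∑ p, a p • x p = ∑ p : {p : Finset (Fin n) × Fin n // p ≠ ({r}, r)}, a p • x p := by
    intro a ha
    rw [← Finset.sum_filter_of_ne (p := fun p => p ≠ ({r}, r)) fun p _ hp hpr => hp (by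
      rw [hpr, ha, zero_smul])]
    exact Finset.sum_subtype _ (by simp) _
  have := Module.Finite.of_basis v
  obtain ⟨B, hB⟩ := exists_basis_of_forall (invDiffDer G)
    (fun o : Option {p : Finset (Fin n) × Fin n // p ≠ ({r}, r)} =>
      o.elim (dEuler v) fun p => x p)
    (by
      rintro (- | p)
      · exact dEuler_mem_invDiffDer v G
      · exact formMulDer_twistedWedge_mem v θ hG hℓ p.1.1 p.1.2)
    (by
      intro c hc
      rw [Fintype.sum_option] at hc
      have h1 : (c none : Poly F V) • dEuler v + ∑ p, (c (some p) : Poly F V) • x p = 0 := hc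
      have h2 := hsum (fun p => if h : p ≠ ({r}, r) then (c (some ⟨p, h⟩) : Poly F V) else 0)
        (dif_neg fun h => h rfl)
      have h3 := eq_zero_of_sum_eq_zero v θ hG.1 hℓ (r := r) (a₀ := c none)
        (a := fun p => if h : p ≠ ({r}, r) then (c (some ⟨p, h⟩) : Poly F V) else 0)
        (dif_neg fun h => h rfl) (by
          rw [← h1, add_right_inj]
          refine h2.trans (Finset.sum_congr rfl fun p _ => ?_)
          rw [dif_pos p.2])
      rintro (- | p)
      · exact Subtype.ext h3.1
      · have h4 := h3.2 p
        rw [dif_pos p.2] at h4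
        exact Subtype.ext h4)
    (by
      intro η hη
      obtain ⟨a₀, a, ha, rfl⟩ := exists_eq_sum v θ hchar hG.1 hmax hℓ hη r
      obtain ⟨h₀, h₁⟩ := mem_invPoly_of_sum_mem v θ hG hℓ ha hη
      refine ⟨fun o => o.elim ⟨a₀, h₀⟩ fun p => ⟨a p, h₁ p⟩, ?_⟩
      rw [Fintype.sum_option]
      exact congrArg (a₀ • dEuler v + ·) (hsum a ha))
  exact ⟨B, hB none, fun p => hB (some p)⟩

end Expansion

end InvDiffDer

theorem mainTheorem2 {F V : Type*} [Field F] [AddCommGroup V] [Module F V] {n : ℕ}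
    (hchar : ringChar F ≠ 2)
    (v : Module.Basis (Fin n) F V)
    (G : Subgroup (V ≃ₗ[F] V)) (hG : InvDiffDer.IsReflectionGroup G)
    (hmax : InvDiffDer.TransvectionRootSpacesMaximal G)
    (ℓ : Submodule F V → Module.Dual F V)
    (hℓ : ∀ H ∈ InvDiffDer.reflArrangement G, LinearMap.ker (ℓ H) = H)
    (θ : Module.Basis (Fin n) (InvDiffDer.invPoly G) (InvDiffDer.invDer G))
    (ω : Fin n → InvDiffDer.OneForm F V)
    (hω : ∀ i, ω i = InvDiffDer.dualOneForm v G ℓ (fun j => (θ j : InvDiffDer.Der F V)) i) :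
    Module.Free (InvDiffDer.invPoly G) (InvDiffDer.invDiffDer G) ∧
    (∀ I : Finset (Fin n), I.Nonempty →
      InvDiffDer.Qe G ℓ ^ (I.card - 1) • InvDiffDer.twistedWedge G ℓ ω I =
        InvDiffDer.orderedProd (fun i => InvDiffDer.oneFormToForm (ω i)) I) ∧
    ∀ r : Fin n,
      ∃ B : Module.Basis (Option {p : Finset (Fin n) × Fin n // p ≠ ({r}, r)})
          (InvDiffDer.invPoly G) (InvDiffDer.invDiffDer G),
        (B none : InvDiffDer.DiffDer F V) = InvDiffDer.dEuler v ∧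
        ∀ p, (B (some p) : InvDiffDer.DiffDer F V) =
          InvDiffDer.formMulDer (InvDiffDer.twistedWedge G ℓ ω p.1.1)
            (θ p.1.2 : InvDiffDer.Der F V) := by
  have := Module.Finite.of_basis v
  obtain rfl : ω = InvDiffDer.basicForm v θ ℓ := funext hω
  have hbasis := InvDiffDer.exists_basis v θ hchar hG hmax hℓ
  refine ⟨?_, fun I _ => InvDiffDer.Qe_pow_smul_twistedWedge v θ hG.1 hℓ I, hbasis⟩
  rcases n with - | n
  · -- in dimension zero all the modules vanish
    have hsub : Subsingleton (InvDiffDer.DiffDer F V) :=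
      ⟨fun η η' => InvDiffDer.diffDer_ext v fun i => i.elim0⟩
    have : Subsingleton (InvDiffDer.invDiffDer G) := ⟨fun a b => Subtype.ext (hsub.elim _ _)⟩
    exact Module.Free.of_subsingleton _ _
  · obtain ⟨B, -⟩ := hbasis 0
    exact Module.Free.of_basis B
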